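/- Let $X$ be a compact connected Riemann surface and let $f:X\to X$ be a holomorphic map of topological degree $\lambda\ge 2$. For $x\in X$ let $d(f,x)$ be the local degree (multiplicity) of $f$ at $x$. For a finite Borel measure $\nu$ on $X$, let $f^*\nu$ be the measure defined by $$\int_X\varphi\,d(f^*\nu)=\int_X\Big(\sum_{f(x)=y}d(f,x)\,\varphi(x)\Big)\,d\nu(y)\qquad(\varphi\in C(X)),$$ and define $(f^n)^*\nu$ in the same way from the iterate $f^n$. A measure is called smooth if it has a $C^\infty$ nonnegative density with respect to Lebesgue measure in every holomorphic chart. Let $$\mathcal E_f=\{x\in X:\ d(f,x)=d(f,f(x))=d(f,f^2(x))=\lambda\}$$ be the set of exceptional points of $f$. Then: 1. There is a unique Borel probability measure $\mu_f$ on $X$ such that $\lambda^{-n}(f^n)^*\sigma\to\mu_f$ weakly as $n\to\infty$ for every smooth probability measure $\sigma$ on $X$. 2. $\mathcal E_f$ has at most two points. 3. For every Borel probability measure $\nu$ on $X$, $$\lambda^{-n}(f^n)^*\nu\to\mu_f\ \text{ weakly}\quad\Longleftrightarrow\quad\nu(\mathcal E_f)=0.$$ 4. In particular, for every $a\in X$,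 writing $\delta_a$ for the Dirac mass at $a$, one has $\lambda^{-n}(f^n)^*\delta_a\to\mu_f$ weakly if and only if $a\notin\mathcal E_f$. -/

import Mathlib

open MeasureTheory Filter
open scoped Manifold ContDiff Topology ENNReal

namespace HolomorphicDynamics

noncomputable section

/-- The local degree `d(f, x)` of a holomorphic map `f` at `x`: the order of vanishing at the
point `x` of `f - f x`, read in the charts at `x` and at `f x`. -/
def localDegree {X : Type*} [TopologicalSpace X] [ChartedSpace ℂ X] (f : X → X) (x : X) : ℕ :=
  analyticOrderNatAt
    (fun z : ℂ => writtenInExtChartAt 𝓘(ℂ) 𝓘(ℂ) x f z - extChartAt 𝓘(ℂ) (f x) (f x))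
    (extChartAt 𝓘(ℂ) x x)

/-- The topological degree of `f`: the number of preimages of all but finitely many points. There
is at most one such number when `X` is infinite; the value is `0` if there is none. -/
def topologicalDegree {X : Type*} (f : X → X) : ℕ :=
  sInf {d : ℕ | ∀ᶠ y in cofinite, (f ⁻¹' {y}).Finite ∧ (f ⁻¹' {y}).ncard = d}

/-- The set of exceptional points of `f`: the points `x` such that `x`, `f x` and `f (f x)` are
all totally ramified. -/
def exceptionalSet {X : Type*} [TopologicalSpace X] [ChartedSpace ℂ X] (f : X → X) : Set X :=
  {x | localDegree f x = topologicalDegree f ∧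
    localDegree f (f x) = topologicalDegree f ∧
    localDegree f (f (f x)) = topologicalDegree f}

/-- The fibre of `f` over `y`, counted with multiplicity: the measure
`∑ d(f, x) δ_x`, the sum being over the points `x` such that `f x = y`. -/
def fiberMeasure {X : Type*} [TopologicalSpace X] [ChartedSpace ℂ X] [MeasurableSpace X]
    (f : X → X) (y : X) : Measure X :=
  Measure.sum fun x : f ⁻¹' {y} => (localDegree f (x : X) : ℝ≥0∞) • Measure.dirac (x : X)

/-- The pullback `f^* ν` of a measure: it gives to a Borel set `A` the mass
`∫ (∑_{f x = y} d(f, x) 1_A(x)) dν(y)`. In other words, it is dual to the push-forward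
`(f_* φ)(y) = ∑_{f x = y} d(f, x) φ(x)` of functions. -/
def pullback {X : Type*} [TopologicalSpace X] [ChartedSpace ℂ X] [MeasurableSpace X]
    (f : X → X) (ν : Measure X) : Measure X :=
  ν.bind (fiberMeasure f)

/-- The measure `λ^{-n} (f^n)^* ν`, where `λ` is the topological degree of `f`. -/
def normalizedPullback {X : Type*} [TopologicalSpace X] [ChartedSpace ℂ X] [MeasurableSpace X]
    (f : X → X) (n : ℕ) (ν : Measure X) : Measure X :=
  ((topologicalDegree f : ℝ≥0∞) ^ n)⁻¹ • pullback (f^[n]) ν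

/-- Weak convergence of measures: convergence of the integrals of all continuous functions
(used on compact spaces). -/
def WeakTendsto {X : Type*} [TopologicalSpace X] [MeasurableSpace X]
    (m : ℕ → Measure X) (μ : Measure X) : Prop :=
  ∀ φ : C(X, ℝ), Tendsto (fun n => ∫ x, φ x ∂(m n)) atTop (𝓝 (∫ x, φ x ∂μ))

/-- A measure on a Riemann surface is smooth if in every chart it has a smooth nonnegative density
with respect to Lebesgue measure, i.e. if it is given by a smooth nonnegative `(1,1)`-form. -/
def IsSmoothMeasure {X : Type*} [TopologicalSpace X] [ChartedSpace ℂ X] [MeasurableSpace X]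
    (σ : Measure X) : Prop :=
  ∀ e ∈ atlas ℂ X, ∃ ρ : ℂ → ℝ, ContDiffOn ℝ ∞ ρ e.target ∧ (∀ z ∈ e.target, 0 ≤ ρ z) ∧
    ∀ A : Set ℂ, MeasurableSet A → A ⊆ e.target →
      σ (e.source ∩ e ⁻¹' A) = ∫⁻ z in A, ENNReal.ofReal (ρ z)

/-- `μ` is the limit measure of `f`: the probability measure which is the weak limit of
`λ^{-n} (f^n)^* σ` for every smooth probability measure `σ`. -/
structure IsCanonicalMeasure {X : Type*} [TopologicalSpace X] [ChartedSpace ℂ X]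
    [MeasurableSpace X] (f : X → X) (μ : Measure X) : Prop where
  isProbabilityMeasure : IsProbabilityMeasure μ
  weakTendsto : ∀ σ : Measure X, IsProbabilityMeasure σ → IsSmoothMeasure σ →
    WeakTendsto (fun n => normalizedPullback f n σ) μ

open Classical in
/-- The canonical measure `μ_f` (and `0` if there is no such measure). -/
def canonicalMeasure {X : Type*} [TopologicalSpace X] [ChartedSpace ℂ X] [MeasurableSpace X]
    (f : X → X) : Measure X :=
  if h : ∃ μ : Measure X, IsCanonicalMeasure f μ then h.choose else 0

end

end HolomorphicDynamics

namespace HolomorphicDynamics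

set_option linter.unusedSectionVars false

open Metric Set

/-! Write λ for the degree, E for the exceptional set and T for the operator `transfer f`, which
averages a function over the fibres of `f` with multiplicity. By duality
(`integral_normalizedPullback`) the integral of φ against the n-th normalized pullback of ν is the
ν-integral of T^n φ. So the theorem is a statement about the functions T^n φ, and its heart is
`tendsto_transfer_sub`: T^n φ(a) - T^n φ(b) tends to 0 for any two points a, b outside E.

Two estimates compete. By Cauchy–Schwarz over the λ inverse branches, and because the Dirichlet
integral is a conformal invariant, the energy of T^k φ is O(λ^{-k}) (`EnergyLE.transfer`). On the
other hand, if the local degrees are at most δ, the fibres over two nearby points can be matched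
with d(x, x')^δ ≤ C d(a, b). Iterating this, T^k φ varies by at most η over distances exp(-B δ^k)
(`exists_modulus`). Bipolar coordinates send a rectangle of height π and half-length about B δ^k
into a chart, with its two short sides within such distances of a and b. The length-area inequality
(`sq_le_of_energy_strip`) then bounds the squared oscillation by a constant times δ^k λ^{-k}, which
tends to 0 when δ < λ (`exists_nhds_tendsto_transfer_sub`).

To have δ < λ, pass to the third iterate: its local degree is a product of three local degrees of
`f`, and equals λ^3 only on E. The set E is finite, completely invariant and made of ramified
points, so it has small forward invariant neighbourhoods U (`exists_trapping`). The estimates are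
made on the complement of U, which is backward invariant. Connectedness of X chains the local
statements together.

A weak limit μ of the pullbacks of one Dirac mass along an ultrafilter is then T-invariant and does
not charge E, and dominated convergence gives convergence to μ for every ν with ν(E) = 0. Smooth
measures are of this kind. Conversely some continuous ψ ≥ 0 equals 1 on E and has μ-integral 0; as
T^n ψ = 1 on E for all n, convergence to μ forces ν(E) = 0.

All this uses that there are at most two totally ramified points (`encard_totallyRamified_le`). That
is Riemann–Hurwitz: comparing the orders of f^*η and η for a meromorphic form η of degree at least
-2, a totally ramified point contributes λ - 1 to a total of at most 2(λ - 1). The form has one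
double pole and is obtained by Dirichlet's principle: orthogonal projection in L² onto the closure
of the exact forms, then Weyl's lemma. That the orders of a meromorphic function add up to 0
follows, like the constancy of the degree, from the local constancy of fibre counts
(`fiberSum_one_eq`). -/

lemma enat_eq_one_of_mul {a b : ℕ∞} (h : a * b = 1) : a = 1 := by
  have hb : b ≠ ⊤ := by
    rintro rfl
    rcases eq_or_ne a 0 with rfl | ha
    · simp at h
    · rw [ENat.mul_top ha] at h; exact absurd h (by simp)
  have ha : a ≠ ⊤ := by
    rintro rfl
    rcases eq_or_ne b 0 with rfl | hb
    · simp at h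
    · rw [ENat.top_mul hb] at h; exact absurd h (by simp)
  lift a to ℕ using ha
  lift b to ℕ using hb
  norm_cast at h ⊢
  exact Nat.eq_one_of_mul_eq_one_right h

/-! ### Holomorphy at a point, orders of vanishing, local normal forms -/

section Holomorphic

variable {M N P : Type*} [TopologicalSpace M] [ChartedSpace ℂ M] [TopologicalSpace N]
  [ChartedSpace ℂ N] [TopologicalSpace P] [ChartedSpace ℂ P]

/-- `f` is holomorphic in a neighbourhood of `x`. -/
def HolAt (f : M → N) (x : M) : Prop := ∀ᶠ y in 𝓝 x, MDifferentiableAt 𝓘(ℂ) 𝓘(ℂ) f y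

lemma HolAt.mdifferentiableAt {f : M → N} {x : M} (h : HolAt f x) :
    MDifferentiableAt 𝓘(ℂ) 𝓘(ℂ) f x := h.self_of_nhds

lemma HolAt.continuousAt {f : M → N} {x : M} (h : HolAt f x) : ContinuousAt f x :=
  h.mdifferentiableAt.continuousAt

lemma HolAt.eventually {f : M → N} {x : M} (h : HolAt f x) : ∀ᶠ y in 𝓝 x, HolAt f y :=
  h.eventually_nhds

lemma HolAt.comp {g : N → P} {f : M → N} {x : M} (hg : HolAt g (f x)) (hf : HolAt f x) :
    HolAt (g ∘ f) x := by
  have h := hf.continuousAt.eventually hg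
  filter_upwards [h, hf] with y hy hy'
  exact hy.comp y hy'

lemma HolAt.congr {f g : M → N} {x : M} (hf : HolAt f x) (h : f =ᶠ[𝓝 x] g) : HolAt g x := by
  filter_upwards [h.eventually_nhds, hf] with y hy hy'
  exact hy'.congr_of_eventuallyEq (EventuallyEq.symm hy)

lemma holAt_iff_analyticAt {f : ℂ → ℂ} {z : ℂ} : HolAt f z ↔ AnalyticAt ℂ f z := by
  simp only [HolAt, mdifferentiableAt_iff_differentiableAt]
  exact Complex.analyticAt_iff_eventually_differentiableAt.symm

lemma _root_.MDifferentiable.holAt {f : M → N} (hf : MDifferentiable 𝓘(ℂ) 𝓘(ℂ) f) (x : M) :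
    HolAt f x := Eventually.of_forall hf

lemma holAt_of_mdifferentiableOn {f : M → N} {s : Set M} (hs : IsOpen s)
    (hf : MDifferentiableOn 𝓘(ℂ) 𝓘(ℂ) f s) {x : M} (hx : x ∈ s) : HolAt f x := by
  filter_upwards [hs.mem_nhds hx] with y hy
  exact (hf y hy).mdifferentiableAt (hs.mem_nhds hy)

end Holomorphic

section Surface

variable {X : Type*} [TopologicalSpace X] [ChartedSpace ℂ X] [IsManifold 𝓘(ℂ) ω X]

instance isManifold_one : IsManifold 𝓘(ℂ) 1 X := IsManifold.of_le (n := ω) le_top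

lemma holAt_of_mem_atlas {e : OpenPartialHomeomorph X ℂ} (he : e ∈ atlas ℂ X) {x : X}
    (hx : x ∈ e.source) : HolAt e x :=
  holAt_of_mdifferentiableOn e.open_source (mdifferentiableOn_atlas he) hx

lemma holAt_symm_of_mem_atlas {e : OpenPartialHomeomorph X ℂ} (he : e ∈ atlas ℂ X) {z : ℂ}
    (hz : z ∈ e.target) : HolAt e.symm z :=
  holAt_of_mdifferentiableOn e.open_target (mdifferentiableOn_atlas_symm he) hz

lemma holAt_chartAt {x y : X} (hy : y ∈ (chartAt ℂ x).source) : HolAt (chartAt ℂ x) y :=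
  holAt_of_mem_atlas (chart_mem_atlas ℂ x) hy

lemma holAt_chartAt_symm {x : X} {z : ℂ} (hz : z ∈ (chartAt ℂ x).target) :
    HolAt (chartAt ℂ x).symm z :=
  holAt_symm_of_mem_atlas (chart_mem_atlas ℂ x) hz

/-- The order of vanishing at `x` of `q - q x`, read in the chart at `x`. -/
noncomputable def ordAt (q : X → ℂ) (x : X) : ℕ∞ :=
  analyticOrderAt (fun z => q ((chartAt ℂ x).symm z) - q x) (chartAt ℂ x x)

lemma HolAt.analyticAt_comp_symm {q : X → ℂ} {x : X} (hq : HolAt q x) :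
    AnalyticAt ℂ (fun z => q ((chartAt ℂ x).symm z)) (chartAt ℂ x x) := by
  rw [← holAt_iff_analyticAt]
  refine HolAt.comp (g := q) (f := (chartAt ℂ x).symm) ?_ (holAt_chartAt_symm (mem_chart_target ℂ x))
  rwa [(chartAt ℂ x).left_inv (mem_chart_source ℂ x)]

lemma ordAt_ne_zero {q : X → ℂ} {x : X} (hq : HolAt q x) : ordAt q x ≠ 0 := by
  rw [ordAt, analyticOrderAt_ne_zero]
  exact ⟨hq.analyticAt_comp_symm.sub analyticAt_const, by simp⟩

lemma ordAt_congr {q q' : X → ℂ} {x : X} (h : q =ᶠ[𝓝 x] q') : ordAt q x = ordAt q' x := by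
  refine analyticOrderAt_congr ?_
  have : Tendsto (chartAt ℂ x).symm (𝓝 (chartAt ℂ x x)) (𝓝 x) := by
    have := (chartAt ℂ x).continuousAt_symm (mem_chart_target ℂ x)
    rwa [ContinuousAt, (chartAt ℂ x).left_inv (mem_chart_source ℂ x)] at this
  filter_upwards [this.eventually h] with z hz
  rw [hz, h.self_of_nhds]

/-- The order along a holomorphic curve. -/
lemma analyticOrderAt_comp_curve {q : X → ℂ} {k : ℂ → X} {z : ℂ} (hq : HolAt q (k z))
    (hk : HolAt k z) :
    analyticOrderAt (fun w => q (k w) - q (k z)) z =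
      ordAt q (k z) * analyticOrderAt (fun w => chartAt ℂ (k z) (k w) - chartAt ℂ (k z) (k z)) z := by
  set e := chartAt ℂ (k z)
  have h1 : AnalyticAt ℂ (fun w => e (k w)) z := by
    rw [← holAt_iff_analyticAt]
    exact HolAt.comp (g := e) (f := k) (holAt_chartAt (mem_chart_source ℂ _)) hk
  have h2 : AnalyticAt ℂ (fun w => q (e.symm w) - q (k z)) (e (k z)) :=
    hq.analyticAt_comp_symm.sub analyticAt_const
  rw [ordAt, ← AnalyticAt.analyticOrderAt_comp (g := fun w => e (k w)) h2 h1]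
  refine analyticOrderAt_congr ?_
  filter_upwards [hk.continuousAt.eventually (e.open_source.mem_nhds (mem_chart_source ℂ (k z)))]
    with w hw
  simp only [Function.comp]
  rw [e.left_inv hw]

/-- The order of a composition of holomorphic maps. -/
lemma ordAt_comp {Y : Type*} [TopologicalSpace Y] [ChartedSpace ℂ Y] [IsManifold 𝓘(ℂ) ω Y]
    {q : Y → ℂ} {f : X → Y} {x : X} (hq : HolAt q (f x)) (hf : HolAt f x) :
    ordAt (q ∘ f) x = ordAt q (f x) * ordAt (chartAt ℂ (f x) ∘ f) x := by
  have e1 : (chartAt ℂ x).symm (chartAt ℂ x x) = x := (chartAt ℂ x).left_inv (mem_chart_source ℂ x)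
  have := analyticOrderAt_comp_curve (q := q) (k := fun z => f ((chartAt ℂ x).symm z))
    (z := chartAt ℂ x x) (by simpa only [e1] using hq)
    (HolAt.comp (g := f) (f := (chartAt ℂ x).symm) (by rwa [e1])
      (holAt_chartAt_symm (mem_chart_target ℂ x)))
  simp only [e1] at this
  simpa only [ordAt, Function.comp] using this

/-- Orders multiply under composition, and a chart composed with its inverse has order one. -/
lemma ordAt_chartAt {x y : X} (hy : y ∈ (chartAt ℂ x).source) : ordAt (chartAt ℂ x) y = 1 := by
  set e := chartAt ℂ x
  have hk : HolAt e.symm (e y) := holAt_chartAt_symm (e.map_source hy)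
  have e1 : e.symm (e y) = y := e.left_inv hy
  have := analyticOrderAt_comp_curve (q := e) (k := e.symm) (z := e y) (by
    rw [e1]; exact holAt_chartAt hy) hk
  have h2 : analyticOrderAt (fun w => e (e.symm w) - e (e.symm (e y))) (e y) = 1 := by
    have : (fun w => e (e.symm w) - e (e.symm (e y))) =ᶠ[𝓝 (e y)] (fun w => w - e y) := by
      filter_upwards [e.open_target.mem_nhds (e.map_source hy)] with w hw
      rw [e.right_inv hw, e1]
    rw [analyticOrderAt_congr this]
    exact analyticOrderAt_id_sub_const_self
  rw [h2, e1] at this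
  exact enat_eq_one_of_mul this.symm

end Surface

/-- Write F - F z₀ = (z - z₀)^d g and let G be a d-th root of g near z₀. Then w = (z - z₀) G has
nonzero derivative at z₀ and w^d = F - F z₀; `k` is its local inverse. -/
lemma exists_normal_form_complex {F : ℂ → ℂ} {z₀ : ℂ} {d : ℕ} (hF : AnalyticAt ℂ F z₀)
    (hd : analyticOrderAt (fun z => F z - F z₀) z₀ = d) :
    ∃ k : OpenPartialHomeomorph ℂ ℂ, 0 ∈ k.source ∧ k 0 = z₀ ∧
      (∀ ζ ∈ k.source, AnalyticAt ℂ k ζ) ∧ (∀ ζ ∈ k.source, F (k ζ) = F z₀ + ζ ^ d) := by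
  have hF' : AnalyticAt ℂ (fun z => F z - F z₀) z₀ := hF.sub analyticAt_const
  obtain ⟨g, hg, hg0, hFg⟩ := hF'.analyticOrderAt_eq_natCast.1 hd
  have hd0 : d ≠ 0 := by
    rintro rfl
    have := hFg.self_of_nhds
    simp at this
    exact hg0 this.symm
  obtain ⟨c, hc⟩ := IsAlgClosed.exists_pow_nat_eq (g z₀) (Nat.pos_of_ne_zero hd0)
  have hc0 : c ≠ 0 := by rintro rfl; rw [zero_pow hd0] at hc; exact hg0 hc.symm
  -- Dividing by `g z₀` moves the argument of the principal branch to 1, inside the slit plane.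
  set G : ℂ → ℂ := fun z => c * (g z / g z₀) ^ ((d : ℂ)⁻¹)
  have hG : AnalyticAt ℂ G z₀ := by
    refine analyticAt_const.mul ?_
    refine AnalyticAt.cpow (hg.div analyticAt_const hg0) analyticAt_const ?_
    rw [div_self hg0]; exact Complex.one_mem_slitPlane
  have hGd : ∀ z, G z ^ d = g z := by
    intro z
    simp only [G, mul_pow, hc]
    rw [← Complex.cpow_nat_mul, mul_inv_cancel₀ (by exact_mod_cast hd0), Complex.cpow_one]
    field_simp
  have hG0 : G z₀ = c := by simp [G, div_self hg0]
  set w : ℂ → ℂ := fun z => (z - z₀) * G z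
  have hw : AnalyticAt ℂ w z₀ := (analyticAt_id.sub analyticAt_const).mul hG
  have hwd : HasDerivAt w c z₀ := by
    have := ((hasDerivAt_id z₀).sub_const z₀).mul hG.differentiableAt.hasDerivAt
    have h2 : HasDerivAt w (1 * G z₀ + (id z₀ - z₀) * deriv G z₀) z₀ := this
    simpa [hG0] using h2
  have hws : HasStrictFDerivAt w
      ((ContinuousLinearEquiv.unitsEquivAut ℂ (Units.mk0 c hc0) : ℂ ≃L[ℂ] ℂ) : ℂ →L[ℂ] ℂ) z₀ := by
    have h1 : HasStrictDerivAt w c z₀ := by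
      have := hw.hasStrictDerivAt
      rwa [hwd.deriv] at this
    exact h1.hasStrictFDerivAt_equiv hc0
  set k₁ : OpenPartialHomeomorph ℂ ℂ := hws.toOpenPartialHomeomorph w
  have hk₁w : ∀ z, k₁ z = w z := fun z => rfl
  have hz₀ : z₀ ∈ k₁.source := hws.mem_toOpenPartialHomeomorph_source
  have hw0 : k₁ z₀ = 0 := by simp [hk₁w, w]
  have h0t : (0 : ℂ) ∈ k₁.target := hw0 ▸ k₁.map_source hz₀
  have hsymm : k₁.symm 0 = z₀ := by rw [← hw0, k₁.left_inv hz₀]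
  have han : AnalyticAt ℂ k₁.symm 0 := by
    have := k₁.contDiffAt_symm_deriv (n := ω) hc0 h0t (by rw [hsymm]; exact hwd)
      (by rw [hsymm]; exact hw.contDiffAt)
    exact this.analyticAt
  have hev : ∀ᶠ ζ in 𝓝 (0 : ℂ), AnalyticAt ℂ k₁.symm ζ ∧ F (k₁.symm ζ) = F z₀ + ζ ^ d := by
    have h2 : Tendsto k₁.symm (𝓝 0) (𝓝 z₀) := hsymm ▸ han.continuousAt.tendsto
    filter_upwards [han.eventually_analyticAt, h2.eventually hFg, k₁.open_target.mem_nhds h0t]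
      with ζ h3 h4 h5
    refine ⟨h3, ?_⟩
    have h6 : w (k₁.symm ζ) = ζ := k₁.right_inv h5
    rw [← hGd, smul_eq_mul, ← mul_pow] at h4
    rw [← sub_eq_iff_eq_add', h4]
    exact congrArg (· ^ d) h6
  obtain ⟨O, hO, hOo, h0O⟩ := _root_.eventually_nhds_iff.1 hev
  refine ⟨k₁.symm.restrOpen O hOo, ⟨h0t, h0O⟩, hsymm, fun ζ hζ => (hO ζ hζ.2).1,
    fun ζ hζ => (hO ζ hζ.2).2⟩

section Surface

variable {X : Type*} [TopologicalSpace X] [ChartedSpace ℂ X] [IsManifold 𝓘(ℂ) ω X]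

/-- A holomorphic parametrization of a neighbourhood of `h 0` by a disc. -/
structure IsDisc (h : ℂ → X) (ρ : ℝ) : Prop where
  pos : 0 < ρ
  injOn : InjOn h (ball 0 ρ)
  hol : ∀ ζ ∈ ball (0 : ℂ) ρ, HolAt h ζ
  isOpen_image : ∀ O ⊆ ball (0 : ℂ) ρ, IsOpen O → IsOpen (h '' O)

lemma IsDisc.mono {h : ℂ → X} {ρ ρ' : ℝ} (H : IsDisc h ρ) (h0 : 0 < ρ') (hle : ρ' ≤ ρ) :
    IsDisc h ρ' where
  pos := h0
  injOn := H.injOn.mono (ball_subset_ball hle)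
  hol ζ hζ := H.hol ζ (ball_subset_ball hle hζ)
  isOpen_image O hO := H.isOpen_image O (hO.trans (ball_subset_ball hle))

/-- The local normal form of a holomorphic function. -/
theorem exists_normal_form {q : X → ℂ} {x : X} (hq : HolAt q x) {d : ℕ} (hd : ordAt q x = d) :
    ∃ h : ℂ → X, ∃ ρ : ℝ, IsDisc h ρ ∧ h 0 = x ∧
      (∀ ζ ∈ ball (0 : ℂ) ρ, q (h ζ) = q x + ζ ^ d) ∧ ∀ ζ ∈ ball (0 : ℂ) ρ, HolAt q (h ζ) := by
  set e := chartAt ℂ x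
  have e1 : e.symm (e x) = x := e.left_inv (mem_chart_source ℂ x)
  obtain ⟨k, hk0, hk, hka, hkq⟩ := exists_normal_form_complex (F := fun z => q (e.symm z))
    (z₀ := e x) (d := d) hq.analyticAt_comp_symm (by simp only [e1]; exact hd)
  set H : OpenPartialHomeomorph ℂ X := k.trans e.symm
  have h0 : (0 : ℂ) ∈ H.source := by
    refine ⟨hk0, ?_⟩
    change k 0 ∈ e.target
    rw [hk]
    exact mem_chart_target ℂ x
  have hH0 : H 0 = x := by simp [H, hk, e1]
  have hev : ∀ᶠ ζ in 𝓝 (0 : ℂ), HolAt q (H ζ) := by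
    have : Tendsto H (𝓝 0) (𝓝 x) := hH0 ▸ (H.continuousAt h0).tendsto
    exact this.eventually hq.eventually
  obtain ⟨ρ, hρ, hsub⟩ := Metric.mem_nhds_iff.1 (inter_mem (H.open_source.mem_nhds h0) hev)
  refine ⟨H, ρ, ⟨hρ, H.injOn.mono fun ζ hζ => (hsub hζ).1, fun ζ hζ => ?_, fun O hO hOo => ?_⟩, hH0,
    fun ζ hζ => ?_, fun ζ hζ => (hsub hζ).2⟩
  · have h1 := (hsub hζ).1
    exact HolAt.comp (g := e.symm) (f := k) (holAt_chartAt_symm h1.2)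
      (holAt_iff_analyticAt.2 (hka ζ h1.1))
  · exact H.isOpen_image_of_subset_source hOo fun ζ hζ => (hsub (hO hζ)).1
  · have h1 := (hsub hζ).1
    have := hkq ζ h1.1
    simp only [e1] at this
    exact this

/-- Off the centre of a normal form, the order is one. -/
lemma ordAt_eq_one_of_normal_form {q : X → ℂ} {x : X} {d : ℕ} {h : ℂ → X} {ρ : ℝ}
    (hd0 : d ≠ 0) (H : IsDisc h ρ) (hh : ∀ ζ ∈ ball (0 : ℂ) ρ, q (h ζ) = q x + ζ ^ d)
    (hq : ∀ ζ ∈ ball (0 : ℂ) ρ, HolAt q (h ζ)) {ζ : ℂ} (hζ : ζ ∈ ball (0 : ℂ) ρ) (h0 : ζ ≠ 0) :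
    ordAt q (h ζ) = 1 := by
  have h1 := analyticOrderAt_comp_curve (hq ζ hζ) (H.hol ζ hζ)
  have h2 : analyticOrderAt (fun w => q (h w) - q (h ζ)) ζ = 1 := by
    have : (fun w => q (h w) - q (h ζ)) =ᶠ[𝓝 ζ] fun w => w ^ d - ζ ^ d := by
      filter_upwards [isOpen_ball.mem_nhds hζ] with w hw
      rw [hh w hw, hh ζ hζ]; ring
    rw [analyticOrderAt_congr this]
    refine AnalyticAt.analyticOrderAt_sub_eq_one_of_deriv_ne_zero (f := fun w : ℂ => w ^ d)
      (analyticAt_id.pow d) ?_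
    simp [hd0, h0]
  rw [h2] at h1
  exact enat_eq_one_of_mul h1.symm

lemma localDegree_eq (f : X → X) (x : X) : localDegree f x = (ordAt (chartAt ℂ (f x) ∘ f) x).toNat := by
  simp only [localDegree, ordAt, analyticOrderNatAt, writtenInExtChartAt, mfld_simps]

/-- `f` is nowhere locally constant. -/
def NowhereConst (f : X → X) : Prop := ∀ x, ordAt (chartAt ℂ (f x) ∘ f) x ≠ ⊤

lemma localDegree_cast {f : X → X} (hf : NowhereConst f) (x : X) :
    (localDegree f x : ℕ∞) = ordAt (chartAt ℂ (f x) ∘ f) x := by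
  rw [localDegree_eq, ENat.natCast_toNat (hf x)]

lemma holAt_chart_comp {f : X → X} (hf : MDifferentiable 𝓘(ℂ) 𝓘(ℂ) f) (x : X) :
    HolAt (chartAt ℂ (f x) ∘ f) x :=
  HolAt.comp (holAt_chartAt (mem_chart_source ℂ _)) (hf.holAt x)

lemma localDegree_ne_zero {f : X → X} (hf : MDifferentiable 𝓘(ℂ) 𝓘(ℂ) f) (hc : NowhereConst f)
    (x : X) : localDegree f x ≠ 0 := by
  have := ordAt_ne_zero (holAt_chart_comp hf x)
  rw [← localDegree_cast hc] at this
  exact_mod_cast this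

lemma ordAt_comp_comp {f g : X → X} (hf : MDifferentiable 𝓘(ℂ) 𝓘(ℂ) f)
    (hg : MDifferentiable 𝓘(ℂ) 𝓘(ℂ) g) (x : X) :
    ordAt (chartAt ℂ (g (f x)) ∘ (g ∘ f)) x =
      ordAt (chartAt ℂ (g (f x)) ∘ g) (f x) * ordAt (chartAt ℂ (f x) ∘ f) x := by
  rw [← ordAt_comp (holAt_chart_comp hg (f x)) (hf.holAt x)]
  rfl

lemma NowhereConst.comp {f g : X → X} (hf : MDifferentiable 𝓘(ℂ) 𝓘(ℂ) f)
    (hg : MDifferentiable 𝓘(ℂ) 𝓘(ℂ) g) (hcf : NowhereConst f) (hcg : NowhereConst g) :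
    NowhereConst (g ∘ f) := by
  intro x
  rw [Function.comp_apply, ordAt_comp_comp hf hg]
  rw [← localDegree_cast hcf, ← localDegree_cast hcg]
  exact_mod_cast ENat.natCast_ne_top _

lemma localDegree_comp {f g : X → X} (hf : MDifferentiable 𝓘(ℂ) 𝓘(ℂ) f)
    (hg : MDifferentiable 𝓘(ℂ) 𝓘(ℂ) g) (x : X) :
    localDegree (g ∘ f) x = localDegree g (f x) * localDegree f x := by
  rw [localDegree_eq, localDegree_eq, localDegree_eq, Function.comp_apply, ordAt_comp_comp hf hg,
    ENat.toNat_mul]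

/-- The local degree of `f` at nearby points, computed in a fixed chart. -/
lemma ordAt_chart_comp {f : X → X} (hf : MDifferentiable 𝓘(ℂ) 𝓘(ℂ) f) {x y : X}
    (hy : f x ∈ (chartAt ℂ y).source) :
    ordAt (chartAt ℂ y ∘ f) x = ordAt (chartAt ℂ (f x) ∘ f) x := by
  rw [ordAt_comp (holAt_chartAt hy) (hf.holAt x), ordAt_chartAt hy, one_mul]

end Surface

/-! ### Fibres of branched maps, counted with multiplicity -/

section Counting

variable {X Y : Type*} [TopologicalSpace X] [ChartedSpace ℂ X] [IsManifold 𝓘(ℂ) ω X]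
  [TopologicalSpace Y]

/-- The sum of `u` over the fibre of `Φ` over `y`, with multiplicities `m`. -/
noncomputable def fiberSum (Φ : X → Y) (m : X → ℕ) (u : X → ℝ) (y : Y) : ℝ :=
  ∑ᶠ z ∈ Φ ⁻¹' {y}, (m z : ℝ) * u z

/-- A standard primitive root of unity. -/
noncomputable def rootOne (d : ℕ) : ℂ := Complex.exp (2 * Real.pi * Complex.I / d)

lemma rootOne_spec {d : ℕ} (hd : d ≠ 0) : IsPrimitiveRoot (rootOne d) d :=
  Complex.isPrimitiveRoot_exp d hd

lemma norm_rootOne_pow {d : ℕ} (hd : d ≠ 0) (j : ℕ) : ‖rootOne d ^ j‖ = 1 := by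
  rw [norm_pow, (rootOne_spec hd).norm'_eq_one hd, one_pow]

lemma pow_eq_iff_exists_rootOne {d : ℕ} (hd : d ≠ 0) {s ζ : ℂ} :
    ζ ^ d = s ^ d ↔ ∃ j ∈ Finset.range d, s * rootOne d ^ j = ζ := by
  have h1 : rootOne d ^ d = 1 := (rootOne_spec hd).pow_eq_one
  constructor
  · intro h
    rcases eq_or_ne s 0 with rfl | hs
    · rw [zero_pow hd] at h
      exact ⟨0, by simp; omega, by simp [pow_eq_zero_iff hd |>.1 h]⟩
    have h2 : (ζ / s) ^ d = 1 := by rw [div_pow, h, div_self (pow_ne_zero d hs)]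
    have : NeZero d := ⟨hd⟩
    obtain ⟨j, hj, hj'⟩ := (rootOne_spec hd).eq_pow_of_pow_eq_one h2
    refine ⟨j, Finset.mem_range.2 hj, ?_⟩
    rw [hj', mul_div_cancel₀ _ hs]
  · rintro ⟨j, -, rfl⟩
    rw [mul_pow, ← pow_mul, mul_comm j, pow_mul, h1, one_pow, mul_one]

lemma rootOne_injOn {d : ℕ} (hd : d ≠ 0) {s : ℂ} (hs : s ≠ 0) :
    InjOn (fun j => s * rootOne d ^ j) (Finset.range d : Set ℕ) := by
  intro i hi j hj hij
  have hi' : i < d := by simpa using hi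
  have hj' : j < d := by simpa using hj
  exact (rootOne_spec hd).pow_inj hi' hj' (mul_left_cancel₀ hs hij)

/-- A local model `ζ ↦ ζ ^ m x` for the map `Φ` with multiplicities `m` at the point `x`. -/
structure LocalModel (Φ : X → Y) (m : X → ℕ) (x : X) (q : Y → ℂ) (h : ℂ → X) (ρ : ℝ) : Prop where
  disc : IsDisc h ρ
  zero : h 0 = x
  ne : m x ≠ 0
  eq : ∀ ζ ∈ ball (0 : ℂ) ρ, q (Φ (h ζ)) = q (Φ x) + ζ ^ m x
  one : ∀ ζ ∈ ball (0 : ℂ) ρ, ζ ≠ 0 → m (h ζ) = 1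
  cont : ContinuousAt q (Φ x)
  inj : ∃ O ∈ 𝓝 (Φ x), InjOn q O

/-- For `s = 0` there is a single root of multiplicity d, for `s ≠ 0` there are d simple ones; the
sum over j covers both cases. -/
lemma sum_roots {h : ℂ → X} {m : X → ℕ} {d : ℕ} (hd : d ≠ 0) {s : ℂ} (h0 : m (h 0) = d)
    (h1 : s ≠ 0 → ∀ j, m (h (s * rootOne d ^ j)) = 1) (u : X → ℝ) :
    ∑ ζ ∈ (Finset.range d).image (fun j => s * rootOne d ^ j), (m (h ζ) : ℝ) * u (h ζ) =
      ∑ j ∈ Finset.range d, u (h (s * rootOne d ^ j)) := by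
  rcases eq_or_ne s 0 with rfl | hs
  · have : (Finset.range d).image (fun j => (0 : ℂ) * rootOne d ^ j) = {0} := by
      ext z
      simp only [zero_mul, Finset.mem_image, Finset.mem_range, Finset.mem_singleton]
      exact ⟨fun ⟨j, _, h⟩ => h.symm, fun h => ⟨0, Nat.pos_of_ne_zero hd, h.symm⟩⟩
    rw [this]
    simp [h0]
  · rw [Finset.sum_image (rootOne_injOn hd hs)]
    refine Finset.sum_congr rfl fun j _ => ?_
    rw [h1 hs j]; simp

variable [CompactSpace X] [T2Space X] [T2Space Y]

/-- By compactness the fibre over y near `y₀` lies in small disjoint discs around the points of `S`,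
and in the disc at x it consists of the `m x`-th roots of `q x y - q x y₀`. The root `s x` is left
arbitrary, since rotating it by roots of unity always gives the same fibre. The target is a general
space because the formula serves both self-maps and maps to the sphere. -/
theorem fiber_formula {Φ : X → Y} {m : X → ℕ} (hΦ : Continuous Φ) (y₀ : Y) {q : X → Y → ℂ}
    {h : X → ℂ → X} {ρ : X → ℝ} (H : ∀ x, Φ x = y₀ → LocalModel Φ m x (q x) (h x) (ρ x)) :
    ∃ S : Finset X, (∀ x, x ∈ S ↔ Φ x = y₀) ∧ ∀ ε > 0, ∀ᶠ y in 𝓝 y₀, (Φ ⁻¹' {y}).Finite ∧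
      (∀ x ∈ S, ∀ s, s ^ m x = q x y - q x y₀ → ‖s‖ < ε ∧ ‖s‖ < ρ x ∧ Φ (h x s) = y) ∧
      ∀ s : X → ℂ, (∀ x ∈ S, s x ^ m x = q x y - q x y₀) → ∀ u : X → ℝ,
        fiberSum Φ m u y = ∑ x ∈ S, ∑ j ∈ Finset.range (m x), u (h x (s x * rootOne (m x) ^ j)) := by
  classical
  have h0mem : ∀ x, Φ x = y₀ → x ∈ h x '' ball 0 (ρ x) := fun x hx =>
    ⟨0, mem_ball_self (H x hx).disc.pos, (H x hx).zero⟩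
  -- the fibre is finite
  have hfin : (Φ ⁻¹' {y₀}).Finite := by
    have hc : IsCompact (Φ ⁻¹' {y₀}) := (isClosed_singleton.preimage hΦ).isCompact
    obtain ⟨t, ht⟩ := hc.elim_finite_subcover
      (fun x : Φ ⁻¹' {y₀} => h x '' ball 0 (ρ x))
      (fun x => (H x x.2).disc.isOpen_image _ Subset.rfl isOpen_ball)
      (fun x hx => mem_iUnion.2 ⟨⟨x, hx⟩, h0mem x hx⟩)
    refine (Set.Finite.image (fun x : Φ ⁻¹' {y₀} => (x : X)) t.finite_toSet).subset fun z hz => ?_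
    obtain ⟨x, hxt, ζ, hζ, rfl⟩ := by simpa only [mem_iUnion, exists_prop] using ht hz
    refine ⟨x, hxt, ?_⟩
    have h1 := (H x x.2).eq ζ hζ
    have hz' : Φ (h x ζ) = y₀ := hz
    have hx' : Φ x = y₀ := x.2
    rw [hz', hx', left_eq_add, pow_eq_zero_iff (H x x.2).ne] at h1
    rw [h1]; exact (H x x.2).zero.symm
  set S := hfin.toFinset
  have hS : ∀ x, x ∈ S ↔ Φ x = y₀ := fun x => by simp [S]
  refine ⟨S, hS, fun ε hε => ?_⟩
  obtain ⟨U, hU, hUd⟩ := S.finite_toSet.t2_separation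
  have hO : ∀ x, ∃ O ∈ 𝓝 y₀, x ∈ S → InjOn (q x) O := by
    intro x
    by_cases hx : x ∈ S
    · obtain ⟨O, hO, hO'⟩ := (H x ((hS x).1 hx)).inj
      exact ⟨O, ((hS x).1 hx) ▸ hO, fun _ => hO'⟩
    · exact ⟨univ, univ_mem, fun h => absurd h hx⟩
  choose O hO hOinj using hO
  have hr : ∀ x, ∃ r > 0, r ≤ ε ∧ (x ∈ S → r ≤ ρ x ∧ ∀ ζ ∈ ball (0 : ℂ) r, h x ζ ∈ U x ∧ Φ (h x ζ) ∈ O x) := by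
    intro x
    by_cases hx : x ∈ S
    · have hx' := (hS x).1 hx
      have hM := H x hx'
      have hc : ContinuousAt (h x) 0 := (hM.disc.hol 0 (mem_ball_self hM.disc.pos)).continuousAt
      have h1 : ∀ᶠ ζ in 𝓝 (0 : ℂ), h x ζ ∈ U x := by
        refine hc.eventually ?_
        rw [hM.zero]; exact (hU x).2.mem_nhds (hU x).1
      have h2 : ∀ᶠ ζ in 𝓝 (0 : ℂ), Φ (h x ζ) ∈ O x := by
        refine hc.eventually (p := fun z => Φ z ∈ O x) ?_
        rw [hM.zero]
        exact hΦ.continuousAt.eventually (by rw [hx']; exact hO x)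
      obtain ⟨r, hr, hr'⟩ := Metric.mem_nhds_iff.1 (h1.and h2)
      exact ⟨min (min r (ρ x)) ε, lt_min (lt_min hr hM.disc.pos) hε, min_le_right _ _, fun _ =>
        ⟨(min_le_left _ _).trans (min_le_right _ _), fun ζ hζ =>
          hr' (ball_subset_ball ((min_le_left _ _).trans (min_le_left _ _)) hζ)⟩⟩
    · exact ⟨ε, hε, le_rfl, fun h => absurd h hx⟩
  choose r hr0 hrε hr using hr
  set W : Set X := ⋃ x ∈ S, h x '' ball 0 (r x)
  have hWo : IsOpen W := isOpen_biUnion fun x hx =>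
    ((H x ((hS x).1 hx)).disc.mono (hr0 x) (hr x hx).1).isOpen_image _ Subset.rfl isOpen_ball
  -- `Φ` is a closed map, so fibres over nearby points cannot escape the discs.
  have hV1 : ∀ᶠ y in 𝓝 y₀, Φ ⁻¹' {y} ⊆ W := by
    have hcl : IsClosed (Φ '' Wᶜ) := (hWo.isClosed_compl.isCompact.image hΦ).isClosed
    have : y₀ ∈ (Φ '' Wᶜ)ᶜ := by
      rintro ⟨z, hz, hz'⟩
      exact hz (mem_biUnion ((hS z).2 hz') ⟨0, mem_ball_self (hr0 z), (H z hz').zero⟩)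
    filter_upwards [hcl.isOpen_compl.mem_nhds this] with y hy z hz
    by_contra hzW
    exact hy ⟨z, hzW, hz⟩
  have hV2 : ∀ᶠ y in 𝓝 y₀, ∀ x ∈ S, y ∈ O x ∧ ‖q x y - q x y₀‖ < r x ^ m x := by
    rw [Filter.eventually_all_finset]
    intro x hx
    refine Filter.Eventually.and (hO x) ?_
    have hc := (H x ((hS x).1 hx)).cont
    rw [(hS x).1 hx] at hc
    have : Tendsto (fun y => ‖q x y - q x y₀‖) (𝓝 y₀) (𝓝 0) := by
      have := (hc.sub continuousAt_const (g := fun _ => q x y₀)).norm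
      simpa [ContinuousAt] using this
    exact this.eventually (gt_mem_nhds (pow_pos (hr0 x) _))
  filter_upwards [hV1, hV2] with y hy1 hy2
  have hroot : ∀ x ∈ S, ∀ s, s ^ m x = q x y - q x y₀ → ‖s‖ < r x := by
    intro x hx s hs
    have := (hy2 x hx).2
    rw [← hs, norm_pow] at this
    exact lt_of_pow_lt_pow_left₀ _ (hr0 x).le this
  have hroot' : ∀ x ∈ S, ∀ s, s ^ m x = q x y - q x y₀ → Φ (h x s) = y := by
    intro x hx s hs
    have hs' := hroot x hx s hs
    have hb : s ∈ ball (0 : ℂ) (r x) := by simpa using hs'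
    refine hOinj x hx ((hr x hx).2 s hb).2 (hy2 x hx).1 ?_
    rw [(H x ((hS x).1 hx)).eq s (ball_subset_ball (hr x hx).1 hb), hs, (hS x).1 hx]
    ring
  have hset : ∀ s : X → ℂ, (∀ x ∈ S, s x ^ m x = q x y - q x y₀) → Φ ⁻¹' {y} = ↑(S.biUnion fun x =>
      ((Finset.range (m x)).image (fun j => s x * rootOne (m x) ^ j)).image (h x)) := by
    intro s hs
    ext z
    simp only [Finset.coe_biUnion, mem_iUnion, Finset.coe_image, exists_prop]
    constructor
    · intro hz
      obtain ⟨x, hx, ζ, hζ, hζz⟩ := by simpa only [W, mem_iUnion, exists_prop] using hy1 hz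
      refine ⟨x, hx, ζ, ?_, hζz⟩
      have h1 := (H x ((hS x).1 hx)).eq ζ (ball_subset_ball (hr x hx).1 hζ)
      have hz' : Φ z = y := hz
      rw [hζz, hz', (hS x).1 hx] at h1
      have h2 : ζ ^ m x = s x ^ m x := by rw [hs x hx, h1]; ring
      obtain ⟨j, hj, hj'⟩ := (pow_eq_iff_exists_rootOne (H x ((hS x).1 hx)).ne).1 h2
      exact ⟨j, hj, hj'⟩
    · rintro ⟨x, hx, ζ, ⟨j, hj, rfl⟩, rfl⟩
      refine hroot' x hx _ ?_
      rw [(pow_eq_iff_exists_rootOne (H x ((hS x).1 hx)).ne).2 ⟨j, hj, rfl⟩, hs x hx]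
  refine ⟨?_, fun x hx s hs => ⟨(hroot x hx s hs).trans_le (hrε x),
    (hroot x hx s hs).trans_le (hr x hx).1, hroot' x hx s hs⟩, fun s hs u => ?_⟩
  · have : ∃ s : X → ℂ, ∀ x ∈ S, s x ^ m x = q x y - q x y₀ := by
      have : ∀ x, ∃ s : ℂ, x ∈ S → s ^ m x = q x y - q x y₀ := by
        intro x
        by_cases hx : x ∈ S
        · obtain ⟨s, hs⟩ := IsAlgClosed.exists_pow_nat_eq (q x y - q x y₀)
            (Nat.pos_of_ne_zero (H x ((hS x).1 hx)).ne)
          exact ⟨s, fun _ => hs⟩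
        · exact ⟨0, fun h => absurd h hx⟩
      choose s hs using this
      exact ⟨s, fun x hx => hs x hx⟩
    obtain ⟨s, hs⟩ := this
    rw [hset s hs]
    exact Finset.finite_toSet _
  · rw [fiberSum, hset s hs, finsum_mem_coe_finset, Finset.sum_biUnion]
    · refine Finset.sum_congr rfl fun x hx => ?_
      have hM := H x ((hS x).1 hx)
      have hmem : ∀ j, s x * rootOne (m x) ^ j ∈ ball (0 : ℂ) (r x) := by
        intro j
        rw [mem_ball_zero_iff, norm_mul, norm_rootOne_pow hM.ne, mul_one]
        exact hroot x hx _ (hs x hx)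
      rw [Finset.sum_image]
      · refine sum_roots hM.ne (by rw [hM.zero]) (fun h0 j => ?_) u
        refine hM.one _ (ball_subset_ball (hr x hx).1 (hmem j)) ?_
        exact mul_ne_zero h0 (pow_ne_zero _ ((rootOne_spec hM.ne).ne_zero hM.ne))
      · refine hM.disc.injOn.mono ?_
        intro ζ hζ
        obtain ⟨j, -, rfl⟩ := by simpa using hζ
        exact ball_subset_ball (hr x hx).1 (hmem j)
    · intro x hx x' hx' hne
      rw [Function.onFun, Finset.disjoint_left]
      intro z hz hz'
      have key : ∀ x ∈ S, z ∈ ((Finset.range (m x)).image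
          (fun j => s x * rootOne (m x) ^ j)).image (h x) → z ∈ U x := by
        intro x hx hz
        obtain ⟨ζ, hζ, rfl⟩ := Finset.mem_image.1 hz
        obtain ⟨j, -, rfl⟩ := Finset.mem_image.1 hζ
        refine ((hr x hx).2 _ ?_).1
        have hM := H x ((hS x).1 hx)
        rw [mem_ball_zero_iff, norm_mul, norm_rootOne_pow hM.ne, mul_one]
        exact hroot x hx _ (hs x hx)
      exact (hUd hx hx' hne).le_bot ⟨key x hx hz, key x' hx' hz'⟩

/-- The number of points in the fibres, with multiplicity, is locally constant. -/
theorem fiberSum_one_eq {Φ : X → Y} {m : X → ℕ} (hΦ : Continuous Φ) [PreconnectedSpace Y]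
    (H : ∀ x, ∃ q h ρ, LocalModel Φ m x q h ρ) (y y' : Y) :
    fiberSum Φ m (fun _ => 1) y = fiberSum Φ m (fun _ => 1) y' := by
  have : IsLocallyConstant (fiberSum Φ m (fun _ => (1 : ℝ))) := by
    rw [IsLocallyConstant.iff_eventually_eq]
    intro y₀
    choose q h ρ H using H
    obtain ⟨S, hS, hS'⟩ := fiber_formula hΦ y₀ (q := q) (h := h) (ρ := ρ) (fun x _ => H x)
    have key : ∀ᶠ y in 𝓝 y₀, fiberSum Φ m (fun _ => (1 : ℝ)) y = ∑ x ∈ S, (m x : ℝ) := by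
      filter_upwards [hS' 1 one_pos] with y hy
      have : ∀ x, ∃ s : ℂ, s ^ m x = q x y - q x y₀ := fun x =>
        IsAlgClosed.exists_pow_nat_eq _ (Nat.pos_of_ne_zero (H x).ne)
      choose s hs using this
      rw [hy.2.2 s (fun x _ => hs x)]
      simp
    filter_upwards [key] with y hy
    rw [hy, key.self_of_nhds]
  exact this.apply_eq_of_preconnectedSpace y y'

end Counting

/-! ### Local models of holomorphic maps, degree, transfer operator -/

section Surface

variable {X : Type*} [TopologicalSpace X] [ChartedSpace ℂ X] [IsManifold 𝓘(ℂ) ω X]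

/-- Local models of holomorphic maps, with holomorphic data. -/
theorem exists_localModel {f : X → X} (hf : MDifferentiable 𝓘(ℂ) 𝓘(ℂ) f) (hc : NowhereConst f)
    (x : X) : ∃ h ρ, LocalModel f (localDegree f) x (chartAt ℂ (f x)) h ρ := by
  obtain ⟨h, ρ, hd, h0, heq, hhol⟩ := exists_normal_form (holAt_chart_comp hf x)
    (localDegree_cast hc x).symm
  have hev : ∀ᶠ ζ in 𝓝 (0 : ℂ), f (h ζ) ∈ (chartAt ℂ (f x)).source := by
    have h1 : ContinuousAt (fun ζ => f (h ζ)) 0 :=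
      (hf.holAt (h 0)).continuousAt.comp (hd.hol 0 (mem_ball_self hd.pos)).continuousAt
    refine h1.eventually (p := fun z => z ∈ (chartAt ℂ (f x)).source) ?_
    simp only [h0]
    exact (chartAt ℂ (f x)).open_source.mem_nhds (mem_chart_source ℂ _)
  obtain ⟨r, hr, hr'⟩ := Metric.mem_nhds_iff.1 hev
  have hs1 : ball (0 : ℂ) (min r ρ) ⊆ ball 0 ρ := ball_subset_ball (min_le_right _ _)
  have hs2 : ball (0 : ℂ) (min r ρ) ⊆ ball 0 r := ball_subset_ball (min_le_left _ _)
  refine ⟨h, min r ρ, hd.mono (lt_min hr hd.pos) (min_le_right _ _), h0, localDegree_ne_zero hf hc x,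
    fun ζ hζ => heq ζ (hs1 hζ), fun ζ hζ hζ0 => ?_, (holAt_chartAt (mem_chart_source ℂ _)).continuousAt,
    ⟨_, (chartAt ℂ (f x)).open_source.mem_nhds (mem_chart_source ℂ _), (chartAt ℂ (f x)).injOn⟩⟩
  have h1 := ordAt_eq_one_of_normal_form (localDegree_ne_zero hf hc x) hd heq hhol (hs1 hζ) hζ0
  rw [ordAt_chart_comp hf (hr' (hs2 hζ)), ← localDegree_cast hc] at h1
  exact_mod_cast h1

end Surface

section Degree

variable {X : Type*} [TopologicalSpace X] [ChartedSpace ℂ X] [IsManifold 𝓘(ℂ) ω X]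

lemma tendsto_chartAt_symm (x : X) : Tendsto (chartAt ℂ x).symm (𝓝 (chartAt ℂ x x)) (𝓝 x) := by
  have := (chartAt ℂ x).continuousAt_symm (mem_chart_target ℂ x)
  rwa [ContinuousAt, (chartAt ℂ x).left_inv (mem_chart_source ℂ x)] at this

lemma tendsto_chartAt (x : X) : Tendsto (chartAt ℂ x) (𝓝 x) (𝓝 (chartAt ℂ x x)) :=
  (chartAt ℂ x).continuousAt (mem_chart_source ℂ x)

lemma eventually_chart_iff {p : X → Prop} (x : X) :
    (∀ᶠ z in 𝓝 (chartAt ℂ x x), p ((chartAt ℂ x).symm z)) ↔ ∀ᶠ y in 𝓝 x, p y := by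
  refine ⟨fun h => ?_, fun h => (tendsto_chartAt_symm x).eventually h⟩
  filter_upwards [(tendsto_chartAt x).eventually h,
    (chartAt ℂ x).open_source.mem_nhds (mem_chart_source ℂ x)] with y hy hy'
  rwa [(chartAt ℂ x).left_inv hy'] at hy

/-- A chart turns `U` into a neighbourhood of a point of the plane, which is infinite. -/
lemma exists_ne_of_isOpen {U : Set X} (hU : IsOpen U) {x : X} (hx : x ∈ U) (s : Set X)
    (hs : s.Finite) : ∃ y ∈ U, y ∉ s := by
  set e := chartAt ℂ x
  have h1 : IsOpen (e.symm ⁻¹' U ∩ e.target) := by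
    rw [inter_comm]; exact e.symm.isOpen_inter_preimage hU
  have h2 : (e.symm ⁻¹' U ∩ e.target).Infinite := by
    refine infinite_of_mem_nhds (e x) (h1.mem_nhds ⟨?_, mem_chart_target ℂ x⟩)
    rw [mem_preimage, e.left_inv (mem_chart_source ℂ x)]; exact hx
  have h3 : (e.symm '' (e.symm ⁻¹' U ∩ e.target)).Infinite :=
    h2.image (e.symm.injOn.mono inter_subset_right)
  obtain ⟨y, ⟨z, hz, rfl⟩, hys⟩ := (h3.sdiff hs).nonempty
  exact ⟨_, hz.1, hys⟩

lemma infinite_surface [Nonempty X] : Infinite X := by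
  refine ⟨fun h => ?_⟩
  obtain ⟨y, -, hy⟩ := exists_ne_of_isOpen isOpen_univ (mem_univ (Classical.arbitrary X)) univ
    (toFinite _)
  exact hy (mem_univ y)

/-- A holomorphic self-map which is nowhere locally constant. -/
structure IsHolEndo (f : X → X) : Prop where
  hol : MDifferentiable 𝓘(ℂ) 𝓘(ℂ) f
  nc : NowhereConst f

lemma IsHolEndo.continuous {f : X → X} (hf : IsHolEndo f) : Continuous f := hf.hol.continuous

lemma ordAt_eq_top_iff {f : X → X} (hf : MDifferentiable 𝓘(ℂ) 𝓘(ℂ) f) (x : X) :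
    ordAt (chartAt ℂ (f x) ∘ f) x = ⊤ ↔ ∀ᶠ y in 𝓝 x, f y = f x := by
  rw [ordAt, analyticOrderAt_eq_top,
    eventually_chart_iff (p := fun y => (chartAt ℂ (f x) ∘ f) y - (chartAt ℂ (f x) ∘ f) x = 0)]
  refine ⟨fun h => ?_, fun h => h.mono fun y hy => by simp [hy]⟩
  filter_upwards [h, hf.continuous.continuousAt.eventually
    ((chartAt ℂ (f x)).open_source.mem_nhds (mem_chart_source ℂ _))] with y hy hy'
  exact (chartAt ℂ (f x)).injOn hy' (mem_chart_source ℂ _) (sub_eq_zero.1 hy)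

/-- The identity theorem for self-maps of a connected surface. -/
theorem nowhereConst_or_const [T2Space X] [PreconnectedSpace X] {f : X → X}
    (hf : MDifferentiable 𝓘(ℂ) 𝓘(ℂ) f) : NowhereConst f ∨ ∀ x y, f x = f y := by
  set A : Set X := {x | ∀ᶠ y in 𝓝 x, f y = f x}
  have hAo : IsOpen A := by
    rw [isOpen_iff_mem_nhds]
    intro x hx
    filter_upwards [Filter.Eventually.eventually_nhds hx, hx] with y hy hy'
    filter_upwards [hy] with z hz
    rw [hz, hy']
  -- If `f` is constant near some `y` close to `x`, the identity theorem in a chart ball around `x`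
  -- makes it constant near `x` too.
  have hAc : IsClosed A := by
    rw [← isOpen_compl_iff, isOpen_iff_mem_nhds]
    intro x hx
    have e1 : (chartAt ℂ x).symm (chartAt ℂ x x) = x := (chartAt ℂ x).left_inv (mem_chart_source ℂ x)
    have han : ∀ᶠ z in 𝓝 (chartAt ℂ x x), AnalyticAt ℂ
        (fun z => chartAt ℂ (f x) (f ((chartAt ℂ x).symm z))) z :=
      (holAt_chart_comp hf x).analyticAt_comp_symm.eventually_analyticAt
    have hev : ∀ᶠ z in 𝓝 (chartAt ℂ x x), f ((chartAt ℂ x).symm z) ∈ (chartAt ℂ (f x)).source :=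
      (eventually_chart_iff (p := fun y => f y ∈ (chartAt ℂ (f x)).source) x).2
        (hf.continuous.continuousAt.eventually
          ((chartAt ℂ (f x)).open_source.mem_nhds (mem_chart_source ℂ _)))
    obtain ⟨r, hr, hr'⟩ := Metric.mem_nhds_iff.1 ((han.and hev).and
      ((chartAt ℂ x).open_target.mem_nhds (mem_chart_target ℂ x)))
    rw [mem_compl_iff, mem_ofPred_eq] at hx
    have hmem : ∀ᶠ y in 𝓝 x, y ∈ (chartAt ℂ x).source ∧ chartAt ℂ x y ∈ ball (chartAt ℂ x x) r :=
      Filter.Eventually.and ((chartAt ℂ x).open_source.mem_nhds (mem_chart_source ℂ x))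
        ((tendsto_chartAt x).eventually (ball_mem_nhds _ hr))
    filter_upwards [hmem] with y hy hyA
    refine hx ?_
    have hya : ∀ᶠ z in 𝓝 (chartAt ℂ x y), f ((chartAt ℂ x).symm z) = f y := by
      have h1 := (chartAt ℂ x).continuousAt_symm ((chartAt ℂ x).map_source hy.1)
      rw [ContinuousAt, (chartAt ℂ x).left_inv hy.1] at h1
      exact h1.eventually hyA
    have hconst := AnalyticOnNhd.eqOn_of_preconnected_of_eventuallyEq
      (f := fun z => chartAt ℂ (f x) (f ((chartAt ℂ x).symm z)))
      (g := fun _ => chartAt ℂ (f x) (f y)) (U := ball (chartAt ℂ x x) r)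
      (fun z hz => (hr' hz).1.1) (fun z _ => analyticAt_const) (convex_ball _ _).isPreconnected hy.2
      (hya.mono fun z hz => by simp only [hz])
    have hfy : f y ∈ (chartAt ℂ (f x)).source := by
      have := (hr' hy.2).1.2
      rwa [(chartAt ℂ x).left_inv hy.1] at this
    have hall : ∀ z ∈ ball (chartAt ℂ x x) r, f ((chartAt ℂ x).symm z) = f y := fun z hz =>
      (chartAt ℂ (f x)).injOn (hr' hz).1.2 hfy (hconst hz)
    have hx0 : f x = f y := by rw [← hall _ (mem_ball_self hr), e1]
    rw [hx0, ← eventually_chart_iff (p := fun z => f z = f y) x]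
    filter_upwards [ball_mem_nhds _ hr] with z hz using hall z hz
  rcases isClopen_iff.1 ⟨hAc, hAo⟩ with h | h
  · left
    intro x hx
    rw [ordAt_eq_top_iff hf] at hx
    have : x ∈ A := hx
    rw [h] at this; exact this
  · right
    have : IsLocallyConstant f := by
      rw [IsLocallyConstant.iff_eventually_eq]
      intro x
      have : x ∈ A := h ▸ mem_univ x
      exact this
    exact this.apply_eq_of_preconnectedSpace

/-- A constant map has empty fibres over all points but one, so its `topologicalDegree` would be 0.
-/
theorem isHolEndo_of_degree [T2Space X] [ConnectedSpace X] {f : X → X}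
    (hf : MDifferentiable 𝓘(ℂ) 𝓘(ℂ) f) (hdeg : 2 ≤ topologicalDegree f) : IsHolEndo f := by
  refine ⟨hf, (nowhereConst_or_const hf).resolve_right fun h => ?_⟩
  obtain ⟨a⟩ : Nonempty X := inferInstance
  have h0 : (0 : ℕ) ∈ {d : ℕ | ∀ᶠ y in cofinite, (f ⁻¹' {y}).Finite ∧ (f ⁻¹' {y}).ncard = d} := by
    have : ∀ᶠ y in cofinite, y ≠ f a := (Set.finite_singleton (f a)).compl_mem_cofinite
    filter_upwards [this] with y hy
    have : f ⁻¹' {y} = ∅ := by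
      ext z
      simp only [mem_preimage, mem_singleton_iff, mem_empty_iff_false, iff_false]
      rw [h z a]; exact hy.symm
    simp [this]
  have : topologicalDegree f = 0 := Nat.sInf_eq_zero.2 (Or.inl h0)
  omega

variable [CompactSpace X] [T2Space X]

/-- A set without accumulation points is closed and discrete, hence finite by compactness. -/
lemma finite_of_forall_eventually {s : Set X} (h : ∀ x, ∀ᶠ y in 𝓝[≠] x, y ∉ s) : s.Finite := by
  have : IsClosed s ∧ IsDiscrete s := isClosed_and_discrete_iff.2 fun x => by
    rw [Filter.disjoint_principal_right]
    exact h x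
  exact this.1.isCompact.finite this.2

lemma eventually_nhdsNE_of_disc {h : ℂ → X} {ρ : ℝ} (H : IsDisc h ρ) {p : X → Prop}
    (hp : ∀ ζ ∈ ball (0 : ℂ) ρ, ζ ≠ 0 → p (h ζ)) : ∀ᶠ y in 𝓝[≠] (h 0), p y := by
  rw [eventually_nhdsWithin_iff]
  filter_upwards [(H.isOpen_image _ Subset.rfl isOpen_ball).mem_nhds
    ⟨0, mem_ball_self H.pos, rfl⟩] with y ⟨ζ, hζ, hy⟩ hne
  rw [← hy]
  refine hp ζ hζ ?_
  rintro rfl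
  exact hne hy.symm

lemma finite_critical {f : X → X} (hf : IsHolEndo f) : {x | localDegree f x ≠ 1}.Finite := by
  refine finite_of_forall_eventually fun x => ?_
  obtain ⟨h, ρ, H⟩ := exists_localModel hf.hol hf.nc x
  have := eventually_nhdsNE_of_disc H.disc (p := fun y => y ∉ {x | localDegree f x ≠ 1})
    (fun ζ hζ h0 => by simpa using H.one ζ hζ h0)
  rwa [H.zero] at this

lemma finite_fiber {f : X → X} (hf : IsHolEndo f) (y : X) : (f ⁻¹' {y}).Finite := by
  choose h ρ H using exists_localModel hf.hol hf.nc
  obtain ⟨S, hS, hS'⟩ := fiber_formula hf.continuous y (q := fun x => chartAt ℂ (f x)) (h := h)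
    (ρ := ρ) (fun x _ => H x)
  exact (hS' 1 one_pos).self_of_nhds.1

/-- The push-forward of functions, `(f_* u)(y) = ∑_{f x = y} d(f, x) u(x)`. -/
noncomputable abbrev push (f : X → X) (u : X → ℝ) : X → ℝ := fiberSum f (localDegree f) u

lemma push_eq_sum {f : X → X} (hf : IsHolEndo f) (u : X → ℝ) (y : X) :
    push f u y = ∑ z ∈ (finite_fiber hf y).toFinset, (localDegree f z : ℝ) * u z :=
  finsum_mem_eq_finite_toFinset_sum _ _

/-- The count with multiplicity does not depend on the point, and off the finitely many critical
values it is the plain number of preimages. As `X` is infinite, two cofinite sets meet, so only one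
number can qualify in the definition of the degree. -/
theorem push_one [ConnectedSpace X] {f : X → X} (hf : IsHolEndo f) (y : X) :
    push f (fun _ => 1) y = topologicalDegree f := by
  have hloc : ∀ x, ∃ q h ρ, LocalModel f (localDegree f) x q h ρ := fun x => by
    obtain ⟨h, ρ, H⟩ := exists_localModel hf.hol hf.nc x
    exact ⟨_, h, ρ, H⟩
  have hinf : Infinite X := infinite_surface
  have hev : ∀ᶠ z in cofinite, ((f ⁻¹' {z}).ncard : ℝ) = push f (fun _ => 1) y := by
    have := ((finite_critical hf).image f).compl_mem_cofinite
    filter_upwards [this] with z hz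
    rw [push, fiberSum_one_eq hf.continuous hloc y z]
    have := push_eq_sum hf (fun _ => 1) z
    rw [push] at this
    rw [this, Set.ncard_eq_toFinset_card _ (finite_fiber hf z), Finset.card_eq_sum_ones, Nat.cast_sum]
    refine Finset.sum_congr rfl fun w hw => ?_
    have hw' : f w = z := by simpa using hw
    have : localDegree f w = 1 := by
      by_contra hne
      exact hz ⟨w, hne, hw'⟩
    simp [this]
  obtain ⟨z₀, hz₀⟩ := hev.exists
  have hset : {d : ℕ | ∀ᶠ y in cofinite, (f ⁻¹' {y}).Finite ∧ (f ⁻¹' {y}).ncard = d} =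
      {(f ⁻¹' {z₀}).ncard} := by
    ext d
    simp only [mem_ofPred_eq, mem_singleton_iff]
    constructor
    · intro h
      obtain ⟨z, hz1, hz2⟩ := (h.and hev).exists
      rw [← hz₀] at hz2
      rw [← hz1.2]; exact_mod_cast hz2
    · rintro rfl
      filter_upwards [hev] with z hz
      refine ⟨finite_fiber hf z, ?_⟩
      rw [← hz₀] at hz
      exact_mod_cast hz
  rw [topologicalDegree, hset, csInf_singleton, hz₀]

/-- The roots `s x y` need not depend continuously on `y`, but they tend to 0 as `y` tends to `y₀`,
which is all that continuity at `y₀` requires. -/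
lemma continuous_push {f : X → X} (hf : IsHolEndo f) {u : X → ℝ} (hu : Continuous u) :
    Continuous (push f u) := by
  rw [continuous_iff_continuousAt]
  intro y₀
  choose h ρ H using exists_localModel hf.hol hf.nc
  obtain ⟨S, hS, hS'⟩ := fiber_formula hf.continuous y₀ (q := fun x => chartAt ℂ (f x)) (h := h)
    (ρ := ρ) (fun x _ => H x)
  have hroot : ∀ x y, ∃ s : ℂ, s ^ localDegree f x = chartAt ℂ (f x) y - chartAt ℂ (f x) y₀ :=
    fun x y => IsAlgClosed.exists_pow_nat_eq _ (Nat.pos_of_ne_zero (H x).ne)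
  choose s hs using hroot
  have hs0 : ∀ x ∈ S, Tendsto (s x) (𝓝 y₀) (𝓝 0) := by
    intro x hx
    rw [Metric.tendsto_nhds]
    intro ε hε
    filter_upwards [hS' ε hε] with y hy
    rw [dist_zero_right]
    exact (hy.2.1 x hx _ (hs x y)).1
  have hev : (fun y => ∑ x ∈ S, ∑ j ∈ Finset.range (localDegree f x),
      u (h x (s x y * rootOne (localDegree f x) ^ j))) =ᶠ[𝓝 y₀] push f u := by
    filter_upwards [hS' 1 one_pos] with y hy
    exact (hy.2.2 (fun x => s x y) (fun x _ => hs x y) u).symm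
  refine ContinuousAt.congr ?_ hev
  refine tendsto_finsetSum _ fun x hx => tendsto_finsetSum _ fun j _ => ?_
  have h0 : s x y₀ = 0 := by
    have := hs x y₀
    rwa [sub_self, pow_eq_zero_iff (H x).ne] at this
  have h1 : Tendsto (fun y => s x y * rootOne (localDegree f x) ^ j) (𝓝 y₀) (𝓝 0) := by
    simpa using (hs0 x hx).mul_const (rootOne (localDegree f x) ^ j)
  have h2 : ContinuousAt (h x) 0 := ((H x).disc.hol 0 (mem_ball_self (H x).disc.pos)).continuousAt
  rw [h0, zero_mul]
  exact (hu.continuousAt.comp h2).tendsto.comp h1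

lemma push_comp {f g : X → X} (hf : IsHolEndo f) (hg : IsHolEndo g) (hgf : IsHolEndo (g ∘ f))
    (u : X → ℝ) : push (g ∘ f) u = push g (push f u) := by
  classical
  funext y
  rw [push_eq_sum hg, push_eq_sum hgf]
  have : (finite_fiber hgf y).toFinset =
      (finite_fiber hg y).toFinset.biUnion fun z => (finite_fiber hf z).toFinset := by
    ext w; simp
  rw [this, Finset.sum_biUnion]
  · refine Finset.sum_congr rfl fun z _ => ?_
    rw [push_eq_sum hf, Finset.mul_sum]
    refine Finset.sum_congr rfl fun w hw => ?_
    have hw' : f w = z := by simpa using hw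
    rw [localDegree_comp hf.hol hg.hol, hw']
    push_cast; ring
  · intro z _ z' _ hne
    rw [Function.onFun, Finset.disjoint_left]
    intro w hw hw'
    simp only [Finite.mem_toFinset, mem_preimage, mem_singleton_iff] at hw hw'
    exact hne (hw.symm.trans hw')

lemma IsHolEndo.comp {f g : X → X} (hf : IsHolEndo f) (hg : IsHolEndo g) : IsHolEndo (g ∘ f) :=
  ⟨hg.hol.comp hf.hol, hf.nc.comp hf.hol hg.hol hg.nc⟩

lemma isHolEndo_id : IsHolEndo (id : X → X) := by
  refine ⟨mdifferentiable_id, fun x => ?_⟩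
  change ordAt (chartAt ℂ x ∘ id) x ≠ ⊤
  rw [Function.comp_id, ordAt_chartAt (mem_chart_source ℂ x)]
  exact ENat.one_ne_top

lemma IsHolEndo.iterate {f : X → X} (hf : IsHolEndo f) (n : ℕ) : IsHolEndo f^[n] := by
  induction n with
  | zero => exact isHolEndo_id
  | succ n ih => rw [Function.iterate_succ']; exact ih.comp hf

lemma push_id (u : X → ℝ) : push (id : X → X) u = u := by
  funext y
  have h1 : localDegree (id : X → X) y = 1 := by
    rw [localDegree_eq, id, Function.comp_id, ordAt_chartAt (mem_chart_source ℂ y)]; rfl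
  simp [push, fiberSum, h1]

/-- The normalized transfer operator. -/
noncomputable def transfer (f : X → X) (u : X → ℝ) : X → ℝ := fun y =>
  (topologicalDegree f : ℝ)⁻¹ * push f u y

lemma push_const_mul {f : X → X} (hf : IsHolEndo f) (c : ℝ) (u : X → ℝ) (y : X) :
    push f (fun x => c * u x) y = c * push f u y := by
  rw [push_eq_sum hf, push_eq_sum hf, Finset.mul_sum]
  exact Finset.sum_congr rfl fun _ _ => by ring

lemma push_iterate {f : X → X} (hf : IsHolEndo f) (h0 : topologicalDegree f ≠ 0) (n : ℕ)
    (u : X → ℝ) (y : X) :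
    push f^[n] u y = (topologicalDegree f : ℝ) ^ n * (transfer f)^[n] u y := by
  induction n generalizing y with
  | zero => simp only [Function.iterate_zero, pow_zero, one_mul, push_id]; rfl
  | succ n ih =>
    have h1 : f^[n + 1] = f ∘ f^[n] := Function.iterate_succ' f n
    rw [h1, push_comp (hf.iterate n) hf ((hf.iterate n).comp hf)]
    have h2 : push f^[n] u = fun y => (topologicalDegree f : ℝ) ^ n * (transfer f)^[n] u y :=
      funext ih
    rw [h2, push_const_mul hf, Function.iterate_succ_apply', transfer]
    have : (topologicalDegree f : ℝ) ≠ 0 := by exact_mod_cast h0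
    field_simp
    ring

lemma transfer_iterate_eq {f : X → X} (hf : IsHolEndo f) (h0 : topologicalDegree f ≠ 0) (n : ℕ)
    (u : X → ℝ) (y : X) :
    (transfer f)^[n] u y = ((topologicalDegree f : ℝ) ^ n)⁻¹ * push f^[n] u y := by
  have : (topologicalDegree f : ℝ) ≠ 0 := by exact_mod_cast h0
  rw [push_iterate hf h0, inv_mul_cancel_left₀ (pow_ne_zero n this)]

lemma continuous_transfer {f : X → X} (hf : IsHolEndo f) {u : X → ℝ} (hu : Continuous u) :
    Continuous (transfer f u) := (continuous_push hf hu).const_mul _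

lemma continuous_transfer_iterate {f : X → X} (hf : IsHolEndo f) {u : X → ℝ} (hu : Continuous u)
    (n : ℕ) : Continuous ((transfer f)^[n] u) := by
  induction n with
  | zero => exact hu
  | succ n ih => rw [Function.iterate_succ_apply']; exact continuous_transfer hf ih

variable [ConnectedSpace X]

/-- Apply `push_iterate` to the constant 1, which the transfer operator fixes. -/
lemma degree_iterate {f : X → X} (hf : IsHolEndo f) (h0 : topologicalDegree f ≠ 0) (n : ℕ) :
    topologicalDegree f^[n] = topologicalDegree f ^ n := by
  obtain ⟨y⟩ : Nonempty X := inferInstance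
  have h1 : (topologicalDegree f : ℝ) ≠ 0 := by exact_mod_cast h0
  have hT : ∀ n, (transfer f)^[n] (fun _ => (1 : ℝ)) = fun _ => 1 := by
    intro n
    induction n with
    | zero => rfl
    | succ n ih =>
      rw [Function.iterate_succ_apply', ih]
      funext y
      rw [transfer, push_one hf, inv_mul_cancel₀ h1]
  have := push_iterate hf h0 n (fun _ => 1) y
  rw [push_one (hf.iterate n), hT, mul_one] at this
  exact_mod_cast this

/-- `transfer f u y` is a mean of `u` over the fibre with nonnegative weights of total mass 1. -/
lemma abs_transfer_sub_le {f : X → X} (hf : IsHolEndo f) (h0 : topologicalDegree f ≠ 0)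
    {u v : X → ℝ} {c : ℝ} {y : X} (h : ∀ z, f z = y → |u z - v z| ≤ c) :
    |transfer f u y - transfer f v y| ≤ c := by
  have h1 : (0 : ℝ) < topologicalDegree f := by exact_mod_cast Nat.pos_of_ne_zero h0
  have h2 : |push f u y - push f v y| ≤ topologicalDegree f * c := by
    rw [← push_one hf y, push_eq_sum hf, push_eq_sum hf, push_eq_sum hf, ← Finset.sum_sub_distrib,
      Finset.sum_mul]
    refine (Finset.abs_sum_le_sum_abs _ _).trans (Finset.sum_le_sum fun z hz => ?_)
    rw [← mul_sub, abs_mul, Nat.abs_cast, mul_one]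
    exact mul_le_mul_of_nonneg_left (h z (by simpa using hz)) (Nat.cast_nonneg _)
  rw [transfer, transfer, ← mul_sub, abs_mul, abs_of_pos (inv_pos.2 h1), inv_mul_le_iff₀ h1]
  exact h2

lemma transfer_const {f : X → X} (hf : IsHolEndo f) (h0 : topologicalDegree f ≠ 0) (c : ℝ) (y : X) :
    transfer f (fun _ => c) y = c := by
  have h1 : (topologicalDegree f : ℝ) ≠ 0 := by exact_mod_cast h0
  have := push_const_mul hf c (fun _ => 1) y
  simp only [mul_one] at this
  rw [transfer, this, push_one hf]
  field_simp

lemma abs_transfer_sub_const_le {f : X → X} (hf : IsHolEndo f) (h0 : topologicalDegree f ≠ 0)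
    {u : X → ℝ} {a c : ℝ} {y : X} (h : ∀ z, f z = y → |u z - a| ≤ c) :
    |transfer f u y - a| ≤ c := by
  have := abs_transfer_sub_le hf h0 (u := u) (v := fun _ => a) h
  rwa [transfer_const hf h0] at this

lemma transfer_congr {f : X → X} (hf : IsHolEndo f) {u v : X → ℝ} {y : X}
    (h : ∀ z, f z = y → u z = v z) : transfer f u y = transfer f v y := by
  rw [transfer, transfer, push_eq_sum hf, push_eq_sum hf]
  congr 1
  exact Finset.sum_congr rfl fun z hz => by rw [h z (by simpa using hz)]

lemma transfer_add {f : X → X} (hf : IsHolEndo f) (u v : X → ℝ) :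
    transfer f (u + v) = transfer f u + transfer f v := by
  funext y
  simp only [Pi.add_apply, transfer, push_eq_sum hf, mul_add, Finset.sum_add_distrib]

lemma transfer_nonneg {f : X → X} (hf : IsHolEndo f) {u : X → ℝ} (hu : ∀ x, 0 ≤ u x) (y : X) :
    0 ≤ transfer f u y := by
  rw [transfer, push_eq_sum hf]
  exact mul_nonneg (by positivity) (Finset.sum_nonneg fun z _ => mul_nonneg (by positivity) (hu z))

lemma transfer_iterate_add {f : X → X} (hf : IsHolEndo f) (n : ℕ) (u v : X → ℝ) :
    (transfer f)^[n] (u + v) = (transfer f)^[n] u + (transfer f)^[n] v := by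
  induction n with
  | zero => rfl
  | succ n ih => simp only [Function.iterate_succ_apply', ih, transfer_add hf]

lemma transfer_iterate_nonneg {f : X → X} (hf : IsHolEndo f) (n : ℕ) {u : X → ℝ}
    (hu : ∀ x, 0 ≤ u x) (y : X) : 0 ≤ (transfer f)^[n] u y := by
  induction n generalizing y with
  | zero => exact hu y
  | succ n ih => rw [Function.iterate_succ_apply']; exact transfer_nonneg hf ih y

lemma transfer_iterate_sub_le {f : X → X} (hf : IsHolEndo f) (h0 : topologicalDegree f ≠ 0) (n : ℕ)
    {u v : X → ℝ} {c : ℝ} (h : ∀ z, |u z - v z| ≤ c) (y : X) :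
    |(transfer f)^[n] u y - (transfer f)^[n] v y| ≤ c := by
  induction n generalizing y with
  | zero => exact h y
  | succ n ih =>
    rw [Function.iterate_succ_apply', Function.iterate_succ_apply']
    exact abs_transfer_sub_le hf h0 fun z _ => ih z

lemma transfer_iterate_const {f : X → X} (hf : IsHolEndo f) (h0 : topologicalDegree f ≠ 0) (n : ℕ)
    (c : ℝ) (y : X) : (transfer f)^[n] (fun _ => c) y = c := by
  induction n generalizing y with
  | zero => rfl
  | succ n ih =>
    rw [Function.iterate_succ_apply']
    have : (transfer f)^[n] (fun _ => c) = fun _ => c := funext ih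
    rw [this, transfer_const hf h0]

lemma abs_transfer_iterate_le {f : X → X} (hf : IsHolEndo f) (h0 : topologicalDegree f ≠ 0) (n : ℕ)
    {u : X → ℝ} {c : ℝ} (h : ∀ z, |u z| ≤ c) (y : X) : |(transfer f)^[n] u y| ≤ c := by
  have := transfer_iterate_sub_le hf h0 n (u := u) (v := fun _ => 0) (c := c) (by simpa using h) y
  rwa [transfer_iterate_const hf h0, sub_zero] at this

end Degree

/-! ### Duality between pullback of measures and the transfer operator -/

section Measures

variable {X : Type*} [TopologicalSpace X] [ChartedSpace ℂ X] [IsManifold 𝓘(ℂ) ω X]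
  [CompactSpace X] [T2Space X] [ConnectedSpace X] [MeasurableSpace X] [BorelSpace X]

lemma secondCountable_surface (X : Type*) [TopologicalSpace X] [ChartedSpace ℂ X] [CompactSpace X] :
    SecondCountableTopology X := ChartedSpace.secondCountable_of_sigmaCompact ℂ X

lemma fiberMeasure_eq_sum {f : X → X} (hf : IsHolEndo f) (y : X) :
    fiberMeasure f y = ∑ z ∈ (finite_fiber hf y).toFinset,
      (localDegree f z : ℝ≥0∞) • Measure.dirac z := by
  have := (finite_fiber hf y).fintype
  rw [fiberMeasure, Measure.sum_fintype]
  rw [Finset.sum_subtype (finite_fiber hf y).toFinset (p := fun z => z ∈ f ⁻¹' {y})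
    (fun z => by simp) (fun z => (localDegree f z : ℝ≥0∞) • Measure.dirac z)]

lemma fiberMeasure_univ {f : X → X} (hf : IsHolEndo f) (y : X) :
    fiberMeasure f y univ = topologicalDegree f := by
  have h := push_one hf y
  rw [push_eq_sum hf] at h
  rw [fiberMeasure_eq_sum hf]
  simp only [mul_one] at h
  simp only [Measure.coe_finsetSum, Finset.sum_apply, Measure.smul_apply, measure_univ, smul_eq_mul,
    mul_one]
  exact_mod_cast h

instance isFiniteMeasure_fiberMeasure {f : X → X} [hf : Fact (IsHolEndo f)] (y : X) :
    IsFiniteMeasure (fiberMeasure f y) :=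
  ⟨by rw [fiberMeasure_univ hf.out]; exact ENNReal.natCast_lt_top _⟩

lemma lintegral_fiberMeasure {f : X → X} (hf : IsHolEndo f) {u : X → ℝ} (hu : Continuous u)
    (h0 : ∀ x, 0 ≤ u x) (y : X) :
    ∫⁻ x, ENNReal.ofReal (u x) ∂(fiberMeasure f y) = ENNReal.ofReal (push f u y) := by
  rw [fiberMeasure_eq_sum hf, push_eq_sum hf, lintegral_finsetSum_measure,
    ENNReal.ofReal_sum_of_nonneg (fun z _ => mul_nonneg (Nat.cast_nonneg _) (h0 z))]
  refine Finset.sum_congr rfl fun z _ => ?_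
  rw [lintegral_smul_measure, lintegral_dirac' _ hu.measurable.ennreal_ofReal,
    ENNReal.ofReal_mul (Nat.cast_nonneg _), ENNReal.ofReal_natCast, smul_eq_mul]

/-- Closed sets form a generating π-system, and their indicators are limits of continuous functions,
whose push-forwards are continuous. -/
lemma measurable_fiberMeasure {f : X → X} (hf : IsHolEndo f) : Measurable (fiberMeasure f) := by
  have := secondCountable_surface X
  have : Fact (IsHolEndo f) := ⟨hf⟩
  refine Measurable.measure_of_isPiSystem (S := {s | IsClosed s}) ?_ isPiSystem_isClosed ?_ ?_
  · rw [← borel_eq_generateFrom_isClosed]; exact BorelSpace.measurable_eq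
  · intro s hs
    have hs' : IsClosed s := hs
    refine measurable_of_tendsto_metrizable (f := fun n y =>
      ∫⁻ x, (hs'.apprSeq n x : ℝ≥0∞) ∂(fiberMeasure f y)) (fun n => ?_)
      (tendsto_pi_nhds.2 fun y => HasOuterApproxClosed.tendsto_lintegral_apprSeq hs' _)
    have h1 : ∀ y, ∫⁻ x, (hs'.apprSeq n x : ℝ≥0∞) ∂(fiberMeasure f y) =
        ENNReal.ofReal (push f (fun x => (hs'.apprSeq n x : ℝ)) y) := by
      intro y
      rw [← lintegral_fiberMeasure hf (by fun_prop) (fun x => NNReal.coe_nonneg _)]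
      simp
    simp only [h1]
    exact (continuous_push hf (by fun_prop)).measurable.ennreal_ofReal
  · simp only [fiberMeasure_univ hf]
    exact measurable_const

lemma pullback_univ {f : X → X} (hf : IsHolEndo f) (ν : Measure X) [IsProbabilityMeasure ν] :
    pullback f ν univ = topologicalDegree f := by
  rw [pullback, Measure.bind_apply MeasurableSet.univ (measurable_fiberMeasure hf).aemeasurable]
  simp [fiberMeasure_univ hf]

lemma isProbabilityMeasure_normalizedPullback {f : X → X} (hf : IsHolEndo f)
    (h0 : topologicalDegree f ≠ 0) (n : ℕ) (ν : Measure X) [IsProbabilityMeasure ν] :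
    IsProbabilityMeasure (normalizedPullback f n ν) := by
  refine ⟨?_⟩
  rw [normalizedPullback, Measure.smul_apply, pullback_univ (hf.iterate n), degree_iterate hf h0,
    smul_eq_mul, Nat.cast_pow]
  refine ENNReal.inv_mul_cancel ?_ ?_
  · exact pow_ne_zero _ (by exact_mod_cast h0)
  · exact ENNReal.pow_ne_top (ENNReal.natCast_ne_top _)

lemma integrable_of_continuous {ν : Measure X} [IsFiniteMeasure ν] {u : X → ℝ}
    (hu : Continuous u) : Integrable u ν :=
  have := secondCountable_surface X
  (BoundedContinuousFunction.mkOfCompact ⟨u, hu⟩).integrable ν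

/-- For `u ≥ 0` this is the formula for the lower integral against `Measure.bind`; a general `u`
becomes nonnegative after adding a constant, which the transfer operator preserves. -/
theorem integral_normalizedPullback {f : X → X} (hf : IsHolEndo f) (h0 : topologicalDegree f ≠ 0)
    (n : ℕ) (ν : Measure X) [IsProbabilityMeasure ν] {u : X → ℝ} (hu : Continuous u) :
    ∫ x, u x ∂(normalizedPullback f n ν) = ∫ x, (transfer f)^[n] u x ∂ν := by
  have hP := isProbabilityMeasure_normalizedPullback hf h0 n ν
  have key : ∀ v : X → ℝ, Continuous v → (∀ x, 0 ≤ v x) →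
      ∫ x, v x ∂(normalizedPullback f n ν) = ∫ x, (transfer f)^[n] v x ∂ν := by
    intro v hv hv0
    rw [integral_eq_lintegral_of_nonneg_ae (Eventually.of_forall hv0) hv.measurable.aestronglyMeasurable,
      integral_eq_lintegral_of_nonneg_ae
        (Eventually.of_forall (transfer_iterate_nonneg hf n hv0))
        (continuous_transfer_iterate hf hv n).measurable.aestronglyMeasurable]
    congr 1
    rw [normalizedPullback, lintegral_smul_measure, pullback,
      Measure.lintegral_bind (measurable_fiberMeasure (hf.iterate n)).aemeasurable
        hv.measurable.ennreal_ofReal.aemeasurable, smul_eq_mul,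
      ← lintegral_const_mul' _ _ (by
        refine ENNReal.inv_ne_top.2 (pow_ne_zero _ (by exact_mod_cast h0)))]
    refine lintegral_congr fun y => ?_
    rw [lintegral_fiberMeasure (hf.iterate n) hv hv0, transfer_iterate_eq hf h0,
      ENNReal.ofReal_mul (by positivity), ENNReal.ofReal_inv_of_pos (by
        exact pow_pos (by exact_mod_cast Nat.pos_of_ne_zero h0) n), ENNReal.ofReal_pow (by positivity),
      ENNReal.ofReal_natCast]
  obtain ⟨c, hc⟩ : ∃ c, ∀ x, |u x| ≤ c := by
    obtain ⟨c, hc⟩ := isCompact_univ.exists_bound_of_continuousOn hu.continuousOn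
    exact ⟨c, fun x => hc x (mem_univ x)⟩
  have h1 := key (u + fun _ => c) (hu.add continuous_const) (fun x => by
    have := (abs_le.1 (hc x)).1
    simp only [Pi.add_apply]; linarith)
  rw [transfer_iterate_add hf] at h1
  simp only [Pi.add_apply] at h1
  rw [integral_add (integrable_of_continuous hu) (integrable_const _),
    integral_add (integrable_of_continuous (continuous_transfer_iterate hf hu n))
      (integrable_of_continuous (continuous_transfer_iterate hf continuous_const n))] at h1
  simp only [transfer_iterate_const hf h0] at h1
  simpa using h1

end Measures

/-! ### Smooth functions and a distance adapted to charts -/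

section Smooth

variable {X : Type*} [TopologicalSpace X] [ChartedSpace ℂ X] [IsManifold 𝓘(ℂ) ω X]
  {E : Type*} [NormedAddCommGroup E] [NormedSpace ℝ E]

/-- `ψ` is of class `C^n` (in the real sense) at `x`. -/
def SmoothAt (n : ℕ∞) (ψ : X → E) (x : X) : Prop :=
  ContDiffAt ℝ n (fun z => ψ ((chartAt ℂ x).symm z)) (chartAt ℂ x x)

/-- `ψ` is smooth (in the real sense). -/
def SmoothFn (ψ : X → E) : Prop := ∀ x, SmoothAt ⊤ ψ x

lemma SmoothAt.continuousAt {n : ℕ∞} {ψ : X → E} {x : X} (h : SmoothAt n ψ x) :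
    ContinuousAt ψ x := by
  have h1 : ContinuousAt (fun z => ψ ((chartAt ℂ x).symm z)) (chartAt ℂ x x) :=
    ContDiffAt.continuousAt h
  have h2 := ContinuousAt.comp (f := chartAt ℂ x) h1 (tendsto_chartAt x)
  refine h2.congr ?_
  filter_upwards [(chartAt ℂ x).open_source.mem_nhds (mem_chart_source ℂ x)] with y hy
  simp [(chartAt ℂ x).left_inv hy]

lemma SmoothFn.continuous {ψ : X → E} (h : SmoothFn ψ) : Continuous ψ :=
  continuous_iff_continuousAt.2 fun x => (h x).continuousAt

lemma SmoothAt.of_le {n m : ℕ∞} {ψ : X → E} {x : X} (h : SmoothAt n ψ x) (hm : m ≤ n) :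
    SmoothAt m ψ x := ContDiffAt.of_le h (by exact_mod_cast hm)

lemma SmoothAt.congr {n : ℕ∞} {ψ ψ' : X → E} {x : X} (h : SmoothAt n ψ x) (he : ψ =ᶠ[𝓝 x] ψ') :
    SmoothAt n ψ' x :=
  ContDiffAt.congr_of_eventuallyEq h ((eventually_chart_iff (p := fun y => ψ' y = ψ y) x).2
    (he.mono fun _ hy => hy.symm))

lemma _root_.AnalyticAt.contDiffAt_real {v : ℂ → ℂ} {z : ℂ} (hv : AnalyticAt ℂ v z) {n : ℕ∞} :
    ContDiffAt ℝ n v z := (hv.contDiffAt (n := n)).restrict_scalars ℝ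

lemma SmoothAt.comp_curve {n : ℕ∞} {ψ : X → E} {k : ℂ → X} {z : ℂ} (hψ : SmoothAt n ψ (k z))
    (hk : HolAt k z) : ContDiffAt ℝ n (fun w => ψ (k w)) z := by
  set e := chartAt ℂ (k z)
  have h1 : AnalyticAt ℂ (fun w => e (k w)) z := by
    rw [← holAt_iff_analyticAt]
    exact HolAt.comp (g := e) (f := k) (holAt_chartAt (mem_chart_source ℂ _)) hk
  have h2 := ContDiffAt.comp (f := fun w => e (k w)) z hψ h1.contDiffAt_real
  refine h2.congr_of_eventuallyEq ?_
  filter_upwards [hk.continuousAt.eventually (e.open_source.mem_nhds (mem_chart_source ℂ (k z)))]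
    with w hw
  simp only [Function.comp]
  rw [e.left_inv hw]

lemma SmoothAt.comp_hol {n : ℕ∞} {ψ : X → E} {b : X → X} {x : X} (hψ : SmoothAt n ψ (b x))
    (hb : HolAt b x) : SmoothAt n (ψ ∘ b) x := by
  have e1 : (chartAt ℂ x).symm (chartAt ℂ x x) = x := (chartAt ℂ x).left_inv (mem_chart_source ℂ x)
  refine SmoothAt.comp_curve (k := fun z => b ((chartAt ℂ x).symm z)) (by rwa [e1]) ?_
  exact HolAt.comp (g := b) (f := (chartAt ℂ x).symm) (by rwa [e1])
    (holAt_chartAt_symm (mem_chart_target ℂ x))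

lemma SmoothAt.comp_chart {n : ℕ∞} {v : ℂ → E} {q : X → ℂ} {x : X} (hv : ContDiffAt ℝ n v (q x))
    (hq : HolAt q x) : SmoothAt n (v ∘ q) x := by
  have e1 : (chartAt ℂ x).symm (chartAt ℂ x x) = x := (chartAt ℂ x).left_inv (mem_chart_source ℂ x)
  exact ContDiffAt.comp (f := fun z => q ((chartAt ℂ x).symm z)) _ (by rwa [e1])
    hq.analyticAt_comp_symm.contDiffAt_real

open Classical in
/-- Extension by zero of a function given in the chart at `x`. -/
noncomputable def chartExt (x : X) (v : ℂ → E) (y : X) : E :=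
  if y ∈ (chartAt ℂ x).source then v (chartAt ℂ x y) else 0

lemma chartExt_of_mem {x y : X} (v : ℂ → E) (hy : y ∈ (chartAt ℂ x).source) :
    chartExt x v y = v (chartAt ℂ x y) := if_pos hy

/-- The image of the compact set `K` is closed in the Hausdorff space `X`. This is what makes the
extension by zero smooth at the boundary of the chart domain. -/
lemma chartExt_eventually_zero [T2Space X] {x : X} {v : ℂ → E} {K : Set ℂ} (hK : IsCompact K)
    (hKt : K ⊆ (chartAt ℂ x).target) (hv : ∀ z ∉ K, v z = 0) {y : X}
    (hy : y ∉ (chartAt ℂ x).symm '' K) : ∀ᶠ w in 𝓝 y, chartExt x v w = 0 := by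
  have hc : IsCompact ((chartAt ℂ x).symm '' K) :=
    hK.image_of_continuousOn ((chartAt ℂ x).continuousOn_symm.mono hKt)
  filter_upwards [hc.isClosed.isOpen_compl.mem_nhds hy] with w hw
  by_cases hws : w ∈ (chartAt ℂ x).source
  · rw [chartExt_of_mem v hws]
    refine hv _ fun h => hw ⟨_, h, (chartAt ℂ x).left_inv hws⟩
  · exact if_neg hws

lemma smoothFn_chartExt [T2Space X] {x : X} {v : ℂ → E} {K : Set ℂ} (hK : IsCompact K)
    (hKt : K ⊆ (chartAt ℂ x).target) (hv : ∀ z ∉ K, v z = 0)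
    (hvs : ContDiff ℝ ∞ v) : SmoothFn (chartExt x v) := by
  intro y
  by_cases hy : y ∈ (chartAt ℂ x).source
  · have h1 : SmoothAt ⊤ (v ∘ chartAt ℂ x) y := SmoothAt.comp_chart hvs.contDiffAt (holAt_chartAt hy)
    refine h1.congr ?_
    filter_upwards [(chartAt ℂ x).open_source.mem_nhds hy] with w hw
    exact (chartExt_of_mem v hw).symm
  · have h2 : y ∉ (chartAt ℂ x).symm '' K := by
      rintro ⟨z, hz, rfl⟩
      exact hy ((chartAt ℂ x).map_target (hKt hz))
    have h1 : SmoothAt ⊤ (fun _ : X => (0 : E)) y := contDiffAt_const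
    exact h1.congr ((chartExt_eventually_zero hK hKt hv h2).mono fun _ h => h.symm)

/-- A radius such that the closed disc of that radius is contained in the chart at `x`. -/
lemma exists_closedBall_subset_target (x : X) :
    ∃ r > 0, closedBall (chartAt ℂ x x) r ⊆ (chartAt ℂ x).target := by
  obtain ⟨r, hr, h⟩ := Metric.nhds_basis_closedBall.mem_iff.1
    ((chartAt ℂ x).open_target.mem_nhds (mem_chart_target ℂ x))
  exact ⟨r, hr, h⟩

/-- A bump function at `x` supported in the chart. -/
lemma exists_bump (x : X) : ∃ b : ContDiffBump (chartAt ℂ x x),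
    closedBall (chartAt ℂ x x) b.rOut ⊆ (chartAt ℂ x).target := by
  obtain ⟨r, hr, h⟩ := exists_closedBall_subset_target x
  exact ⟨⟨r / 2, r, half_pos hr, half_lt_self hr⟩, h⟩

lemma bump_zero {c : ℂ} (b : ContDiffBump c) {z : ℂ} (hz : z ∉ closedBall c b.rOut) : b z = 0 := by
  refine b.zero_of_le_dist ?_
  rw [mem_closedBall, not_le] at hz
  exact hz.le

/-- A distance function comparable to the Euclidean one in charts. -/
structure IsChartDist (d : X → X → ℝ) : Prop where
  cont : Continuous (fun p : X × X => d p.1 p.2)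
  nonneg : ∀ x y, 0 ≤ d x y
  self : ∀ x, d x x = 0
  pos : ∀ x y, x ≠ y → 0 < d x y
  upper : ∀ (k : ℂ → X) (z : ℂ), HolAt k z → ∃ C ≥ 0, ∃ O ∈ 𝓝 z, ∀ ζ ∈ O, ∀ ζ' ∈ O,
    d (k ζ) (k ζ') ≤ C * ‖ζ - ζ'‖
  lower : ∀ y₀, ∃ C ≥ 0, ∃ O ∈ 𝓝 y₀, ∀ a ∈ O, ∀ b ∈ O,
    ‖chartAt ℂ y₀ a - chartAt ℂ y₀ b‖ ≤ C * d a b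

lemma SmoothFn.pi {ι : Type*} [Fintype ι] {ψ : ι → X → E} (h : ∀ i, SmoothFn (ψ i)) :
    SmoothFn (fun x i => ψ i x) := fun x => contDiffAt_pi.2 fun i => h i x

lemma SmoothFn.prodMk {E' : Type*} [NormedAddCommGroup E'] [NormedSpace ℝ E'] {ψ : X → E}
    {ψ' : X → E'} (h : SmoothFn ψ) (h' : SmoothFn ψ') : SmoothFn (fun x => (ψ x, ψ' x)) :=
  fun x => ContDiffAt.prodMk (h x) (h' x)

/-- Finitely many bump functions, together with their products with the charts, embed `X` in a
finite-dimensional normed space; the distance is the induced one. It is locally Lipschitz along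
curves because the embedding is smooth, and it controls chart differences because, where a bump
equals 1, the chart is one of the components. -/
theorem exists_chartDist (X : Type*) [TopologicalSpace X] [ChartedSpace ℂ X]
    [IsManifold 𝓘(ℂ) ω X] [T2Space X] [CompactSpace X] : ∃ d : X → X → ℝ, IsChartDist d := by
  choose b hb using exists_bump (X := X)
  set O : X → Set X := fun x => (chartAt ℂ x).source ∩ chartAt ℂ x ⁻¹' ball (chartAt ℂ x x) (b x).rIn
  have hOo : ∀ x, IsOpen (O x) := fun x => (chartAt ℂ x).isOpen_inter_preimage isOpen_ball
  have hxO : ∀ x, x ∈ O x := fun x => ⟨mem_chart_source ℂ x, mem_ball_self (b x).rIn_pos⟩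
  obtain ⟨t, ht⟩ := isCompact_univ.elim_finite_subcover O hOo
    (fun x _ => mem_iUnion.2 ⟨x, hxO x⟩)
  have hcov : ∀ y, ∃ x ∈ t, y ∈ O x := fun y => by
    simpa only [mem_iUnion, exists_prop] using ht (mem_univ y)
  set β : X → X → ℝ := fun x => chartExt x (b x)
  set γ : X → X → ℂ := fun x => chartExt x (fun z => (b x z : ℝ) • z)
  have hcb : ∀ x, IsCompact (closedBall (chartAt ℂ x x) (b x).rOut) := fun x => isCompact_closedBall _ _
  have hβ : ∀ x, SmoothFn (β x) := fun x => smoothFn_chartExt (hcb x) (hb x)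
    (fun z hz => bump_zero _ hz) (b x).contDiff
  have hγ : ∀ x, SmoothFn (γ x) := fun x => smoothFn_chartExt (hcb x) (hb x)
    (fun z hz => by rw [bump_zero _ hz, zero_smul]) ((b x).contDiff.smul contDiff_id)
  set Ψ : X → (t → ℝ × ℂ) := fun y x => (β x y, γ x y)
  have hΨ : SmoothFn Ψ := SmoothFn.pi fun x => (hβ x).prodMk (hγ x)
  have hβ1 : ∀ x, ∀ y ∈ O x, β x y = 1 := fun x y hy => by
    rw [show β x y = b x (chartAt ℂ x y) from chartExt_of_mem _ hy.1]
    exact (b x).one_of_mem_closedBall (ball_subset_closedBall hy.2)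
  have hγ1 : ∀ x y, y ∈ (chartAt ℂ x).source → β x y = 1 → γ x y = chartAt ℂ x y := fun x y hy h1 => by
    have h2 : β x y = b x (chartAt ℂ x y) := chartExt_of_mem _ hy
    rw [show γ x y = (b x (chartAt ℂ x y) : ℝ) • chartAt ℂ x y from chartExt_of_mem _ hy, ← h2, h1,
      one_smul]
  have hβsrc : ∀ x y, β x y = 1 → y ∈ (chartAt ℂ x).source := fun x y h1 => by
    by_contra hy
    have : β x y = 0 := if_neg hy
    rw [this] at h1; exact zero_ne_one h1
  have hinj : Function.Injective Ψ := by
    intro y y' h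
    obtain ⟨x, hx, hy⟩ := hcov y
    have h1 := congrFun h ⟨x, hx⟩
    simp only [Ψ, Prod.mk.injEq] at h1
    have h2 := hβ1 x y hy
    have h3 : β x y' = 1 := by rw [← h1.1, h2]
    have h4 := hβsrc x y' h3
    refine (chartAt ℂ x).injOn hy.1 h4 ?_
    rw [← hγ1 x y hy.1 h2, ← hγ1 x y' h4 h3, h1.2]
  refine ⟨fun x y => ‖Ψ x - Ψ y‖, ?_, fun x y => norm_nonneg _, fun x => by simp, fun x y hxy => ?_,
    fun k z hk => ?_, fun y₀ => ?_⟩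
  · exact ((hΨ.continuous.comp continuous_fst).sub (hΨ.continuous.comp continuous_snd)).norm
  · exact norm_pos_iff.2 (sub_ne_zero.2 fun h => hxy (hinj h))
  · have h1 : ContDiffAt ℝ (⊤ : ℕ∞) (fun w => Ψ (k w)) z := (hΨ (k z)).comp_curve hk
    obtain ⟨C, O, hO, hL⟩ := (h1.of_le (m := 1) (by norm_cast)).exists_lipschitzOnWith
    refine ⟨C, C.2, O, hO, fun ζ hζ ζ' hζ' => ?_⟩
    have := hL.dist_le_mul ζ hζ ζ' hζ'
    rwa [dist_eq_norm, dist_eq_norm] at this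
  · obtain ⟨x, hx, hy⟩ := hcov y₀
    have h1 : HolAt (chartAt ℂ y₀ ∘ (chartAt ℂ x).symm) (chartAt ℂ x y₀) :=
      HolAt.comp (by rw [(chartAt ℂ x).left_inv hy.1]; exact holAt_chartAt (mem_chart_source ℂ _))
        (holAt_chartAt_symm ((chartAt ℂ x).map_source hy.1))
    have h2 : ContDiffAt ℝ (1 : ℕ∞) (chartAt ℂ y₀ ∘ (chartAt ℂ x).symm) (chartAt ℂ x y₀) :=
      (holAt_iff_analyticAt.1 h1).contDiffAt_real
    obtain ⟨C, V, hV, hL⟩ := h2.exists_lipschitzOnWith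
    refine ⟨C, C.2, O x ∩ (chartAt ℂ x) ⁻¹' V, inter_mem ((hOo x).mem_nhds hy)
      ((chartAt ℂ x).continuousAt hy.1 hV), fun a ha b hb => ?_⟩
    have h3 := hL.dist_le_mul _ ha.2 _ hb.2
    simp only [Function.comp, (chartAt ℂ x).left_inv ha.1.1, (chartAt ℂ x).left_inv hb.1.1] at h3
    rw [dist_eq_norm, dist_eq_norm] at h3
    refine h3.trans (mul_le_mul_of_nonneg_left ?_ C.2)
    rw [← hγ1 x a ha.1.1 (hβ1 x a ha.1), ← hγ1 x b hb.1.1 (hβ1 x b hb.1)]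
    exact (norm_snd_le ((Ψ a - Ψ b) ⟨x, hx⟩)).trans (norm_le_pi_norm (Ψ a - Ψ b) ⟨x, hx⟩)

end Smooth

/-! ### Matching of fibres and the iterated modulus of continuity -/

section Matching

/-- Take the root `s'` of `t` nearest to `s`: `s ^ d - t` is the product of the differences of `s`
with all d roots, and each of them is at least `‖s - s'‖` in norm. -/
lemma exists_near_root {d : ℕ} (hd : d ≠ 0) (s t : ℂ) :
    ∃ s' : ℂ, s' ^ d = t ∧ ‖s - s'‖ ^ d ≤ ‖s ^ d - t‖ := by
  obtain ⟨s₀, hs₀⟩ := IsAlgClosed.exists_pow_nat_eq t (Nat.pos_of_ne_zero hd)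
  have hne : (Polynomial.nthRootsFinset d (1 : ℂ)).Nonempty :=
    ⟨1, Polynomial.one_mem_nthRootsFinset (Nat.pos_of_ne_zero hd)⟩
  obtain ⟨ζ, hζ, hmin⟩ := Finset.exists_min_image _ (fun ζ => ‖s - ζ * s₀‖) hne
  have hζ1 : ζ ^ d = 1 := (Polynomial.mem_nthRootsFinset (Nat.pos_of_ne_zero hd) 1).1 hζ
  refine ⟨ζ * s₀, by rw [mul_pow, hζ1, one_mul, hs₀], ?_⟩
  rw [← hs₀, (rootOne_spec hd).pow_sub_pow_eq_prod_sub_mul _ _ (Nat.pos_of_ne_zero hd), norm_prod]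
  calc ‖s - ζ * s₀‖ ^ d = ∏ _ζ' ∈ Polynomial.nthRootsFinset d (1 : ℂ), ‖s - ζ * s₀‖ := by
        rw [Finset.prod_const, (rootOne_spec hd).card_nthRootsFinset]
    _ ≤ _ := Finset.prod_le_prod (fun _ _ => norm_nonneg _) fun ζ' hζ' => hmin ζ' hζ'

variable {X : Type*} [TopologicalSpace X] [ChartedSpace ℂ X] [IsManifold 𝓘(ℂ) ω X]
  [CompactSpace X] [T2Space X] [ConnectedSpace X]

/-- The fibres of `F` over `a` and `b` can be matched with `d x x' ^ δ ≤ C * d a b`. -/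
def Matched (F : X → X) (d : X → X → ℝ) (δ : ℕ) (C : ℝ) (a b : X) : Prop :=
  ∀ (u : X → ℝ) (η : ℝ), (∀ x x', F x = a → F x' = b → d x x' ^ δ ≤ C * d a b → |u x - u x'| ≤ η) →
    |transfer F u a - transfer F u b| ≤ η

lemma Matched.mono {F : X → X} {d : X → X → ℝ} (hd : IsChartDist d) {δ : ℕ} {C C' : ℝ} {a b : X}
    (h : Matched F d δ C a b) (hC : C ≤ C') : Matched F d δ C' a b := fun u η H =>
  h u η fun x x' hx hx' hxx' => H x x' hx hx'
    (hxx'.trans (mul_le_mul_of_nonneg_right hC (hd.nonneg a b)))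

/-- In the local model at x the fibres over a and b are rotations of roots s and s'. With s' nearest
to s, ‖s - s'‖ to the power of the local degree is at most the chart distance of a and b; the
parametrization `h x` is Lipschitz, so matching equal rotations gives the bound. -/
lemma matched_local {F : X → X} (hF : IsHolEndo F) (h0 : topologicalDegree F ≠ 0)
    {d : X → X → ℝ} (hd : IsChartDist d) {δ : ℕ} {y₀ : X}
    (hδ : ∀ x, F x = y₀ → localDegree F x ≤ δ) :
    ∃ C, ∃ O ∈ 𝓝 y₀, ∀ a ∈ O, ∀ b ∈ O, Matched F d δ C a b := by
  choose h ρ H using exists_localModel hF.hol hF.nc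
  obtain ⟨S, hS, hS'⟩ := fiber_formula hF.continuous y₀ (q := fun _ => chartAt ℂ y₀) (h := h)
    (ρ := ρ) (fun x hx => hx ▸ H x)
  obtain ⟨C₂, hC₂, O₂, hO₂, hL⟩ := hd.lower y₀
  have hU : ∀ x, ∃ C ≥ 0, ∃ O ∈ 𝓝 (0 : ℂ), ∀ ζ ∈ O, ∀ ζ' ∈ O,
      d (h x ζ) (h x ζ') ≤ C * ‖ζ - ζ'‖ := fun x =>
    hd.upper (h x) 0 ((H x).disc.hol 0 (mem_ball_self (H x).disc.pos))
  choose C₁ hC₁ O₁ hO₁ hU using hU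
  -- Roots smaller than 1/2 differ by at most 1, so that the exponent may be raised from the local
  -- degree to `δ`.
  have hr : ∃ ε > 0, ε ≤ 1 / 2 ∧ ∀ x ∈ S, ball (0 : ℂ) ε ⊆ O₁ x := by
    have : (⋂ x ∈ S, O₁ x) ∈ 𝓝 (0 : ℂ) := (Filter.biInter_finset_mem S).2 fun x _ => hO₁ x
    obtain ⟨ε, hε, hε'⟩ := Metric.mem_nhds_iff.1 this
    exact ⟨min ε (1 / 2), lt_min hε (by norm_num), min_le_right _ _, fun x hx =>
      (ball_subset_ball (min_le_left _ _)).trans (hε'.trans (biInter_subset_of_mem hx))⟩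
  obtain ⟨ε, hε, hε1, hεO⟩ := hr
  obtain ⟨C₃, hC₃⟩ : ∃ C₃, ∀ x ∈ S, C₁ x ^ δ ≤ C₃ :=
    ⟨∑ x ∈ S, C₁ x ^ δ, fun x hx => Finset.single_le_sum (f := fun x => C₁ x ^ δ)
      (fun x _ => pow_nonneg (hC₁ x) δ) hx⟩
  have hcard : ∑ x ∈ S, (localDegree F x : ℝ) = topologicalDegree F := by
    rw [← push_one hF y₀, push_eq_sum hF]
    simp only [mul_one]
    refine Finset.sum_congr ?_ fun _ _ => rfl
    ext x; simp [hS]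
  have hlam : (0 : ℝ) < topologicalDegree F := by exact_mod_cast Nat.pos_of_ne_zero h0
  refine ⟨C₃ * C₂, _, inter_mem hO₂ (hS' ε hε), fun a ha b hb u η hη => ?_⟩
  have hsa : ∀ x, ∃ s : ℂ, s ^ localDegree F x = chartAt ℂ y₀ a - chartAt ℂ y₀ y₀ := fun x =>
    IsAlgClosed.exists_pow_nat_eq _ (Nat.pos_of_ne_zero (H x).ne)
  choose s hs using hsa
  have hsb : ∀ x, ∃ s' : ℂ, s' ^ localDegree F x = chartAt ℂ y₀ b - chartAt ℂ y₀ y₀ ∧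
      ‖s x - s'‖ ^ localDegree F x ≤ ‖chartAt ℂ y₀ a - chartAt ℂ y₀ b‖ := fun x => by
    obtain ⟨s', h1, h2⟩ := exists_near_root (H x).ne (s x) (chartAt ℂ y₀ b - chartAt ℂ y₀ y₀)
    refine ⟨s', h1, ?_⟩
    rwa [hs x, sub_sub_sub_cancel_right] at h2
  choose s' hs' hss' using hsb
  have hpush : |push F u a - push F u b| ≤ topologicalDegree F * η := by
    rw [push, ha.2.2.2 s (fun x _ => hs x) u, hb.2.2.2 s' (fun x _ => hs' x) u, ← hcard,
      ← Finset.sum_sub_distrib, Finset.sum_mul]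
    refine (Finset.abs_sum_le_sum_abs _ _).trans (Finset.sum_le_sum fun x hx => ?_)
    rw [← Finset.sum_sub_distrib]
    have hterm : ∀ j ∈ Finset.range (localDegree F x), |u (h x (s x * rootOne (localDegree F x) ^ j)) -
        u (h x (s' x * rootOne (localDegree F x) ^ j))| ≤ η := by
      intro j hj
      have hroot : ∀ s : ℂ, (s * rootOne (localDegree F x) ^ j) ^ localDegree F x =
          s ^ localDegree F x := fun s => (pow_eq_iff_exists_rootOne (H x).ne).2 ⟨j, hj, rfl⟩
      have ra := ha.2.2.1 x hx _ ((hroot (s x)).trans (hs x))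
      have rb := hb.2.2.1 x hx _ ((hroot (s' x)).trans (hs' x))
      refine hη _ _ ra.2.2 rb.2.2 ?_
      have d1 := hU x _ (hεO x hx (mem_ball_zero_iff.2 ra.1)) _
        (hεO x hx (mem_ball_zero_iff.2 rb.1))
      rw [← sub_mul, norm_mul, norm_rootOne_pow (H x).ne, mul_one] at d1
      have n1 : ‖s x‖ < ε := (ha.2.2.1 x hx _ (hs x)).1
      have n2 : ‖s' x‖ < ε := (hb.2.2.1 x hx _ (hs' x)).1
      have n3 : ‖s x - s' x‖ ≤ 1 := by
        have := norm_sub_le (s x) (s' x); linarith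
      calc d _ _ ^ δ ≤ (C₁ x * ‖s x - s' x‖) ^ δ := pow_le_pow_left₀ (hd.nonneg _ _) d1 δ
        _ = C₁ x ^ δ * ‖s x - s' x‖ ^ δ := mul_pow _ _ _
        _ ≤ C₁ x ^ δ * ‖s x - s' x‖ ^ localDegree F x := by
            refine mul_le_mul_of_nonneg_left ?_ (pow_nonneg (hC₁ x) δ)
            exact pow_le_pow_of_le_one (norm_nonneg _) n3 (hδ x ((hS x).1 hx))
        _ ≤ C₃ * (C₂ * d a b) := by
            refine mul_le_mul (hC₃ x hx) ((hss' x).trans (hL a ha.1 b hb.1)) (by positivity) ?_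
            exact (pow_nonneg (hC₁ x) δ).trans (hC₃ x hx)
        _ = C₃ * C₂ * d a b := by ring
    refine (Finset.abs_sum_le_sum_abs _ _).trans ?_
    refine (Finset.sum_le_sum hterm).trans ?_
    simp
  rw [transfer, transfer, ← mul_sub, abs_mul, abs_of_pos (inv_pos.2 hlam), inv_mul_le_iff₀ hlam]
  exact hpush

/-- Compactness of `K ×ˢ K`: near the diagonal use the local matching; off the diagonal `d a b` is
bounded below, and for large `C` every pair of preimages satisfies the distance condition. -/
theorem exists_matched {F : X → X} (hF : IsHolEndo F) (h0 : topologicalDegree F ≠ 0)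
    {d : X → X → ℝ} (hd : IsChartDist d) {δ : ℕ} {K : Set X} (hK : IsClosed K)
    (hδ : ∀ x, F x ∈ K → localDegree F x ≤ δ) :
    ∃ C, ∀ a ∈ K, ∀ b ∈ K, Matched F d δ C a b := by
  obtain ⟨D, hD⟩ : ∃ D, ∀ x y, d x y ^ δ ≤ D := by
    obtain ⟨D, hD⟩ := isCompact_univ.exists_bound_of_continuousOn (hd.cont.pow δ).continuousOn
    exact ⟨D, fun x y => (le_abs_self _).trans (hD (x, y) (mem_univ _))⟩
  have key : ∃ C, ∀ p ∈ K ×ˢ K, Matched F d δ C p.1 p.2 := by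
    refine (hK.isCompact.prod hK.isCompact).induction_on
      (p := fun s => ∃ C, ∀ p ∈ s, Matched F d δ C p.1 p.2) ⟨0, by simp⟩ ?_ ?_ ?_
    · rintro s t hst ⟨C, hC⟩
      exact ⟨C, fun p hp => hC p (hst hp)⟩
    · rintro s t ⟨C, hC⟩ ⟨C', hC'⟩
      refine ⟨max C C', fun p hp => ?_⟩
      rcases hp with hp | hp
      · exact (hC p hp).mono hd (le_max_left _ _)
      · exact (hC' p hp).mono hd (le_max_right _ _)
    · rintro ⟨a, b⟩ ⟨ha, hb⟩
      rcases eq_or_ne a b with rfl | hab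
      · obtain ⟨C, O, hO, hC⟩ := matched_local hF h0 hd (y₀ := a) (δ := δ)
          (fun x hx => hδ x (hx ▸ ha))
        exact ⟨O ×ˢ O, mem_nhdsWithin_of_mem_nhds (prod_mem_nhds hO hO), C,
          fun p hp => hC p.1 hp.1 p.2 hp.2⟩
      · have hpos := hd.pos a b hab
        refine ⟨{p : X × X | d a b / 2 < d p.1 p.2}, mem_nhdsWithin_of_mem_nhds
          ((isOpen_lt continuous_const hd.cont).mem_nhds (by
            change d a b / 2 < d a b; linarith)), D / (d a b / 2), fun p hp u η H => ?_⟩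
        have hp' : d a b / 2 < d p.1 p.2 := hp
        have hall : ∀ x x', F x = p.1 → F x' = p.2 → |u x - u x'| ≤ η := by
          intro x x' hx hx'
          refine H x x' hx hx' ((hD x x').trans ?_)
          have hD0 : 0 ≤ D := (pow_nonneg (hd.nonneg a a) δ).trans (hD a a)
          rw [div_mul_eq_mul_div, le_div_iff₀ (by linarith)]
          exact mul_le_mul_of_nonneg_left hp'.le hD0
        refine abs_transfer_sub_const_le hF h0 fun x hx => ?_
        rw [abs_sub_comm]
        refine abs_transfer_sub_const_le hF h0 fun x' hx' => ?_
        rw [abs_sub_comm]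
        exact hall x x' hx hx'
  obtain ⟨C, hC⟩ := key
  exact ⟨C, fun a ha b hb => hC (a, b) ⟨ha, hb⟩⟩

/-- Iterated modulus of continuity on a backward invariant closed set. -/
theorem exists_modulus {F : X → X} (hF : IsHolEndo F) (h0 : topologicalDegree F ≠ 0)
    {d : X → X → ℝ} (hd : IsChartDist d) {δ : ℕ} (hδ2 : 2 ≤ δ) {K : Set X} (hK : IsClosed K)
    (hδ : ∀ x, F x ∈ K → localDegree F x ≤ δ) (hinv : ∀ x, F x ∈ K → x ∈ K)
    {φ : X → ℝ} (hφ : Continuous φ) {η : ℝ} (hη : 0 < η) :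
    ∃ B : ℝ, ∀ k : ℕ, ∀ a ∈ K, ∀ b ∈ K, d a b ≤ Real.exp (- B * δ ^ k) →
      |(transfer F)^[k] φ a - (transfer F)^[k] φ b| ≤ η := by
  obtain ⟨C, hC⟩ := exists_matched hF h0 hd hK hδ
  -- uniform continuity
  obtain ⟨r, hr, hφr⟩ : ∃ r > 0, ∀ a b, d a b ≤ r → |φ a - φ b| ≤ η := by
    set Z : Set (X × X) := {p | η ≤ |φ p.1 - φ p.2|}
    have hZ : IsClosed Z := isClosed_le continuous_const
      ((hφ.comp continuous_fst).sub (hφ.comp continuous_snd)).abs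
    rcases Z.eq_empty_or_nonempty with hZe | hZn
    · refine ⟨1, one_pos, fun a b _ => ?_⟩
      have : (a, b) ∉ Z := hZe ▸ notMem_empty _
      exact (not_le.1 this).le
    · obtain ⟨p, hp, hmin⟩ := hZ.isCompact.exists_isMinOn hZn hd.cont.continuousOn
      have hp0 : 0 < d p.1 p.2 := by
        refine hd.pos _ _ fun h => ?_
        have hp' : η ≤ |φ p.1 - φ p.2| := hp
        rw [h, sub_self, abs_zero] at hp'
        linarith
      refine ⟨d p.1 p.2 / 2, half_pos hp0, fun a b hab => ?_⟩
      by_contra hcon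
      have : (a, b) ∈ Z := (not_le.1 hcon).le
      have := hmin this
      simp only [mem_ofPred_eq] at this
      linarith
  set A : ℝ := Real.log (max C 1)
  have hA0 : 0 ≤ A := Real.log_nonneg (le_max_right _ _)
  have hCexp : C ≤ Real.exp A := by
    rw [Real.exp_log (by positivity)]; exact le_max_left _ _
  -- `L k` with `L (k+1) = δ L k + A`
  set L₀ : ℝ := max (-Real.log r) 0
  have hrec : ∀ k : ℕ, ∀ L : ℝ, (∀ a ∈ K, ∀ b ∈ K, d a b ≤ Real.exp (-L) →
      |(transfer F)^[k] φ a - (transfer F)^[k] φ b| ≤ η) →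
      ∀ a ∈ K, ∀ b ∈ K, d a b ≤ Real.exp (-(δ * L + A)) →
      |(transfer F)^[k + 1] φ a - (transfer F)^[k + 1] φ b| ≤ η := by
    intro k L hL a ha b hb hab
    rw [Function.iterate_succ_apply']
    -- Matched preimages stay in `K`, and the `δ`-th power of their distance is at most e^A e^{-(δL
    -- + A)} = (e^{-L})^δ.
    refine hC a ha b hb _ η fun x x' hx hx' hxx' => ?_
    refine hL x (hinv x (hx ▸ ha)) x' (hinv x' (hx' ▸ hb)) ?_
    have h1 : d x x' ^ δ ≤ Real.exp (-L) ^ δ := by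
      calc d x x' ^ δ ≤ C * d a b := hxx'
        _ ≤ Real.exp A * Real.exp (-(δ * L + A)) :=
            mul_le_mul hCexp hab (hd.nonneg _ _) (Real.exp_pos _).le
        _ = Real.exp (-L) ^ δ := by
            rw [← Real.exp_add, ← Real.exp_nat_mul]; congr 1; ring
    exact le_of_pow_le_pow_left₀ (by omega) (Real.exp_pos _).le h1
  refine ⟨L₀ + A, fun k => ?_⟩
  have hδ' : (2 : ℝ) ≤ δ := by exact_mod_cast hδ2
  -- The offset `-A` makes the induction close: δ((L₀ + A)δ^k - A) + A ≤ (L₀ + A)δ^{k+1} - A because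
  -- 2 ≤ δ.
  have main : ∀ k : ℕ, ∀ a ∈ K, ∀ b ∈ K, d a b ≤ Real.exp (-((L₀ + A) * δ ^ k - A)) →
      |(transfer F)^[k] φ a - (transfer F)^[k] φ b| ≤ η := by
    intro k
    induction k with
    | zero =>
      intro a _ b _ hab
      refine hφr a b (hab.trans ?_)
      rw [pow_zero, mul_one, add_sub_cancel_right]
      calc Real.exp (-L₀) ≤ Real.exp (Real.log r) :=
            Real.exp_le_exp.2 (by have := le_max_left (-Real.log r) 0; linarith)
        _ = r := Real.exp_log hr
    | succ k ih =>
      intro a ha b hb hab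
      refine hrec k _ ih a ha b hb (hab.trans (Real.exp_le_exp.2 ?_))
      rw [pow_succ]
      nlinarith
  intro a ha b hb hab
  refine main k a ha b hb (hab.trans (Real.exp_le_exp.2 ?_))
  linarith

end Matching

/-! ### Dirichlet energy and its contraction by the transfer operator -/

section PlaneCalculus

lemma det_fderiv_real (v : ℂ → ℂ) (z : ℂ) :
    |((fderiv ℂ v z).restrictScalars ℝ).det| = ‖deriv v z‖ ^ 2 := by
  have h1 : ((fderiv ℂ v z).restrictScalars ℝ).det =
      LinearMap.det ((fderiv ℂ v z : ℂ →ₗ[ℂ] ℂ).restrictScalars ℝ) := rfl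
  have h2 : LinearMap.det (fderiv ℂ v z : ℂ →ₗ[ℂ] ℂ) = deriv v z := by
    have : (fderiv ℂ v z : ℂ →ₗ[ℂ] ℂ) = (deriv v z) • (LinearMap.id : ℂ →ₗ[ℂ] ℂ) := by
      ext; simp
    rw [this, LinearMap.det_smul]; simp
  rw [h1, LinearMap.det_restrictScalars, h2, Algebra.norm_complex_apply, Complex.normSq_eq_norm_sq,
    abs_of_nonneg (by positivity)]

lemma lintegral_image_hol {v : ℂ → ℂ} {s : Set ℂ} (hs : MeasurableSet s)
    (hv : ∀ z ∈ s, AnalyticAt ℂ v z) (hinj : InjOn v s) (G : ℂ → ℝ≥0∞) :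
    ∫⁻ z in v '' s, G z = ∫⁻ z in s, ‖deriv v z‖ₑ ^ 2 * G (v z) := by
  rw [lintegral_image_eq_lintegral_abs_det_fderiv_mul volume hs
    (fun z hz => ((hv z hz).differentiableAt.hasFDerivAt.restrictScalars ℝ).hasFDerivWithinAt) hinj]
  refine setLIntegral_congr_fun hs fun z hz => ?_
  rw [det_fderiv_real, ENNReal.ofReal_pow (norm_nonneg _), ofReal_norm]

lemma norm_fderiv_real_eq {v : ℂ → ℂ} {z : ℂ} (hv : DifferentiableAt ℂ v z) :
    ‖fderiv ℝ v z‖ = ‖deriv v z‖ := by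
  rw [hv.fderiv_restrictScalars ℝ, ContinuousLinearMap.norm_restrictScalars, norm_deriv_eq_norm_fderiv]

end PlaneCalculus

section Energy

variable {X : Type*} [TopologicalSpace X] [ChartedSpace ℂ X] [IsManifold 𝓘(ℂ) ω X]

/-- An injective holomorphic parametrization of an open subset of `X`. -/
structure IsParam (g : ℂ → X) (W : Set ℂ) : Prop where
  isOpen : IsOpen W
  hol : ∀ z ∈ W, HolAt g z
  injOn : InjOn g W

lemma IsParam.continuousOn {g : ℂ → X} {W : Set ℂ} (H : IsParam g W) : ContinuousOn g W :=
  fun z hz => (H.hol z hz).continuousAt.continuousWithinAt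

lemma IsParam.finite_inter_preimage {g : ℂ → X} {W : Set ℂ} (H : IsParam g W) {V : Set X}
    (hV : V.Finite) : (W ∩ g ⁻¹' V).Finite :=
  Set.Finite.of_finite_image (hV.subset (by rintro _ ⟨z, hz, rfl⟩; exact hz.2))
    (H.injOn.mono inter_subset_left)

variable [MeasurableSpace X] [BorelSpace X]

lemma IsParam.measurableSet_inter_preimage {g : ℂ → X} {W : Set ℂ} (H : IsParam g W) {B : Set X}
    (hB : MeasurableSet B) : MeasurableSet (W ∩ g ⁻¹' B) := by
  have h1 : Measurable (W.domRestrict g) := (continuousOn_iff_continuous_domRestrict.1 H.continuousOn).measurable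
  have h2 := H.isOpen.measurableSet.subtype_image (h1 hB)
  convert h2 using 1
  ext z
  simp [and_comm]

/-- An energy bound is a local property: a countable subcover is made disjoint and the bounds are
added, and the finite set `V` has a null preimage. -/
lemma lintegral_le_of_locally [SecondCountableTopology X] {g : ℂ → X} {W : Set ℂ} (H : IsParam g W)
    {G : ℂ → ℝ≥0∞} {μ : Measure X} {V : Set X} (hV : V.Finite)
    (h : ∀ x ∉ V, ∃ O, IsOpen O ∧ x ∈ O ∧ ∀ B ⊆ O, MeasurableSet B →
      ∫⁻ z in W ∩ g ⁻¹' B, G z ≤ μ B) {B : Set X} (hB : MeasurableSet B) :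
    ∫⁻ z in W ∩ g ⁻¹' B, G z ≤ μ B := by
  have hO : ∀ x, ∃ O, IsOpen O ∧ (x ∉ V → x ∈ O) ∧ ∀ B ⊆ O, MeasurableSet B →
      ∫⁻ z in W ∩ g ⁻¹' B, G z ≤ μ B := by
    intro x
    by_cases hx : x ∈ V
    · refine ⟨∅, isOpen_empty, fun h => absurd hx h, fun B hB _ => ?_⟩
      rw [subset_empty_iff.1 hB]; simp
    · obtain ⟨O, h1, h2, h3⟩ := h x hx
      exact ⟨O, h1, fun _ => h2, h3⟩
  choose O hOo hxO hO using hO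
  obtain ⟨T, hT, hTU⟩ := TopologicalSpace.isOpen_iUnion_countable O hOo
  obtain ⟨P, hPo, hPV, hP⟩ : ∃ P : ℕ → Set X, (∀ n, IsOpen (P n)) ∧ Vᶜ ⊆ ⋃ n, P n ∧ ∀ n, ∀ B ⊆ P n,
      MeasurableSet B → ∫⁻ z in W ∩ g ⁻¹' B, G z ≤ μ B := by
    have hcov : Vᶜ ⊆ ⋃ i ∈ T, O i := by
      rw [hTU]; exact fun x hx => mem_iUnion.2 ⟨x, hxO x hx⟩
    rcases T.eq_empty_or_nonempty with rfl | hne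
    · refine ⟨fun _ => ∅, fun _ => isOpen_empty, by simpa using hcov, fun n B hB _ => ?_⟩
      rw [subset_empty_iff.1 hB]; simp
    · obtain ⟨t, rfl⟩ := hT.exists_eq_range hne
      exact ⟨fun n => O (t n), fun n => hOo _, by simpa using hcov, fun n => hO (t n)⟩
  have hPm : ∀ n, MeasurableSet (disjointed P n) := MeasurableSet.disjointed fun n => (hPo n).measurableSet
  have hsub : W ∩ g ⁻¹' B ⊆ (W ∩ g ⁻¹' V) ∪ ⋃ n, (W ∩ g ⁻¹' (B ∩ disjointed P n)) := by
    rintro z ⟨hz, hzB⟩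
    by_cases hzV : g z ∈ V
    · exact Or.inl ⟨hz, hzV⟩
    · have := hPV hzV
      rw [← iUnion_disjointed] at this
      obtain ⟨n, hn⟩ := mem_iUnion.1 this
      exact Or.inr (mem_iUnion.2 ⟨n, hz, hzB, hn⟩)
  calc ∫⁻ z in W ∩ g ⁻¹' B, G z
      ≤ ∫⁻ z in (W ∩ g ⁻¹' V) ∪ ⋃ n, (W ∩ g ⁻¹' (B ∩ disjointed P n)), G z := lintegral_mono_set hsub
    _ ≤ (∫⁻ z in W ∩ g ⁻¹' V, G z) + ∫⁻ z in ⋃ n, (W ∩ g ⁻¹' (B ∩ disjointed P n)), G z :=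
        lintegral_union_le (μ := volume) G _ _
    _ = ∫⁻ z in ⋃ n, (W ∩ g ⁻¹' (B ∩ disjointed P n)), G z := by
        rw [setLIntegral_measure_zero (W ∩ g ⁻¹' V) G ((H.finite_inter_preimage hV).measure_zero _), zero_add]
    _ ≤ ∑' n, ∫⁻ z in W ∩ g ⁻¹' (B ∩ disjointed P n), G z := lintegral_iUnion_le _ _
    _ ≤ ∑' n, μ (B ∩ disjointed P n) := ENNReal.tsum_le_tsum fun n =>
        hP n _ (inter_subset_right.trans (disjointed_subset P n)) (hB.inter (hPm n))
    _ = μ (⋃ n, B ∩ disjointed P n) := (measure_iUnion (fun i j hij =>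
        ((disjoint_disjointed P hij).mono inter_subset_right inter_subset_right))
          fun n => hB.inter (hPm n)).symm
    _ ≤ μ B := measure_mono (iUnion_subset fun n => inter_subset_left)

/-- The Dirichlet energy of `u`, a continuous function of class `C^1` off the finite set `V`, is
bounded by the measure `μ`. -/
structure EnergyLE (u : X → ℝ) (μ : Measure X) (V : Set X) : Prop where
  finite : V.Finite
  cont : Continuous u
  smooth : ∀ x ∉ V, SmoothAt 1 u x
  energy : ∀ g W, IsParam g W → ∀ B, MeasurableSet B →
    ∫⁻ z in W ∩ g ⁻¹' B, ‖fderiv ℝ (fun w => u (g w)) z‖ₑ ^ 2 ≤ μ B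

variable [CompactSpace X] [T2Space X] [ConnectedSpace X]

/-- The measure is the area of finitely many chart balls, weighted by the squares of bounds for the
derivative of φ there. For any parametrization g the factor |(e ∘ g)'|² produced by the chain rule
is the Jacobian of e ∘ g, so the energy is bounded by an area, whatever g is. -/
theorem exists_energyLE {φ : X → ℝ} (hφ : SmoothFn φ) :
    ∃ μ : Measure X, IsFiniteMeasure μ ∧ EnergyLE φ μ ∅ := by
  have := secondCountable_surface X
  choose r hr hrt using exists_closedBall_subset_target (X := X)
  set O : X → Set X := fun x => (chartAt ℂ x).source ∩ chartAt ℂ x ⁻¹' ball (chartAt ℂ x x) (r x)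
  have hOo : ∀ x, IsOpen (O x) := fun x => (chartAt ℂ x).isOpen_inter_preimage isOpen_ball
  obtain ⟨t, ht⟩ := isCompact_univ.elim_finite_subcover O hOo
    (fun x _ => mem_iUnion.2 ⟨x, mem_chart_source ℂ x, mem_ball_self (hr x)⟩)
  have hcov : ∀ y, ∃ x ∈ t, y ∈ O x := fun y => by
    simpa only [mem_iUnion, exists_prop] using ht (mem_univ y)
  have hφs : ∀ x, ∀ z ∈ (chartAt ℂ x).target,
      ContDiffAt ℝ (⊤ : ℕ∞) (fun w => φ ((chartAt ℂ x).symm w)) z := fun x z hz =>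
    (hφ _).comp_curve (holAt_chartAt_symm hz)
  have hC : ∀ x, ∃ C : ℝ, 0 ≤ C ∧ ∀ z ∈ closedBall (chartAt ℂ x x) (r x),
      ‖fderiv ℝ (fun w => φ ((chartAt ℂ x).symm w)) z‖ ≤ C := by
    intro x
    have h1 : ContinuousOn (fderiv ℝ (fun w => φ ((chartAt ℂ x).symm w)))
        (closedBall (chartAt ℂ x x) (r x)) := fun z hz =>
      (((hφs x z (hrt x hz)).fderiv_right (m := 0) (by norm_cast)).continuousAt).continuousWithinAt
    obtain ⟨C, hC⟩ := (isCompact_closedBall _ _).exists_bound_of_continuousOn h1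
    exact ⟨max C 0, le_max_right _ _, fun z hz => (hC z hz).trans (le_max_left _ _)⟩
  choose C hC0 hC using hC
  set m : X → Measure X := fun x => ENNReal.ofReal (C x) ^ 2 •
    Measure.map (chartAt ℂ x).symm (volume.restrict (ball (chartAt ℂ x x) (r x)))
  have hae : ∀ x, AEMeasurable (chartAt ℂ x).symm (volume.restrict (ball (chartAt ℂ x x) (r x))) :=
    fun x => (((chartAt ℂ x).continuousOn_symm.mono
      (ball_subset_closedBall.trans (hrt x))).aemeasurable measurableSet_ball)
  have hmfin : ∀ x, IsFiniteMeasure (m x) := fun x => by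
    have h1 : IsFiniteMeasure (volume.restrict (ball (chartAt ℂ x x) (r x))) :=
      ⟨by rw [Measure.restrict_apply_univ]; exact measure_ball_lt_top⟩
    refine ⟨?_⟩
    simp only [m, Measure.smul_apply, smul_eq_mul]
    exact ENNReal.mul_lt_top (ENNReal.pow_lt_top ENNReal.ofReal_lt_top) (measure_lt_top _ _)
  refine ⟨∑ x ∈ t, m x, inferInstance, finite_empty, hφ.continuous,
    fun x _ => (hφ x).of_le le_top, fun g W H B hB => ?_⟩
  refine lintegral_le_of_locally H finite_empty (fun y _ => ?_) hB
  obtain ⟨x, hx, hy⟩ := hcov y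
  refine ⟨O x, hOo x, hy, fun B hBO hB => ?_⟩
  set e := chartAt ℂ x
  have hmle : m x B ≤ (∑ x ∈ t, m x) B := by
    rw [Measure.finsetSum_apply]
    exact Finset.single_le_sum (f := fun x => m x B) (fun _ _ => zero_le) hx
  refine le_trans ?_ hmle
  set A := W ∩ g ⁻¹' B
  have hA : MeasurableSet A := H.measurableSet_inter_preimage hB
  have hsrc : ∀ z ∈ A, g z ∈ e.source := fun z hz => (hBO hz.2).1
  have heg : ∀ z ∈ A, AnalyticAt ℂ (fun w => e (g w)) z := fun z hz =>
    holAt_iff_analyticAt.1 (HolAt.comp (g := e) (f := g) (holAt_chartAt (hsrc z hz)) (H.hol z hz.1))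
  have hpt : ∀ z ∈ A, ‖fderiv ℝ (fun w => φ (g w)) z‖ₑ ^ 2 ≤
      ENNReal.ofReal (C x) ^ 2 * ‖deriv (fun w => e (g w)) z‖ₑ ^ 2 := by
    intro z hz
    have h1 : (fun w => φ (g w)) =ᶠ[𝓝 z] (fun w => φ (e.symm w)) ∘ (fun w => e (g w)) := by
      filter_upwards [(H.hol z hz.1).continuousAt.eventually (e.open_source.mem_nhds (hsrc z hz))]
        with w hw
      simp only [Function.comp]; rw [e.left_inv hw]
    have h2 : ‖fderiv ℝ (fun w => φ (g w)) z‖ ≤ C x * ‖deriv (fun w => e (g w)) z‖ := by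
      rw [h1.fderiv_eq, fderiv_comp (g := fun w => φ (e.symm w)) (f := fun w => e (g w)) z
        ((hφs x _ (e.map_source (hsrc z hz))).differentiableAt (by simp))
        ((heg z hz).differentiableAt.restrictScalars ℝ),
        ← norm_fderiv_real_eq (heg z hz).differentiableAt]
      refine (ContinuousLinearMap.opNorm_comp_le _ _).trans ?_
      exact mul_le_mul_of_nonneg_right (hC x _ (ball_subset_closedBall (hBO hz.2).2)) (norm_nonneg _)
    rw [← mul_pow, ← ofReal_norm, ← ofReal_norm, ← ENNReal.ofReal_mul (hC0 x)]
    gcongr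
  calc ∫⁻ z in A, ‖fderiv ℝ (fun w => φ (g w)) z‖ₑ ^ 2
      ≤ ∫⁻ z in A, ENNReal.ofReal (C x) ^ 2 * ‖deriv (fun w => e (g w)) z‖ₑ ^ 2 :=
        setLIntegral_mono' hA hpt
    _ = ENNReal.ofReal (C x) ^ 2 * ∫⁻ z in A, ‖deriv (fun w => e (g w)) z‖ₑ ^ 2 :=
        lintegral_const_mul' _ _ (ENNReal.pow_ne_top ENNReal.ofReal_ne_top)
    _ = ENNReal.ofReal (C x) ^ 2 * volume ((fun w => e (g w)) '' A) := by
        congr 1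
        have := lintegral_image_hol (v := fun w => e (g w)) hA heg (fun z hz w hw hzw =>
          H.injOn hz.1 hw.1 (e.injOn (hsrc z hz) (hsrc w hw) hzw)) (fun _ => 1)
        simpa using this.symm
    _ ≤ m x B := by
        simp only [m, Measure.smul_apply, smul_eq_mul]
        refine mul_le_mul_right ?_ _
        rw [Measure.map_apply_of_aemeasurable (hae x) hB]
        refine (measure_mono ?_).trans (Measure.le_restrict_apply _ _)
        rintro _ ⟨z, hz, rfl⟩
        refine ⟨?_, (hBO hz.2).2⟩
        simp only [mem_preimage]
        rw [e.left_inv (hsrc z hz)]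
        exact hz.2

/-- Local inverse branches near a point over which there is no ramification. -/
lemma exists_branches {F : X → X} (hF : IsHolEndo F) {y₀ : X}
    (h1 : ∀ x, F x = y₀ → localDegree F x = 1) :
    ∃ (S : Finset X) (O : Set X) (b : X → X → X) (U : X → Set X), (∀ x, x ∈ S ↔ F x = y₀) ∧
      IsOpen O ∧ y₀ ∈ O ∧ (∀ x ∈ S, IsOpen (U x)) ∧ (S : Set X).PairwiseDisjoint U ∧
      (∀ x ∈ S, ∀ y ∈ O, HolAt (b x) y ∧ F (b x y) = y ∧ b x y ∈ U x) ∧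
      ∀ y ∈ O, ∀ u, push F u y = ∑ x ∈ S, u (b x y) := by
  choose h ρ H using exists_localModel hF.hol hF.nc
  obtain ⟨S, hS, hS'⟩ := fiber_formula hF.continuous y₀ (q := fun _ => chartAt ℂ y₀) (h := h)
    (ρ := ρ) (fun x hx => hx ▸ H x)
  obtain ⟨U, hU, hUd⟩ := S.finite_toSet.t2_separation
  set q : X → ℂ := fun y => chartAt ℂ y₀ y - chartAt ℂ y₀ y₀
  have hq0 : q y₀ = 0 := sub_self _
  have hqh : HolAt q y₀ := HolAt.comp (g := fun z : ℂ => z - chartAt ℂ y₀ y₀) (f := chartAt ℂ y₀)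
    (holAt_iff_analyticAt.2 (analyticAt_id.sub analyticAt_const)) (holAt_chartAt (mem_chart_source ℂ _))
  set b : X → X → X := fun x y => h x (q y)
  have hb0 : ∀ x, b x y₀ = x := fun x => by simp only [b, hq0, (H x).zero]
  have hbh : ∀ x, HolAt (b x) y₀ := fun x => HolAt.comp (g := h x) (f := q)
    (by rw [hq0]; exact (H x).disc.hol 0 (mem_ball_self (H x).disc.pos)) hqh
  have hev : ∀ᶠ y in 𝓝 y₀, ∀ x ∈ S, HolAt (b x) y ∧ b x y ∈ U x := by
    rw [Filter.eventually_all_finset]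
    intro x hx
    refine (hbh x).eventually.and ((hbh x).continuousAt.eventually ?_)
    rw [hb0]; exact (hU x).2.mem_nhds (hU x).1
  obtain ⟨O, hO, hOo, hyO⟩ := _root_.eventually_nhds_iff.1 (hev.and (hS' 1 one_pos))
  refine ⟨S, O, b, U, hS, hOo, hyO, fun x _ => (hU x).2, hUd, fun x hx y hy => ?_, fun y hy u => ?_⟩
  · obtain ⟨h2, h3⟩ := hO y hy
    refine ⟨(h2 x hx).1, ?_, (h2 x hx).2⟩
    exact (h3.2.1 x hx (q y) (by rw [h1 x ((hS x).1 hx), pow_one])).2.2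
  · obtain ⟨h2, h3⟩ := hO y hy
    rw [push, h3.2.2 (fun _ => q y) (fun x hx => by rw [h1 x ((hS x).1 hx), pow_one]) u]
    refine Finset.sum_congr rfl fun x hx => ?_
    rw [h1 x ((hS x).1 hx), Finset.sum_range_one, pow_zero, mul_one]

/-- The transfer operator contracts the energy. -/
theorem EnergyLE.transfer {F : X → X} (hF : IsHolEndo F) (h0 : topologicalDegree F ≠ 0)
    {u : X → ℝ} {μ : Measure X} {V : Set X} (hu : EnergyLE u μ V) :
    EnergyLE (transfer F u) (ENNReal.ofReal (topologicalDegree F : ℝ)⁻¹ • μ.map F)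
      (F '' (V ∪ {x | localDegree F x ≠ 1})) := by
  have := secondCountable_surface X
  set V' := F '' (V ∪ {x | localDegree F x ≠ 1})
  have hV' : V'.Finite := (hu.finite.union (finite_critical hF)).image F
  have hlam : (0 : ℝ) < topologicalDegree F := by exact_mod_cast Nat.pos_of_ne_zero h0
  have hbr : ∀ y₀ ∉ V', ∀ x, F x = y₀ → localDegree F x = 1 := fun y₀ hy₀ x hx => by
    by_contra hne
    exact hy₀ ⟨x, Or.inr hne, hx⟩
  have hVb : ∀ x, F x ∉ V' → x ∉ V := fun x hx hxV => hx ⟨x, Or.inl hxV, rfl⟩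
  refine ⟨hV', continuous_transfer hF hu.cont, fun y₀ hy₀ => ?_, fun g W H B hB => ?_⟩
  · obtain ⟨S, O, b, U, hS, hO, hyO, hU, hUd, hb, hpush⟩ := exists_branches hF (hbr y₀ hy₀)
    have h1 : SmoothAt 1 (fun y => (topologicalDegree F : ℝ)⁻¹ * ∑ x ∈ S, u (b x y)) y₀ := by
      refine ContDiffAt.mul contDiffAt_const (ContDiffAt.sum fun x hx => ?_)
      have h2 := hb x hx y₀ hyO
      exact SmoothAt.comp_hol (hu.smooth _ (hVb _ (by rw [h2.2.1]; exact hy₀))) h2.1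
    refine h1.congr ?_
    filter_upwards [hO.mem_nhds hyO] with y hy
    rw [HolomorphicDynamics.transfer, hpush y hy]
  · refine lintegral_le_of_locally H hV' (fun y₀ hy₀ => ?_) hB
    obtain ⟨S, O, b, U, hS, hO, hyO, hU, hUd, hb, hpush⟩ := exists_branches hF (hbr y₀ hy₀)
    have hcard : (S.card : ℝ) = topologicalDegree F := by
      rw [← push_one hF y₀, hpush y₀ hyO]; simp
    refine ⟨O ∩ V'ᶜ, hO.inter hV'.isClosed.isOpen_compl, ⟨hyO, hy₀⟩, fun B hBO hB => ?_⟩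
    set A := W ∩ g ⁻¹' B
    have hA : MeasurableSet A := H.measurableSet_inter_preimage hB
    have hWo : IsOpen (W ∩ g ⁻¹' O) := H.continuousOn.isOpen_inter_preimage H.isOpen hO
    have hp : ∀ x ∈ S, IsParam (b x ∘ g) (W ∩ g ⁻¹' O) := fun x hx =>
      ⟨hWo, fun z hz => HolAt.comp (hb x hx _ hz.2).1 (H.hol z hz.1), fun z hz w hw hzw =>
        H.injOn hz.1 hw.1 (by
          rw [← (hb x hx _ hz.2).2.1, ← (hb x hx _ hw.2).2.1]; exact congrArg F hzw)⟩
    have hpt : ∀ z ∈ A, ‖fderiv ℝ (fun w => HolomorphicDynamics.transfer F u (g w)) z‖ₑ ^ 2 ≤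
        ENNReal.ofReal (topologicalDegree F : ℝ)⁻¹ *
          ∑ x ∈ S, ‖fderiv ℝ (fun w => u ((b x ∘ g) w)) z‖ₑ ^ 2 := by
      intro z hz
      have hzO : g z ∈ O := (hBO hz.2).1
      have hd : ∀ x ∈ S, DifferentiableAt ℝ (fun w => u ((b x ∘ g) w)) z := fun x hx => by
        have h2 := hb x hx _ hzO
        have h3 : SmoothAt 1 u ((b x ∘ g) z) := hu.smooth _ (hVb _ (by
          rw [Function.comp_apply, h2.2.1]; exact (hBO hz.2).2))
        exact (h3.comp_curve (HolAt.comp h2.1 (H.hol z hz.1))).differentiableAt (by simp)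
      have he : (fun w => HolomorphicDynamics.transfer F u (g w)) =ᶠ[𝓝 z]
          fun w => (topologicalDegree F : ℝ)⁻¹ * ∑ x ∈ S, u ((b x ∘ g) w) := by
        filter_upwards [(H.hol z hz.1).continuousAt.eventually (hO.mem_nhds hzO)] with w hw
        rw [HolomorphicDynamics.transfer, hpush _ hw]; rfl
      have hn : ‖fderiv ℝ (fun w => HolomorphicDynamics.transfer F u (g w)) z‖ ^ 2 ≤
          (topologicalDegree F : ℝ)⁻¹ * ∑ x ∈ S, ‖fderiv ℝ (fun w => u ((b x ∘ g) w)) z‖ ^ 2 := by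
        rw [he.fderiv_eq, fderiv_const_mul (DifferentiableAt.fun_sum fun x hx => hd x hx),
          fderiv_fun_sum fun x hx => hd x hx, norm_smul, mul_pow, norm_inv, Real.norm_natCast]
        -- Cauchy–Schwarz for a sum of λ terms costs a factor λ, against the λ^{-2} of the square of
        -- the mean; what remains is the gain λ^{-1}.
        calc ((topologicalDegree F : ℝ)⁻¹) ^ 2 * ‖∑ x ∈ S, fderiv ℝ (fun w => u ((b x ∘ g) w)) z‖ ^ 2
            ≤ ((topologicalDegree F : ℝ)⁻¹) ^ 2 *
              (S.card * ∑ x ∈ S, ‖fderiv ℝ (fun w => u ((b x ∘ g) w)) z‖ ^ 2) := by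
              refine mul_le_mul_of_nonneg_left ?_ (by positivity)
              refine le_trans ?_ sq_sum_le_card_mul_sum_sq
              exact pow_le_pow_left₀ (norm_nonneg _) (norm_sum_le _ _) 2
          _ = _ := by rw [hcard]; field_simp
      calc ‖fderiv ℝ (fun w => HolomorphicDynamics.transfer F u (g w)) z‖ₑ ^ 2
          = ENNReal.ofReal (‖fderiv ℝ (fun w => HolomorphicDynamics.transfer F u (g w)) z‖ ^ 2) := by
            rw [ENNReal.ofReal_pow (norm_nonneg _), ofReal_norm]
        _ ≤ _ := ENNReal.ofReal_le_ofReal hn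
        _ = _ := by
            rw [ENNReal.ofReal_mul (by positivity), ENNReal.ofReal_sum_of_nonneg fun _ _ => by positivity]
            simp only [ENNReal.ofReal_pow (norm_nonneg _), ofReal_norm]
    have hFm : Measurable F := hF.continuous.measurable
    calc ∫⁻ z in A, ‖fderiv ℝ (fun w => HolomorphicDynamics.transfer F u (g w)) z‖ₑ ^ 2
        ≤ ∫⁻ z in A, ENNReal.ofReal (topologicalDegree F : ℝ)⁻¹ *
          ∑ x ∈ S, ‖fderiv ℝ (fun w => u ((b x ∘ g) w)) z‖ₑ ^ 2 := setLIntegral_mono' hA hpt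
      _ = ENNReal.ofReal (topologicalDegree F : ℝ)⁻¹ *
          ∑ x ∈ S, ∫⁻ z in A, ‖fderiv ℝ (fun w => u ((b x ∘ g) w)) z‖ₑ ^ 2 := by
          rw [lintegral_const_mul' _ _ ENNReal.ofReal_ne_top, lintegral_finsetSum]
          exact fun x _ => ((measurable_fderiv ℝ _).enorm).pow_const 2
      -- Each branch composed with `g` is again a parametrization, so the bound for `u` applies to
      -- it; the branches have values in the disjoint sets `U x`, so the masses add up to at most
      -- the mass of `F ⁻¹' B`.
      _ ≤ ENNReal.ofReal (topologicalDegree F : ℝ)⁻¹ * ∑ x ∈ S, μ (F ⁻¹' B ∩ U x) := by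
          refine mul_le_mul_right (Finset.sum_le_sum fun x hx => ?_) _
          refine le_trans (lintegral_mono_set ?_)
            (hu.energy _ _ (hp x hx) _ ((hFm hB).inter (hU x hx).measurableSet))
          intro z hz
          have h2 := hb x hx (g z) (hBO hz.2).1
          refine ⟨⟨hz.1, (hBO hz.2).1⟩, ?_, h2.2.2⟩
          simp only [mem_preimage, Function.comp]
          rw [h2.2.1]; exact hz.2
      _ = ENNReal.ofReal (topologicalDegree F : ℝ)⁻¹ * μ (⋃ x ∈ S, F ⁻¹' B ∩ U x) := by
          rw [measure_biUnion_finset]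
          · exact fun x hx x' hx' hne => (hUd hx hx' hne).mono inter_subset_right inter_subset_right
          · exact fun x hx => (hFm hB).inter (hU x hx).measurableSet
      _ ≤ _ := by
          rw [Measure.smul_apply, smul_eq_mul, Measure.map_apply hFm hB]
          exact mul_le_mul_right (measure_mono (iUnion₂_subset fun x _ => inter_subset_left)) _

/-- Pushing a measure forward keeps its total mass, so each step only gains the factor λ^{-1}. -/
theorem exists_energyLE_iterate {F : X → X} (hF : IsHolEndo F) (h0 : topologicalDegree F ≠ 0)
    {φ : X → ℝ} (hφ : SmoothFn φ) :
    ∃ M : ℝ, 0 ≤ M ∧ ∀ k : ℕ, ∃ μ V, EnergyLE ((transfer F)^[k] φ) μ V ∧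
      μ univ ≤ ENNReal.ofReal (M * ((topologicalDegree F : ℝ)⁻¹) ^ k) := by
  obtain ⟨μ₀, hμ₀, h⟩ := exists_energyLE hφ
  refine ⟨(μ₀ univ).toReal, ENNReal.toReal_nonneg, fun k => ?_⟩
  induction k with
  | zero =>
    refine ⟨μ₀, ∅, h, ?_⟩
    rw [pow_zero, mul_one, ENNReal.ofReal_toReal (measure_ne_top _ _)]
  | succ k ih =>
    obtain ⟨μ, V, h1, h2⟩ := ih
    refine ⟨_, _, by rw [Function.iterate_succ_apply']; exact h1.transfer hF h0, ?_⟩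
    rw [Measure.smul_apply, smul_eq_mul, Measure.map_apply hF.continuous.measurable MeasurableSet.univ,
      preimage_univ]
    calc _ ≤ ENNReal.ofReal (topologicalDegree F : ℝ)⁻¹ *
          ENNReal.ofReal ((μ₀ univ).toReal * ((topologicalDegree F : ℝ)⁻¹) ^ k) := mul_le_mul_right h2 _
      _ = _ := by
        rw [← ENNReal.ofReal_mul (by positivity)]; congr 1; ring

end Energy

/-! ### The length-area inequality on a strip -/

section Rectangle

lemma sq_setLIntegral_le {α : Type*} [MeasurableSpace α] {μ : Measure α} {s : Set α} {f : α → ℝ≥0∞}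
    (hf : Measurable f) : (∫⁻ x in s, f x ∂μ) ^ 2 ≤ μ s * ∫⁻ x in s, f x ^ 2 ∂μ := by
  have h := ENNReal.lintegral_mul_le_Lp_mul_Lq (μ.restrict s) Real.HolderConjugate.two_two
    (f := fun _ => 1) (g := f) aemeasurable_const hf.aemeasurable
  simp only [Pi.mul_apply, one_mul, ENNReal.one_rpow, lintegral_const, Measure.restrict_apply_univ]
    at h
  calc (∫⁻ x in s, f x ∂μ) ^ 2
      ≤ (μ s ^ (1 / (2 : ℝ)) * (∫⁻ x in s, f x ^ (2 : ℝ) ∂μ) ^ (1 / (2 : ℝ))) ^ 2 :=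
        pow_le_pow_left' h 2
    _ = μ s * ∫⁻ x in s, f x ^ 2 ∂μ := by
        rw [mul_pow, ← ENNReal.rpow_natCast, ← ENNReal.rpow_natCast, ← ENNReal.rpow_mul,
          ← ENNReal.rpow_mul]
        norm_num

lemma lintegral_reProdIm {G : ℂ → ℝ≥0∞} (hG : Measurable G) {s t : Set ℝ} (hs : MeasurableSet s)
    (ht : MeasurableSet t) :
    ∫⁻ z in s ×ℂ t, G z = ∫⁻ y in t, ∫⁻ x in s, G (x + y * Complex.I) := by
  have hm : Measurable fun p : ℝ × ℝ => G (p.1 + p.2 * Complex.I) := by fun_prop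
  have h := Complex.volume_preserving_equiv_real_prod.setLIntegral_comp_preimage (hs.prod ht) hm
  have h1 : ∀ z : ℂ, G ((Complex.measurableEquivRealProd z).1 +
      (Complex.measurableEquivRealProd z).2 * Complex.I) = G z := fun z =>
    congrArg G (Complex.re_add_im z)
  simp only [h1] at h
  change ∫⁻ z in s ×ℂ t, G z = _ at h
  rw [h, Measure.volume_eq_prod, ← Measure.prod_restrict, lintegral_prod_symm' _ hm]

lemma volume_reProdIm {s t : Set ℝ} (hs : MeasurableSet s) (ht : MeasurableSet t) :
    volume (s ×ℂ t) = volume s * volume t := by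
  have h := Complex.volume_preserving_equiv_real_prod.measure_preimage
    (hs.prod ht).nullMeasurableSet
  change volume (s ×ℂ t) = _ at h
  rw [h, Measure.volume_eq_prod, Measure.prod_prod]

/-- The difference of the values at the end points of a horizontal segment. -/
lemma enorm_sub_le_lintegral_fderiv {v : ℂ → ℝ} {x y : ℝ} (hx : 0 ≤ x)
    (hv : ∀ t : ℝ, ContDiffAt ℝ 1 v (t + y * Complex.I)) :
    ‖v (x + y * Complex.I) - v ((-x : ℝ) + y * Complex.I)‖ₑ ≤
      ∫⁻ t in Ioc (-x) x, ‖fderiv ℝ v (t + y * Complex.I)‖ₑ := by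
  have hline : ∀ t : ℝ, HasDerivAt (fun t : ℝ => (t + y * Complex.I : ℂ)) 1 t := fun t =>
    (Complex.ofRealCLM.hasDerivAt (x := t)).add_const _ 
  have hd : ∀ t : ℝ, HasDerivAt (fun t : ℝ => v (t + y * Complex.I))
      (fderiv ℝ v (t + y * Complex.I) 1) t := fun t =>
    ((hv t).differentiableAt (by simp)).hasFDerivAt.comp_hasDerivAt t (hline t)
  have hcont : Continuous fun t : ℝ => fderiv ℝ v (t + y * Complex.I) := by
    refine continuous_iff_continuousAt.2 fun t => ?_
    exact ContinuousAt.comp (f := fun t : ℝ => (t + y * Complex.I : ℂ)) (g := fderiv ℝ v)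
      ((hv t).fderiv_right (m := 0) (by norm_num)).continuousAt (hline t).continuousAt
  have hint : IntervalIntegrable (fun t : ℝ => fderiv ℝ v (t + y * Complex.I) 1) volume (-x) x :=
    (hcont.clm_apply continuous_const).intervalIntegrable _ _
  rw [← intervalIntegral.integral_eq_sub_of_hasDerivAt (fun t _ => hd t) hint,
    intervalIntegral.integral_of_le (by linarith)]
  refine (enorm_integral_le_lintegral_enorm _).trans (lintegral_mono fun t => ?_)
  rw [← ofReal_norm, ← ofReal_norm]
  refine ENNReal.ofReal_le_ofReal ?_
  simpa using (fderiv ℝ v (t + y * Complex.I)).le_opNorm 1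

/-- A function on the strip `π / 2 < Im z < 3 π / 2` whose energy is at most `M` cannot differ much
on the opposite sides of a long rectangle. -/
theorem sq_le_of_energy_strip {v : ℂ → ℝ} {Z : Set ℂ} (hZ : Z.Finite)
    (hv : ∀ z, z.im ∈ Ioo (Real.pi / 2) (3 * Real.pi / 2) → z ∉ Z → ContDiffAt ℝ 1 v z)
    {M : ℝ} (hM0 : 0 ≤ M)
    (hM : ∫⁻ z in univ ×ℂ Ioo (Real.pi / 2) (3 * Real.pi / 2), ‖fderiv ℝ v z‖ₑ ^ 2 ≤ ENNReal.ofReal M)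
    {D x : ℝ} (hD0 : 0 ≤ D) (hx : 0 ≤ x)
    (hD : ∀ y ∈ Ioo (Real.pi / 2) (3 * Real.pi / 2),
      D ≤ |v (x + y * Complex.I) - v ((-x : ℝ) + y * Complex.I)|) :
    (Real.pi * D) ^ 2 ≤ 2 * Real.pi * x * M := by
  set J := Ioo (Real.pi / 2) (3 * Real.pi / 2)
  have hpi := Real.pi_pos
  have hJ : volume J = ENNReal.ofReal Real.pi := by
    rw [Real.volume_Ioo]; congr 1; ring
  have hGm : Measurable fun z => ‖fderiv ℝ v z‖ₑ := (measurable_fderiv ℝ v).enorm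
  have h1 : ENNReal.ofReal (Real.pi * D) ≤ ∫⁻ z in Ioc (-x) x ×ℂ J, ‖fderiv ℝ v z‖ₑ := by
    rw [lintegral_reProdIm hGm measurableSet_Ioc measurableSet_Ioo, mul_comm,
      ENNReal.ofReal_mul hD0, ← hJ, ← setLIntegral_const]
    -- Only finitely many horizontal lines meet the exceptional points; on all the others the
    -- function is of class C^1.
    have hae : ∀ᵐ y ∂(volume.restrict J), y ∈ J ∧ y ∉ Complex.im '' Z :=
      (ae_restrict_mem measurableSet_Ioo).and
        (ae_restrict_of_ae ((hZ.image _).countable.ae_notMem _))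
    refine lintegral_mono_ae (hae.mono fun y hy => ?_)
    refine le_trans ?_ (enorm_sub_le_lintegral_fderiv hx fun t => hv _ (by simpa using hy.1) ?_)
    · rw [← ofReal_norm, Real.norm_eq_abs]
      exact ENNReal.ofReal_le_ofReal (hD y hy.1)
    · exact fun hz => hy.2 ⟨_, hz, by simp⟩
  have h2 : ENNReal.ofReal ((Real.pi * D) ^ 2) ≤ ENNReal.ofReal (2 * Real.pi * x * M) :=
    calc ENNReal.ofReal ((Real.pi * D) ^ 2) = ENNReal.ofReal (Real.pi * D) ^ 2 :=
          ENNReal.ofReal_pow (by positivity) 2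
      _ ≤ (∫⁻ z in Ioc (-x) x ×ℂ J, ‖fderiv ℝ v z‖ₑ) ^ 2 := pow_le_pow_left' h1 2
      _ ≤ volume (Ioc (-x) x ×ℂ J) * ∫⁻ z in Ioc (-x) x ×ℂ J, ‖fderiv ℝ v z‖ₑ ^ 2 :=
          sq_setLIntegral_le hGm
      _ ≤ ENNReal.ofReal (2 * Real.pi * x) * ENNReal.ofReal M := by
          refine mul_le_mul' (le_of_eq ?_) ((lintegral_mono_set ?_).trans hM)
          · rw [volume_reProdIm measurableSet_Ioc measurableSet_Ioo, hJ, Real.volume_Ioc,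
              ← ENNReal.ofReal_mul (by linarith)]
            congr 1; ring
          · exact fun z hz => ⟨trivial, hz.2⟩
      _ = _ := (ENNReal.ofReal_mul (by positivity)).symm
  exact (ENNReal.ofReal_le_ofReal_iff (by positivity)).1 h2

end Rectangle

/-! ### Bipolar coordinates -/

section Bipolar

/-- Bipolar coordinates with poles `α` and `β`. -/
noncomputable def bipolar (α β ζ : ℂ) : ℂ := (α - β * Complex.exp ζ) / (1 - Complex.exp ζ)

/-- The strip is the one where the cosine of the imaginary part is negative; there `1 - exp ζ` stays
away from 0 and `bipolar` has no pole. -/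
lemma exp_re_neg {ζ : ℂ} (hζ : ζ.im ∈ Ioo (Real.pi / 2) (3 * Real.pi / 2)) :
    (Complex.exp ζ).re < 0 := by
  rw [Complex.exp_re]
  have : Real.cos ζ.im < 0 := Real.cos_neg_of_pi_div_two_lt_of_lt hζ.1 (by linarith [hζ.2])
  exact mul_neg_of_pos_of_neg (Real.exp_pos _) this

lemma one_le_norm_one_sub_exp {ζ : ℂ} (hζ : ζ.im ∈ Ioo (Real.pi / 2) (3 * Real.pi / 2)) :
    1 ≤ ‖1 - Complex.exp ζ‖ := by
  have h := Complex.re_le_norm (1 - Complex.exp ζ)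
  rw [Complex.sub_re, Complex.one_re] at h
  linarith [exp_re_neg hζ]

lemma norm_exp_le_norm_one_sub_exp {ζ : ℂ} (hζ : ζ.im ∈ Ioo (Real.pi / 2) (3 * Real.pi / 2)) :
    ‖Complex.exp ζ‖ ≤ ‖1 - Complex.exp ζ‖ := by
  have h := exp_re_neg hζ
  rw [← sq_le_sq₀ (norm_nonneg _) (norm_nonneg _), ← Complex.normSq_eq_norm_sq,
    ← Complex.normSq_eq_norm_sq, Complex.normSq_apply, Complex.normSq_apply]
  simp only [Complex.sub_re, Complex.one_re, Complex.sub_im, Complex.one_im]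
  nlinarith

lemma one_sub_exp_ne_zero {ζ : ℂ} (hζ : ζ.im ∈ Ioo (Real.pi / 2) (3 * Real.pi / 2)) :
    1 - Complex.exp ζ ≠ 0 :=
  norm_pos_iff.1 (zero_lt_one.trans_le (one_le_norm_one_sub_exp hζ))

/-- The difference equals e^ζ(α - β)/(1 - e^ζ). The first bound shows that the far left of the strip
goes to α; the second keeps the whole image inside a fixed chart ball. -/
lemma norm_bipolar_sub_left {α β ζ : ℂ} (hζ : ζ.im ∈ Ioo (Real.pi / 2) (3 * Real.pi / 2)) :
    ‖bipolar α β ζ - α‖ ≤ Real.exp ζ.re * ‖α - β‖ ∧ ‖bipolar α β ζ - α‖ ≤ ‖α - β‖ := by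
  have h0 := one_sub_exp_ne_zero hζ
  have h1 : bipolar α β ζ - α = Complex.exp ζ * (α - β) / (1 - Complex.exp ζ) := by
    rw [bipolar]; field_simp; ring
  have h2 := norm_pos_iff.2 h0
  rw [h1, norm_div, norm_mul]
  refine ⟨(div_le_self (by positivity) (one_le_norm_one_sub_exp hζ)).trans
    (by rw [Complex.norm_exp]), (div_le_iff₀ h2).2 ?_⟩
  rw [mul_comm]
  exact mul_le_mul_of_nonneg_left (norm_exp_le_norm_one_sub_exp hζ) (norm_nonneg _)

lemma norm_bipolar_sub_right {α β ζ : ℂ} (hζ : ζ.im ∈ Ioo (Real.pi / 2) (3 * Real.pi / 2)) :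
    ‖bipolar α β ζ - β‖ ≤ Real.exp (-ζ.re) * ‖α - β‖ := by
  have h0 := one_sub_exp_ne_zero hζ
  have h1 : bipolar α β ζ - β = (α - β) / (1 - Complex.exp ζ) := by
    rw [bipolar]; field_simp; ring
  have h2 := norm_pos_iff.2 h0
  rw [h1, norm_div, div_le_iff₀ h2]
  have h3 := norm_exp_le_norm_one_sub_exp hζ
  rw [Complex.norm_exp] at h3
  have h4 : (1 : ℝ) ≤ Real.exp (-ζ.re) * ‖1 - Complex.exp ζ‖ := by
    rw [Real.exp_neg, ← div_eq_inv_mul, le_div_iff₀ (Real.exp_pos _), one_mul]; exact h3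
  nlinarith [norm_nonneg (α - β)]

lemma analyticAt_bipolar {α β ζ : ℂ} (hζ : ζ.im ∈ Ioo (Real.pi / 2) (3 * Real.pi / 2)) :
    AnalyticAt ℂ (bipolar α β) ζ := by
  have h := one_sub_exp_ne_zero hζ
  unfold bipolar
  fun_prop (disch := exact h)

/-- A Möbius map is injective, and the strip has height π, less than the period 2π of the
exponential. -/
lemma injOn_bipolar {α β : ℂ} (h : α ≠ β) :
    InjOn (bipolar α β) (univ ×ℂ Ioo (Real.pi / 2) (3 * Real.pi / 2)) := by
  rintro z ⟨-, hz⟩ w ⟨-, hw⟩ hzw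
  have h1 := one_sub_exp_ne_zero hz
  have h2 := one_sub_exp_ne_zero hw
  rw [bipolar, bipolar, div_eq_div_iff h1 h2] at hzw
  have h3 : (α - β) * (Complex.exp z - Complex.exp w) = 0 := by linear_combination hzw
  have h4 : Complex.exp z = Complex.exp w :=
    sub_eq_zero.1 ((mul_eq_zero.1 h3).resolve_left (sub_ne_zero.2 h))
  obtain ⟨n, hn⟩ := Complex.exp_eq_exp_iff_exists_int.1 h4
  have h5 : z.im = w.im + n * (2 * Real.pi) := by simpa using congrArg Complex.im hn
  have hpi := Real.pi_pos
  simp only [mem_preimage, mem_Ioo] at hz hw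
  have h6 : n = 0 := by
    by_contra hne
    rcases lt_or_gt_of_ne hne with h | h
    · have : (n : ℝ) ≤ -1 := by exact_mod_cast Int.le_sub_one_of_lt h
      nlinarith
    · have : (1 : ℝ) ≤ n := by exact_mod_cast h
      nlinarith
  rw [hn, h6]; simp

end Bipolar

/-! ### Energy against modulus of continuity: the oscillation tends to zero locally -/

section Oscillation

variable {X : Type*} [TopologicalSpace X] [ChartedSpace ℂ X] [IsManifold 𝓘(ℂ) ω X]
  [MeasurableSpace X] [BorelSpace X] [CompactSpace X] [T2Space X] [ConnectedSpace X]

/-- Bipolar coordinates read in a chart ball of the surface. -/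
lemma isParam_bipolar {x₀ : X} {r : ℝ}
    (hr : closedBall (chartAt ℂ x₀ x₀) (3 * r) ⊆ (chartAt ℂ x₀).target) {α β : ℂ}
    (hα : α ∈ ball (chartAt ℂ x₀ x₀) r) (hβ : β ∈ ball (chartAt ℂ x₀ x₀) r) (hαβ : α ≠ β) :
    (∀ z ∈ univ ×ℂ Ioo (Real.pi / 2) (3 * Real.pi / 2),
      bipolar α β z ∈ closedBall (chartAt ℂ x₀ x₀) (3 * r)) ∧
    IsParam (fun z => (chartAt ℂ x₀).symm (bipolar α β z))
      (univ ×ℂ Ioo (Real.pi / 2) (3 * Real.pi / 2)) := by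
  have h1 : ∀ z ∈ univ ×ℂ Ioo (Real.pi / 2) (3 * Real.pi / 2),
      bipolar α β z ∈ closedBall (chartAt ℂ x₀ x₀) (3 * r) := by
    rintro z ⟨-, hz⟩
    have h2 := (norm_bipolar_sub_left (α := α) (β := β) hz).2
    rw [← dist_eq_norm, ← dist_eq_norm] at h2
    have h3 := dist_triangle (bipolar α β z) α (chartAt ℂ x₀ x₀)
    have h4 := dist_triangle_right α β (chartAt ℂ x₀ x₀)
    rw [mem_closedBall]
    linarith [mem_ball.1 hα, mem_ball.1 hβ]
  refine ⟨h1, isOpen_univ.reProdIm isOpen_Ioo, fun z hz => ?_, fun z hz w hw hzw => ?_⟩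
  · exact HolAt.comp (g := (chartAt ℂ x₀).symm) (f := bipolar α β) (holAt_chartAt_symm (hr (h1 z hz)))
      (holAt_iff_analyticAt.2 (analyticAt_bipolar hz.2))
  · exact injOn_bipolar hαβ hz hw ((chartAt ℂ x₀).symm.injOn (hr (h1 z hz)) (hr (h1 w hw)) hzw)

/-- The oscillation of `T^k φ` between two nearby points which stay in a backward invariant
compact set, where the local degree is at most `δ < Λ`, tends to zero. -/
theorem exists_nhds_tendsto_transfer_sub (x₀ : X) : ∃ N : Set X, IsOpen N ∧ x₀ ∈ N ∧
    ∀ (F : X → X), IsHolEndo F → ∀ δ : ℕ, 2 ≤ δ → δ < topologicalDegree F →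
    ∀ K : Set X, IsClosed K → (∀ x, F x ∈ K → localDegree F x ≤ δ) → (∀ x, F x ∈ K → x ∈ K) →
    ∀ φ : X → ℝ, SmoothFn φ → ∀ a ∈ N ∩ interior K, ∀ b ∈ N ∩ interior K,
    Tendsto (fun k => (transfer F)^[k] φ a - (transfer F)^[k] φ b) atTop (𝓝 0) := by
  obtain ⟨d, hd⟩ := exists_chartDist X
  set e := chartAt ℂ x₀
  obtain ⟨C, hC0, O, hO, hC⟩ := hd.upper e.symm (e x₀) (holAt_chartAt_symm (mem_chart_target ℂ x₀))
  obtain ⟨R, hR, hRO⟩ := Metric.nhds_basis_closedBall.mem_iff.1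
    (Filter.inter_mem hO (e.open_target.mem_nhds (mem_chart_target ℂ x₀)))
  -- Bipolar images with poles in a ball of radius r stay in the concentric ball of radius 3r.
  set r := R / 3
  have hr : 0 < r := by positivity
  have h3r : 3 * r = R := by simp only [r]; ring
  refine ⟨e.source ∩ e ⁻¹' ball (e x₀) r, e.isOpen_inter_preimage isOpen_ball,
    ⟨mem_chart_source ℂ x₀, mem_ball_self hr⟩, ?_⟩
  rintro F hF δ hδ2 hδ K hK hKδ hKinv φ hφ a ⟨⟨has, haN⟩, haK⟩ b ⟨⟨hbs, hbN⟩, hbK⟩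
  by_cases hab : a = b
  · simp [hab]
  have h0 : topologicalDegree F ≠ 0 := by omega
  set α := e a
  set β := e b
  have hαβ : α ≠ β := fun h => hab (e.injOn has hbs h)
  set S : Set ℂ := univ ×ℂ Ioo (Real.pi / 2) (3 * Real.pi / 2)
  obtain ⟨hgb, hg⟩ := isParam_bipolar (x₀ := x₀) (r := r) (by
    rw [h3r]; exact fun z hz => (hRO hz).2) haN hbN hαβ
  rw [h3r] at hgb
  set g : ℂ → X := fun z => e.symm (bipolar α β z)
  obtain ⟨M, hM0, hM⟩ := exists_energyLE_iterate hF h0 hφ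
  have hint : ∀ c ∈ interior K, c ∈ e.source → ∀ᶠ z in 𝓝 (e c), e.symm z ∈ K := by
    intro c hc hcs
    refine (e.tendsto_symm hcs).eventually ?_
    exact mem_interior_iff_mem_nhds.1 hc
  obtain ⟨ε, hε, hεab⟩ : ∃ ε > 0, ∀ z, (‖z - α‖ < ε ∨ ‖z - β‖ < ε) → e.symm z ∈ K := by
    obtain ⟨ε₁, h1, h1'⟩ := Metric.eventually_nhds_iff.1 (hint a haK has)
    obtain ⟨ε₂, h2, h2'⟩ := Metric.eventually_nhds_iff.1 (hint b hbK hbs)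
    refine ⟨min ε₁ ε₂, lt_min h1 h2, fun z hz => ?_⟩
    rcases hz with hz | hz
    · exact h1' (by rw [dist_eq_norm]; exact hz.trans_le (min_le_left _ _))
    · exact h2' (by rw [dist_eq_norm]; exact hz.trans_le (min_le_right _ _))
  -- The extra half-length `X₁` does not depend on k. It keeps the short sides of the rectangle
  -- inside `K` and absorbs the Lipschitz constant `C`.
  obtain ⟨X₁, hX₁0, hX₁ε, hX₁C⟩ : ∃ X₁ : ℝ, 0 ≤ X₁ ∧ Real.exp (-X₁) * ‖α - β‖ < ε ∧
      C * (Real.exp (-X₁) * ‖α - β‖) ≤ 1 := by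
    have h1 : Tendsto (fun t : ℝ => Real.exp (-t) * ‖α - β‖) atTop (𝓝 (0 * ‖α - β‖)) :=
      (Real.tendsto_exp_neg_atTop_nhds_zero).mul_const _
    have h2 := h1.const_mul C
    rw [zero_mul] at h1 h2
    rw [mul_zero] at h2
    obtain ⟨t, ht1, ht2, ht3⟩ := ((eventually_ge_atTop (0 : ℝ)).and
      ((h1.eventually_lt_const hε).and (h2.eventually_le_const one_pos))).exists
    exact ⟨t, ht1, ht2, ht3⟩
  rw [Metric.tendsto_atTop']
  intro η' hη'
  set η := η' / 3
  have hη : 0 < η := by positivity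
  obtain ⟨B, hB⟩ := exists_modulus hF h0 hd hδ2 hK hKδ hKinv hφ.continuous hη
  have hlam : (0 : ℝ) < topologicalDegree F := by exact_mod_cast Nat.pos_of_ne_zero h0
  -- the main estimate
  have key : ∀ k : ℕ, η ≤ |(transfer F)^[k] φ a - (transfer F)^[k] φ b| - 2 * η →
      (Real.pi * η) ^ 2 ≤ 2 * Real.pi * (|B| * δ ^ k + X₁) *
        (M * ((topologicalDegree F : ℝ)⁻¹) ^ k) := by
    intro k hk
    set u := (transfer F)^[k] φ
    obtain ⟨μ, V, hE, hμ⟩ := hM k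
    have hx0 : 0 ≤ |B| * (δ : ℝ) ^ k + X₁ := by positivity
    -- Bipolar coordinates turn half-length x into distance e^{-x} from the poles, so this length
    -- reaches the scale exp(-B δ^k) of the modulus of continuity.
    set x := |B| * (δ : ℝ) ^ k + X₁
    have hex : Real.exp (-x) ≤ Real.exp (-X₁) := by
      refine Real.exp_le_exp.2 (neg_le_neg ?_)
      simp only [x]; linarith [show 0 ≤ |B| * (δ : ℝ) ^ k by positivity]
    have hex2 : C * (Real.exp (-x) * ‖α - β‖) ≤ Real.exp (-B * δ ^ k) := by
      have : Real.exp (-x) = Real.exp (-(|B| * δ ^ k)) * Real.exp (-X₁) := by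
        rw [← Real.exp_add]; congr 1; simp only [x]; ring
      rw [this]
      calc C * (Real.exp (-(|B| * δ ^ k)) * Real.exp (-X₁) * ‖α - β‖)
          = Real.exp (-(|B| * δ ^ k)) * (C * (Real.exp (-X₁) * ‖α - β‖)) := by ring
        _ ≤ Real.exp (-(|B| * δ ^ k)) * 1 := mul_le_mul_of_nonneg_left hX₁C (Real.exp_pos _).le
        _ ≤ Real.exp (-B * δ ^ k) := by
          rw [mul_one, Real.exp_le_exp, neg_mul]
          exact neg_le_neg (mul_le_mul_of_nonneg_right (le_abs_self B) (by positivity))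
    -- values near the poles
    have hnear : ∀ c ∈ interior K, c ∈ e.source → e c ∈ ball (e x₀) r →
        ∀ z ∈ closedBall (e x₀) R, ‖z - e c‖ ≤ Real.exp (-x) * ‖α - β‖ →
        (‖z - α‖ < ε ∨ ‖z - β‖ < ε) → |u (e.symm z) - u c| ≤ η := by
      intro c hcK hcs hcN z hzR hz hzε
      refine hB k _ (hεab z hzε) _ (interior_subset hcK) ?_
      have h1 := hC z (hRO hzR).1 (e c) (hRO (ball_subset_closedBall
        (ball_subset_ball (by linarith) hcN))).1
      rw [e.left_inv hcs] at h1
      exact h1.trans ((mul_le_mul_of_nonneg_left hz hC0).trans hex2)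
    refine sq_le_of_energy_strip (v := fun z => u (g z)) (Z := S ∩ g ⁻¹' V)
      (hg.finite_inter_preimage hE.finite) (fun z hz hzV => ?_) (by positivity) ?_ hη.le hx0 ?_
    · have hzS : z ∈ S := ⟨trivial, hz⟩
      exact (hE.smooth (g z) fun h => hzV ⟨hzS, h⟩).comp_curve (hg.hol z hzS)
    · have := hE.energy g S hg univ MeasurableSet.univ
      rw [preimage_univ, inter_univ] at this
      exact this.trans hμ
    · intro y hy
      have hi1 : ((x : ℂ) + y * Complex.I).im ∈ Ioo (Real.pi / 2) (3 * Real.pi / 2) := by simpa using hy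
      have hi2 : (((-x : ℝ) : ℂ) + y * Complex.I).im ∈ Ioo (Real.pi / 2) (3 * Real.pi / 2) := by
        simpa using hy
      have hr1 : ((x : ℂ) + y * Complex.I).re = x := by simp
      have hr2 : (((-x : ℝ) : ℂ) + y * Complex.I).re = -x := by simp
      -- The right side of the rectangle lands near `b` and the left side near `a`; each replacement
      -- of a value by that at the pole costs `η`.
      have hβ' := norm_bipolar_sub_right (α := α) (β := β) hi1
      have hα' := (norm_bipolar_sub_left (α := α) (β := β) hi2).1
      rw [hr1] at hβ'
      rw [hr2] at hα'
      have hlt : Real.exp (-x) * ‖α - β‖ < ε :=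
        (mul_le_mul_of_nonneg_right hex (norm_nonneg _)).trans_lt hX₁ε
      have h1 := hnear b hbK hbs hbN _ (hgb _ ⟨trivial, hi1⟩) hβ' (Or.inr (hβ'.trans_lt hlt))
      have h2 := hnear a haK has haN _ (hgb _ ⟨trivial, hi2⟩) hα' (Or.inl (hα'.trans_lt hlt))
      simp only [g]
      rw [abs_le] at h1 h2
      rcases abs_cases (u a - u b) with h3 | h3 <;> rw [h3.1] at hk
      · rw [abs_sub_comm]
        exact le_trans (by linarith) (le_abs_self _)
      · exact le_trans (by linarith) (le_abs_self _)
  -- The length grows like δ^k and the energy decays like λ^{-k}: this is where δ < λ is decisive.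
  have hlim : Tendsto (fun k : ℕ => 2 * Real.pi * (|B| * (δ : ℝ) ^ k + X₁) *
      (M * ((topologicalDegree F : ℝ)⁻¹) ^ k)) atTop (𝓝 0) := by
    have h1 : Tendsto (fun k : ℕ => ((δ : ℝ) * (topologicalDegree F : ℝ)⁻¹) ^ k) atTop (𝓝 0) := by
      refine tendsto_pow_atTop_nhds_zero_of_lt_one (by positivity) ?_
      rw [← div_eq_mul_inv, div_lt_one hlam]; exact_mod_cast hδ
    have h2 : Tendsto (fun k : ℕ => ((topologicalDegree F : ℝ)⁻¹) ^ k) atTop (𝓝 0) := by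
      refine tendsto_pow_atTop_nhds_zero_of_lt_one (by positivity) (inv_lt_one_of_one_lt₀ ?_)
      exact_mod_cast (by omega : 1 < topologicalDegree F)
    have h3 := (h1.const_mul (2 * Real.pi * |B| * M)).add (h2.const_mul (2 * Real.pi * X₁ * M))
    rw [mul_zero, mul_zero, add_zero] at h3
    refine h3.congr fun k => ?_
    rw [mul_pow]; ring
  obtain ⟨n, hn⟩ := eventually_atTop.1 (hlim.eventually_lt_const
    (show 0 < (Real.pi * η) ^ 2 by positivity))
  refine ⟨n, fun k hk => ?_⟩
  rw [Real.dist_0_eq_abs]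
  by_contra hcon
  exact absurd (key k (by simp only [η] at hcon ⊢; linarith)) (not_le.2 (hn k hk.le))

end Oscillation

/-! ### Totally ramified points and the exceptional set -/

section Exceptional

variable {X : Type*} [TopologicalSpace X] [ChartedSpace ℂ X] [IsManifold 𝓘(ℂ) ω X]
  [CompactSpace X] [T2Space X] [ConnectedSpace X]

/-- The set of totally ramified points. -/
def totallyRamified (f : X → X) : Set X := {x | localDegree f x = topologicalDegree f}

lemma sum_localDegree {f : X → X} (hf : IsHolEndo f) (y : X) :
    ∑ z ∈ (finite_fiber hf y).toFinset, localDegree f z = topologicalDegree f := by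
  have h := push_one hf y
  rw [push_eq_sum hf] at h
  simp only [mul_one] at h
  exact_mod_cast h

lemma localDegree_le {f : X → X} (hf : IsHolEndo f) (x : X) :
    localDegree f x ≤ topologicalDegree f := by
  rw [← sum_localDegree hf (f x)]
  exact Finset.single_le_sum (f := localDegree f) (fun _ _ => Nat.zero_le _) (by simp)

/-- A totally ramified point exhausts the multiplicity λ of its fibre. -/
lemma eq_of_totallyRamified {f : X → X} (hf : IsHolEndo f) {x z : X} (hx : x ∈ totallyRamified f)
    (hz : f z = f x) : z = x := by
  classical
  by_contra hne
  have h1 := sum_localDegree hf (f x)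
  have h2 : localDegree f z + localDegree f x ≤ topologicalDegree f := by
    rw [← h1, ← Finset.sum_pair hne]
    refine Finset.sum_le_sum_of_subset ?_
    intro w hw
    rcases Finset.mem_insert.1 hw with rfl | hw
    · simpa using hz
    · rw [Finset.mem_singleton.1 hw]; simp
  have h3 := localDegree_ne_zero hf.hol hf.nc z
  have h4 : localDegree f x = topologicalDegree f := hx
  omega

lemma exceptionalSet_subset (f : X → X) : exceptionalSet f ⊆ totallyRamified f := fun _ hx => hx.1

/-- Otherwise x, f x and f (f x) would be three distinct totally ramified points. -/
lemma iterate_two_of_mem_exceptionalSet {f : X → X} (hf : IsHolEndo f)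
    (hT : (totallyRamified f).encard ≤ 2) {x : X} (hx : x ∈ exceptionalSet f) : f (f x) = x := by
  obtain ⟨h1, h2, h3⟩ := hx
  by_contra hne
  have hx1 : f x ≠ x := fun h => hne (by rw [h, h])
  have hx2 : f (f x) ≠ f x := fun h => hx1 (eq_of_totallyRamified hf h1 h)
  have h4 : ({x, f x, f (f x)} : Set X).encard = 3 :=
    encard_eq_three.2 ⟨x, f x, f (f x), hx1.symm, Ne.symm hne, hx2.symm, rfl⟩
  have h5 : ({x, f x, f (f x)} : Set X).encard ≤ 2 := (encard_le_encard (by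
    rintro y (rfl | rfl | rfl) <;> assumption)).trans hT
  rw [h4] at h5
  exact absurd h5 (by decide)

/-- Forward invariance comes from period two. For the converse, f (f x) is a totally ramified
preimage of f x, hence the only one, so it is x itself. -/
lemma map_mem_exceptionalSet_iff {f : X → X} (hf : IsHolEndo f)
    (hT : (totallyRamified f).encard ≤ 2) {x : X} : f x ∈ exceptionalSet f ↔ x ∈ exceptionalSet f := by
  have hmap : ∀ y ∈ exceptionalSet f, f y ∈ exceptionalSet f := fun y hy => by
    refine ⟨hy.2.1, hy.2.2, ?_⟩
    rw [iterate_two_of_mem_exceptionalSet hf hT hy]; exact hy.2.1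
  refine ⟨fun h => ?_, hmap x⟩
  have h1 := hmap _ h
  have h2 := iterate_two_of_mem_exceptionalSet hf hT h
  rw [eq_of_totallyRamified hf h1.1 h2.symm]
  exact h1

lemma iterate_mem_exceptionalSet_iff {f : X → X} (hf : IsHolEndo f)
    (hT : (totallyRamified f).encard ≤ 2) (n : ℕ) {x : X} :
    f^[n] x ∈ exceptionalSet f ↔ x ∈ exceptionalSet f := by
  induction n with
  | zero => rfl
  | succ n ih => rw [Function.iterate_succ_apply', map_mem_exceptionalSet_iff hf hT, ih]

lemma finite_exceptionalSet {f : X → X} (hT : (totallyRamified f).encard ≤ 2) :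
    (exceptionalSet f).Finite :=
  (finite_of_encard_le_coe (k := 2) hT).subset (exceptionalSet_subset f)

/-- Near a ramified point, a holomorphic map contracts. -/
lemma eventually_norm_chart_sub_le {f : X → X} (hf : IsHolEndo f) {p : X} (hp : 2 ≤ localDegree f p) :
    ∀ᶠ z in 𝓝 (chartAt ℂ p p), f ((chartAt ℂ p).symm z) ∈ (chartAt ℂ (f p)).source ∧
      ‖chartAt ℂ (f p) (f ((chartAt ℂ p).symm z)) - chartAt ℂ (f p) (f p)‖ ≤ ‖z - chartAt ℂ p p‖ := by
  have e1 : (chartAt ℂ p).symm (chartAt ℂ p p) = p := (chartAt ℂ p).left_inv (mem_chart_source ℂ p)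
  refine Filter.Eventually.and ?_ ?_
  · exact (eventually_chart_iff (p := fun y => f y ∈ (chartAt ℂ (f p)).source) p).2
      (hf.continuous.continuousAt.eventually
        ((chartAt ℂ (f p)).open_source.mem_nhds (mem_chart_source ℂ _)))
  · have h1 := (holAt_chart_comp hf.hol p).analyticAt_comp_symm
    have h2 : deriv (fun z => (chartAt ℂ (f p) ∘ f) ((chartAt ℂ p).symm z)) (chartAt ℂ p p) = 0 := by
      by_contra hne
      have h3 := h1.analyticOrderAt_sub_eq_one_of_deriv_ne_zero hne
      simp only [e1] at h3
      have h4 := localDegree_cast hf.nc p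
      rw [ordAt, h3] at h4
      have : localDegree f p = 1 := by exact_mod_cast h4
      omega
    have h3 := h1.differentiableAt.hasDerivAt
    rw [h2] at h3
    have h4 := h3.isLittleO.def one_pos
    filter_upwards [h4] with z hz
    simpa [e1] using hz

lemma eventually_forall_closedBall {p : ℂ → Prop} {z₀ : ℂ} (h : ∀ᶠ z in 𝓝 z₀, p z) :
    ∀ᶠ s in 𝓝[>] (0 : ℝ), ∀ z ∈ closedBall z₀ s, p z := by
  obtain ⟨r, hr, h⟩ := Metric.eventually_nhds_iff.1 h
  filter_upwards [Ioo_mem_nhdsGT hr] with s hs z hz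
  exact h ((mem_closedBall.1 hz).trans_lt hs.2)

/-- Arbitrarily small trapping neighbourhoods of a finite invariant set of ramified points. -/
theorem exists_trapping {f : X → X} (hf : IsHolEndo f) {E : Set X} (hE : E.Finite)
    (hEf : ∀ p ∈ E, f p ∈ E) (hE2 : ∀ p ∈ E, 2 ≤ localDegree f p) {A : Set X} (hA : A.Finite)
    (hAE : ∀ a ∈ A, a ∉ E) :
    ∃ U : Set X, IsOpen U ∧ E ⊆ U ∧ (∀ x ∈ U, f x ∈ U) ∧ ∀ a ∈ A, a ∉ closure U := by
  have h1 : ∀ᶠ s in 𝓝[>] (0 : ℝ), ∀ p ∈ E, ∀ z ∈ closedBall (chartAt ℂ p p) s,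
      (z ∈ (chartAt ℂ p).target ∧ ∀ a ∈ A, (chartAt ℂ p).symm z ≠ a) ∧
      f ((chartAt ℂ p).symm z) ∈ (chartAt ℂ (f p)).source ∧
      ‖chartAt ℂ (f p) (f ((chartAt ℂ p).symm z)) - chartAt ℂ (f p) (f p)‖ ≤ ‖z - chartAt ℂ p p‖ := by
    rw [Filter.eventually_all_finite hE]
    intro p hp
    refine eventually_forall_closedBall (Filter.Eventually.and (Filter.Eventually.and
      ((chartAt ℂ p).open_target.mem_nhds (mem_chart_target ℂ p)) ?_)
      (eventually_norm_chart_sub_le hf (hE2 p hp)))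
    rw [Filter.eventually_all_finite hA]
    intro a ha
    refine (eventually_chart_iff (p := fun y => y ≠ a) p).2 (isOpen_ne.mem_nhds ?_)
    rintro rfl
    exact hAE _ ha hp
  -- One radius serves for all points of `E`: as `f` does not increase chart distances from p to f
  -- p, the union of the balls is forward invariant.
  obtain ⟨s, hs, hs0⟩ := (h1.and self_mem_nhdsWithin).exists
  have hs0 : 0 < s := hs0
  have hUo : ∀ p ∈ E, IsOpen ((chartAt ℂ p).symm '' ball (chartAt ℂ p p) s) := fun p hp =>
    (chartAt ℂ p).symm.isOpen_image_of_subset_source isOpen_ball fun z hz =>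
      (hs p hp z (ball_subset_closedBall hz)).1.1
  refine ⟨⋃ p ∈ E, (chartAt ℂ p).symm '' ball (chartAt ℂ p p) s, isOpen_biUnion hUo, ?_, ?_, ?_⟩
  · exact fun p hp => mem_iUnion₂.2 ⟨p, hp, chartAt ℂ p p, mem_ball_self hs0,
      (chartAt ℂ p).left_inv (mem_chart_source ℂ p)⟩
  · intro x hx
    obtain ⟨p, hp, z, hz, rfl⟩ := mem_iUnion₂.1 hx
    obtain ⟨-, h3, h4⟩ := hs p hp z (ball_subset_closedBall hz)
    refine mem_iUnion₂.2 ⟨f p, hEf p hp, _, ?_, (chartAt ℂ (f p)).left_inv h3⟩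
    rw [mem_ball, dist_eq_norm] at hz ⊢
    exact h4.trans_lt hz
  · intro a ha haU
    have h5 : IsClosed (⋃ p ∈ E, (chartAt ℂ p).symm '' closedBall (chartAt ℂ p p) s) :=
      hE.isClosed_biUnion fun p hp => ((isCompact_closedBall _ _).image_of_continuousOn
        ((chartAt ℂ p).continuousOn_symm.mono fun z hz => (hs p hp z hz).1.1)).isClosed
    have h6 := closure_minimal (iUnion₂_mono fun p _ => image_mono ball_subset_closedBall) h5 haU
    obtain ⟨p, hp, z, hz, hza⟩ := mem_iUnion₂.1 h6
    exact (hs p hp z hz).1.2 a ha hza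

end Exceptional

/-! ### Density of smooth functions and global vanishing of the oscillation -/

section Density

variable {X : Type*} [TopologicalSpace X] [ChartedSpace ℂ X] [IsManifold 𝓘(ℂ) ω X]
  [CompactSpace X] [T2Space X]

/-- Smooth functions separate points. -/
lemma exists_smoothFn_ne {x y : X} (hxy : x ≠ y) : ∃ φ : X → ℝ, SmoothFn φ ∧ φ x ≠ φ y := by
  have h1 : ∀ᶠ s in 𝓝[>] (0 : ℝ), ∀ z ∈ closedBall (chartAt ℂ x x) s,
      z ∈ (chartAt ℂ x).target ∧ (chartAt ℂ x).symm z ≠ y :=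
    eventually_forall_closedBall (Filter.Eventually.and
      ((chartAt ℂ x).open_target.mem_nhds (mem_chart_target ℂ x))
      ((eventually_chart_iff (p := fun w => w ≠ y) x).2 (isOpen_ne.mem_nhds hxy)))
  obtain ⟨s, hs, hs0⟩ := (h1.and self_mem_nhdsWithin).exists
  have hs0 : 0 < s := hs0
  set b : ContDiffBump (chartAt ℂ x x) := ⟨s / 2, s, half_pos hs0, half_lt_self hs0⟩
  refine ⟨chartExt x b, smoothFn_chartExt (isCompact_closedBall (chartAt ℂ x x) s)
    (fun z hz => (hs z hz).1) (fun z hz => bump_zero b hz) b.contDiff, ?_⟩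
  have h2 : chartExt x b x = 1 := by
    rw [chartExt_of_mem _ (mem_chart_source ℂ x)]
    exact b.one_of_mem_closedBall (mem_closedBall_self b.rIn_pos.le)
  have h3 : chartExt x b y = 0 := by
    by_cases hy : y ∈ (chartAt ℂ x).source
    · rw [chartExt_of_mem _ hy]
      exact bump_zero b fun h => (hs _ h).2 ((chartAt ℂ x).left_inv hy)
    · exact if_neg hy
  rw [h2, h3]; exact one_ne_zero

/-- Stone–Weierstrass: the smooth functions form an algebra that separates points. -/
lemma exists_smoothFn_near {φ : X → ℝ} (hφ : Continuous φ) {ε : ℝ} (hε : 0 < ε) :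
    ∃ ψ : X → ℝ, SmoothFn ψ ∧ ∀ x, |ψ x - φ x| < ε := by
  let A : Subalgebra ℝ C(X, ℝ) :=
    { carrier := {g | SmoothFn g}
      mul_mem' := fun {a b} ha hb x => ContDiffAt.mul (ha x) (hb x)
      add_mem' := fun {a b} ha hb x => ContDiffAt.add (ha x) (hb x)
      algebraMap_mem' := fun r x => contDiffAt_const }
  have hA : A.SeparatesPoints := fun x y hxy => by
    obtain ⟨ψ, hψ, h⟩ := exists_smoothFn_ne hxy
    exact ⟨ψ, ⟨⟨ψ, hψ.continuous⟩, hψ, rfl⟩, h⟩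
  obtain ⟨g, hg⟩ := ContinuousMap.exists_mem_subalgebra_near_continuous_of_separatesPoints A hA φ hφ
    ε hε
  exact ⟨g, g.2, fun x => hg x⟩

end Density

section Chain

variable {X : Type*} [TopologicalSpace X] [ChartedSpace ℂ X] [IsManifold 𝓘(ℂ) ω X]
  [MeasurableSpace X] [BorelSpace X] [CompactSpace X] [T2Space X] [ConnectedSpace X]

lemma transfer_iterate_three {f : X → X} (hf : IsHolEndo f) (h0 : topologicalDegree f ≠ 0) :
    transfer f^[3] = (transfer f)^[3] := by
  funext u y
  rw [transfer_iterate_eq hf h0, transfer, degree_iterate hf h0, Nat.cast_pow]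

lemma localDegree_iterate_three {f : X → X} (hf : IsHolEndo f) (x : X) :
    localDegree f^[3] x = localDegree f (f (f x)) * (localDegree f (f x) * localDegree f x) := by
  have h : f^[3] = f ∘ (f ∘ f) := rfl
  rw [h, localDegree_comp (hf.comp hf).hol hf.hol, localDegree_comp hf.hol hf.hol]
  rfl

/-- Outside the exceptional set one of the three factors is smaller than λ; this is why that set is
defined by three consecutive points. -/
lemma localDegree_iterate_three_lt {f : X → X} (hf : IsHolEndo f) (h2 : 2 ≤ topologicalDegree f)
    {x : X} (hx : x ∉ exceptionalSet f) : localDegree f^[3] x < topologicalDegree f ^ 3 := by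
  rw [localDegree_iterate_three hf]
  have l1 := localDegree_le hf x
  have l2 := localDegree_le hf (f x)
  have l3 := localDegree_le hf (f (f x))
  have h : localDegree f x < topologicalDegree f ∨ localDegree f (f x) < topologicalDegree f ∨
      localDegree f (f (f x)) < topologicalDegree f := by
    by_contra hcon
    push Not at hcon
    exact hx ⟨le_antisymm l1 hcon.1, le_antisymm l2 hcon.2.1, le_antisymm l3 hcon.2.2⟩
  generalize topologicalDegree f = n at *
  generalize localDegree f x = a at *
  generalize localDegree f (f x) = b at *
  generalize localDegree f (f (f x)) = c at *
  have h4 : n ^ 3 = n * (n * n) := by ring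
  rw [h4]
  have hn : 0 < n := by omega
  have hnn : 0 < n * n := Nat.mul_pos hn hn
  rcases h with h | h | h
  · exact lt_of_le_of_lt (Nat.mul_le_mul_right _ l3) (Nat.mul_lt_mul_of_pos_left
      (lt_of_le_of_lt (Nat.mul_le_mul_right _ l2) (Nat.mul_lt_mul_of_pos_left h hn)) hn)
  · exact lt_of_le_of_lt (Nat.mul_le_mul_right _ l3) (Nat.mul_lt_mul_of_pos_left
      (lt_of_le_of_lt (Nat.mul_le_mul_left _ l1) (Nat.mul_lt_mul_of_pos_right h hn)) hn)
  · exact lt_of_le_of_lt (Nat.mul_le_mul_left _ (Nat.mul_le_mul l2 l1))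
      (Nat.mul_lt_mul_of_pos_right h hnn)

/-- The operators contract the sup norm, so smooth functions, which are dense, suffice. -/
lemma tendsto_of_forall_near {T : ℕ → (X → ℝ) → X → ℝ}
    (hT : ∀ n u v c, (∀ x, |u x - v x| ≤ c) → ∀ y, |T n u y - T n v y| ≤ c) {a b : X}
    (h : ∀ φ : X → ℝ, SmoothFn φ → Tendsto (fun n => T n φ a - T n φ b) atTop (𝓝 0))
    {φ : X → ℝ} (hφ : Continuous φ) : Tendsto (fun n => T n φ a - T n φ b) atTop (𝓝 0) := by
  rw [Metric.tendsto_nhds]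
  intro ε hε
  obtain ⟨ψ, hψ, hψφ⟩ := exists_smoothFn_near hφ (show 0 < ε / 3 by positivity)
  filter_upwards [Metric.tendsto_nhds.1 (h ψ hψ) (ε / 3) (by positivity)] with n hn
  have h1 := hT n ψ φ (ε / 3) (fun x => (hψφ x).le) a
  have h2 := hT n ψ φ (ε / 3) (fun x => (hψφ x).le) b
  rw [Real.dist_0_eq_abs] at hn ⊢
  rw [abs_lt] at hn ⊢
  rw [abs_le] at h1 h2
  constructor <;> linarith

/-- The oscillation of the iterates of the transfer operator tends to zero off the exceptional
set. -/
theorem tendsto_transfer_sub {f : X → X} (hf : IsHolEndo f) (h2 : 2 ≤ topologicalDegree f)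
    (hT : (totallyRamified f).encard ≤ 2) {a b : X} (ha : a ∉ exceptionalSet f)
    (hb : b ∉ exceptionalSet f) {φ : X → ℝ} (hφ : Continuous φ) :
    Tendsto (fun n => (transfer f)^[n] φ a - (transfer f)^[n] φ b) atTop (𝓝 0) := by
  have h0 : topologicalDegree f ≠ 0 := by omega
  set E := exceptionalSet f
  have hE : E.Finite := finite_exceptionalSet hT
  set F := f^[3]
  have hF : IsHolEndo F := hf.iterate 3
  have hdF : topologicalDegree F = topologicalDegree f ^ 3 := degree_iterate hf h0 3
  have hF0 : topologicalDegree F ≠ 0 := by rw [hdF]; exact pow_ne_zero 3 h0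
  have h8 : 8 ≤ topologicalDegree f ^ 3 := by
    calc 8 = 2 ^ 3 := rfl
      _ ≤ _ := Nat.pow_le_pow_left h2 3
  have hFE : ∀ x, F x ∈ E ↔ x ∈ E := fun x => iterate_mem_exceptionalSet_iff hf hT 3
  -- These neighbourhoods depend neither on the map nor on `K`, which matters because the trapping
  -- set used below varies with `a` and `b`.
  choose N hNo hxN hN using exists_nhds_tendsto_transfer_sub (X := X)
  -- the local statement
  have hloc : ∀ x, ∀ a ∈ N x, a ∉ E → ∀ b ∈ N x, b ∉ E → ∀ φ : X → ℝ, Continuous φ →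
      Tendsto (fun k => (transfer F)^[k] φ a - (transfer F)^[k] φ b) atTop (𝓝 0) := by
    intro x a ha haE b hb hbE φ hφ
    refine tendsto_of_forall_near (T := fun k => (transfer F)^[k])
      (fun n u v c h y => transfer_iterate_sub_le hF hF0 n h y) (fun φ hφ => ?_) hφ
    obtain ⟨U, hU, hEU, hfU, hAU⟩ := exists_trapping hf hE
      (fun p hp => (map_mem_exceptionalSet_iff hf hT).2 hp)
      (fun p hp => by rw [show localDegree f p = _ from hp.1]; exact h2)
      (A := {a, b}) (toFinite _) (by
        rintro c (rfl | rfl) <;> assumption)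
    have hFU : ∀ x ∈ U, F x ∈ U := fun x hx => hfU _ (hfU _ (hfU _ hx))
    -- The complement of the trapping set avoids the exceptional points, so the local degrees of `F`
    -- over it are at most λ^3 - 1.
    refine hN x F hF (topologicalDegree f ^ 3 - 1) (by omega) (by rw [hdF]; omega) Uᶜ
      hU.isClosed_compl (fun z hz => ?_) (fun z hz h => hz (hFU z h)) φ hφ a ⟨ha, ?_⟩ b ⟨hb, ?_⟩
    · have : z ∉ exceptionalSet f := fun h => hz (hEU ((hFE z).2 h))
      have := localDegree_iterate_three_lt hf h2 this
      exact Nat.le_sub_one_of_lt this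
    · rw [interior_compl]; exact hAU a (by simp)
    · rw [interior_compl]; exact hAU b (by simp)
  -- the chain of neighbourhoods
  have hchain : ∀ b ∉ E, ∀ φ : X → ℝ, Continuous φ →
      Tendsto (fun k => (transfer F)^[k] φ a - (transfer F)^[k] φ b) atTop (𝓝 0) := by
    set S : Set X := {x | ∀ b ∈ N x, b ∉ E → ∀ φ : X → ℝ, Continuous φ →
      Tendsto (fun k => (transfer F)^[k] φ a - (transfer F)^[k] φ b) atTop (𝓝 0)}
    -- Two overlapping neighbourhoods share a point outside the finite set `E`, through which the
    -- two limits are compared.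
    have hstep : ∀ x ∈ S, ∀ y, (N x ∩ N y).Nonempty → y ∈ S := by
      rintro x hx y ⟨z, hz⟩ b hb hbE φ hφ
      obtain ⟨w, hw, hwE⟩ := exists_ne_of_isOpen ((hNo x).inter (hNo y)) hz E hE
      have := (hx w hw.1 hwE φ hφ).add (hloc y w hw.2 hwE b hb hbE φ hφ)
      rw [add_zero] at this
      exact this.congr fun k => by ring
    have hSo : IsOpen S := by
      rw [isOpen_iff_mem_nhds]
      intro x hx
      filter_upwards [(hNo x).mem_nhds (hxN x)] with y hy
      exact hstep x hx y ⟨y, hy, hxN y⟩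
    have hSc : IsClosed S := by
      rw [← isOpen_compl_iff, isOpen_iff_mem_nhds]
      intro x hx
      filter_upwards [(hNo x).mem_nhds (hxN x)] with y hy hyS
      exact hx (hstep y hyS x ⟨y, hxN y, hy⟩)
    have haS : a ∈ S := fun b hb hbE φ hφ => hloc a a (hxN a) ha b hb hbE φ hφ
    have hS : S = univ := (isClopen_iff.1 ⟨hSc, hSo⟩).resolve_left (Set.Nonempty.ne_empty ⟨a, haS⟩)
    intro b hb
    have : b ∈ S := hS ▸ mem_univ b
    exact this b (hxN b) hb
  -- Each residue class modulo 3 is handled by applying the result for `F` to `(transfer f)^[j] φ`,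
  -- which is continuous but perhaps not smooth.
  have hres : ∀ j : ℕ, Tendsto (fun k => (transfer f)^[3 * k + j] φ a - (transfer f)^[3 * k + j] φ b)
      atTop (𝓝 0) := by
    intro j
    refine (hchain b hb _ (continuous_transfer_iterate hf hφ j)).congr fun k => ?_
    rw [transfer_iterate_three hf h0, ← Function.iterate_mul, ← Function.iterate_add_apply]
  rw [Metric.tendsto_atTop]
  intro ε hε
  obtain ⟨n0, h0'⟩ := Metric.tendsto_atTop.1 (hres 0) ε hε
  obtain ⟨n1, h1'⟩ := Metric.tendsto_atTop.1 (hres 1) ε hε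
  obtain ⟨n2, h2'⟩ := Metric.tendsto_atTop.1 (hres 2) ε hε
  refine ⟨3 * (n0 + n1 + n2) + 3, fun n hn => ?_⟩
  have hdiv : n = 3 * (n / 3) + n % 3 := (Nat.div_add_mod n 3).symm
  have hmod : n % 3 = 0 ∨ n % 3 = 1 ∨ n % 3 = 2 := by omega
  rcases hmod with h | h | h <;> rw [hdiv, h]
  · exact h0' (n / 3) (by omega)
  · exact h1' (n / 3) (by omega)
  · exact h2' (n / 3) (by omega)

end Chain

/-! ### Construction of the equilibrium measure -/

section Limit

variable {X : Type*} [TopologicalSpace X] [ChartedSpace ℂ X] [IsManifold 𝓘(ℂ) ω X]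
  [MeasurableSpace X] [BorelSpace X] [CompactSpace X] [T2Space X] [ConnectedSpace X]

lemma exists_bound_of_continuous {φ : X → ℝ} (hφ : Continuous φ) : ∃ C, ∀ x, |φ x| ≤ C := by
  obtain ⟨C, hC⟩ := isCompact_univ.exists_bound_of_continuousOn hφ.continuousOn
  exact ⟨C, fun x => hC x (mem_univ x)⟩

lemma integrable_transfer_iterate {f : X → X} (hf : IsHolEndo f) {φ : X → ℝ} (hφ : Continuous φ)
    (n : ℕ) (ν : Measure X) [IsFiniteMeasure ν] : Integrable ((transfer f)^[n] φ) ν :=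
  integrable_of_continuous (continuous_transfer_iterate hf hφ n)

/-- If `ν` does not charge the exceptional set, then the averages of `T^n φ` with respect to `ν`
have the same asymptotic behaviour as the values at a point. -/
lemma tendsto_integral_transfer_sub {f : X → X} (hf : IsHolEndo f) (h2 : 2 ≤ topologicalDegree f)
    (hT : (totallyRamified f).encard ≤ 2) (ν : Measure X) [IsProbabilityMeasure ν]
    (hν : ν (exceptionalSet f) = 0) {a : X} (ha : a ∉ exceptionalSet f) {φ : X → ℝ}
    (hφ : Continuous φ) :
    Tendsto (fun n => ∫ x, (transfer f)^[n] φ x ∂ν - (transfer f)^[n] φ a) atTop (𝓝 0) := by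
  have h0 : topologicalDegree f ≠ 0 := by omega
  obtain ⟨C, hC⟩ := exists_bound_of_continuous hφ
  have h1 : Tendsto (fun n => ∫ x, ((transfer f)^[n] φ x - (transfer f)^[n] φ a) ∂ν) atTop
      (𝓝 (∫ _, (0 : ℝ) ∂ν)) := by
    refine tendsto_integral_of_dominated_convergence (fun _ => C + C) (fun n => ?_)
      (integrable_const _) (fun n => Eventually.of_forall fun x => ?_) ?_
    · exact ((integrable_transfer_iterate hf hφ n ν).sub (integrable_const _)).aestronglyMeasurable
    · exact (norm_sub_le _ _).trans (add_le_add (abs_transfer_iterate_le hf h0 n hC x)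
        (abs_transfer_iterate_le hf h0 n hC a))
    · have : ∀ᵐ x ∂ν, x ∉ exceptionalSet f := measure_eq_zero_iff_ae_notMem.1 hν
      exact this.mono fun x hx => tendsto_transfer_sub hf h2 hT hx ha hφ
  rw [integral_zero] at h1
  refine h1.congr fun n => ?_
  rw [integral_sub (integrable_transfer_iterate hf hφ n ν) (integrable_const _)]
  simp

/-- The complement of a forward invariant set contains all preimages of its points. -/
lemma transfer_iterate_eq_zero {f : X → X} (hf : IsHolEndo f) {U : Set X}
    (hU : ∀ x ∈ U, f x ∈ U) {φ : X → ℝ} (hφ : ∀ x ∉ U, φ x = 0) (n : ℕ) :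
    ∀ x ∉ U, (transfer f)^[n] φ x = 0 := by
  induction n with
  | zero => exact hφ
  | succ n ih =>
    intro x hx
    rw [Function.iterate_succ_apply', transfer, push_eq_sum hf]
    refine mul_eq_zero_of_right _ (Finset.sum_eq_zero fun z hz => ?_)
    have hz' : f z = x := by simpa using hz
    rw [ih z fun h => hx (hz' ▸ hU z h), mul_zero]

/-- Over a point of the backward invariant set `E`, the operator averages values of φ at points of
`E` only. -/
lemma transfer_iterate_eq_one {f : X → X} (hf : IsHolEndo f) (h0 : topologicalDegree f ≠ 0)
    {E : Set X} (hE : ∀ x, f x ∈ E → x ∈ E) {φ : X → ℝ} (hφ : ∀ x ∈ E, φ x = 1) (n : ℕ) :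
    ∀ x ∈ E, (transfer f)^[n] φ x = 1 := by
  induction n with
  | zero => exact hφ
  | succ n ih =>
    intro x hx
    rw [Function.iterate_succ_apply', transfer_congr hf (v := fun _ => 1), transfer_const hf h0]
    rintro z rfl
    exact ih z (hE z hx)

/-- The equilibrium measure. -/
theorem exists_limit_measure {f : X → X} (hf : IsHolEndo f) (h2 : 2 ≤ topologicalDegree f)
    (hT : (totallyRamified f).encard ≤ 2) :
    ∃ μ : Measure X, IsProbabilityMeasure μ ∧
      (∀ ν : Measure X, IsProbabilityMeasure ν → ν (exceptionalSet f) = 0 →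
        ∀ φ : X → ℝ, Continuous φ →
        Tendsto (fun n => ∫ x, (transfer f)^[n] φ x ∂ν) atTop (𝓝 (∫ x, φ x ∂μ))) ∧
      ∃ φ : X → ℝ, Continuous φ ∧ (∀ x, 0 ≤ φ x) ∧ (∀ x ∈ exceptionalSet f, φ x = 1) ∧
        ∫ x, φ x ∂μ = 0 := by
  have := secondCountable_surface X
  have h0 : topologicalDegree f ≠ 0 := by omega
  set E := exceptionalSet f
  have hE : E.Finite := finite_exceptionalSet hT
  obtain ⟨a, -, ha⟩ := exists_ne_of_isOpen isOpen_univ (mem_univ (Classical.arbitrary X)) E hE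
  have hP : ∀ n, IsProbabilityMeasure (normalizedPullback f n (Measure.dirac a)) := fun n =>
    isProbabilityMeasure_normalizedPullback hf h0 n _
  let ν : ℕ → ProbabilityMeasure X := fun n => ⟨normalizedPullback f n (Measure.dirac a), hP n⟩
  -- Probability measures on `X` form a compact space, so the pullbacks of the Dirac mass converge
  -- along an ultrafilter; full convergence comes only at the end.
  obtain ⟨μ, -, hμ⟩ := isCompact_univ.ultrafilter_le_nhds ((hyperfilter ℕ).map ν) (by simp)
  have hlim : ∀ φ : X → ℝ, Continuous φ → Tendsto (fun n => (transfer f)^[n] φ a) (hyperfilter ℕ)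
      (𝓝 (∫ x, φ x ∂(μ : Measure X))) := by
    intro φ hφ
    have h1 : Tendsto ν (hyperfilter ℕ) (𝓝 μ) := hμ
    have h3 := (ProbabilityMeasure.tendsto_iff_forall_integral_tendsto.1 h1)
      (BoundedContinuousFunction.mkOfCompact ⟨φ, hφ⟩)
    refine h3.congr fun n => ?_
    change ∫ x, φ x ∂(normalizedPullback f n (Measure.dirac a)) = _
    rw [integral_normalizedPullback hf h0 n _ hφ, integral_dirac]
  -- T^n(Tφ)(a) is the mean of T^n φ over the preimages of `a`, none of which is exceptional; its
  -- difference with T^n φ(a) tends to 0, which makes `μ` invariant.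
  have hsub : ∀ φ : X → ℝ, Continuous φ →
      Tendsto (fun n => (transfer f)^[n] (transfer f φ) a - (transfer f)^[n] φ a) atTop (𝓝 0) := by
    intro φ hφ
    have h1 : ∀ z ∈ (finite_fiber hf a).toFinset,
        Tendsto (fun n => (localDegree f z : ℝ) * ((transfer f)^[n] φ z - (transfer f)^[n] φ a))
        atTop (𝓝 0) := by
      intro z hz
      have hz' : f z = a := by simpa using hz
      have hzE : z ∉ E := fun h => ha (hz' ▸ (map_mem_exceptionalSet_iff hf hT).2 h)
      simpa using (tendsto_transfer_sub hf h2 hT hzE ha hφ).const_mul (localDegree f z : ℝ)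
    have h3 := (tendsto_finsetSum _ h1).const_mul (topologicalDegree f : ℝ)⁻¹
    rw [Finset.sum_const_zero, mul_zero] at h3
    refine h3.congr fun n => ?_
    have hlam : (topologicalDegree f : ℝ) ≠ 0 := by exact_mod_cast h0
    have hsum : ∑ z ∈ (finite_fiber hf a).toFinset, (localDegree f z : ℝ) = topologicalDegree f := by
      exact_mod_cast sum_localDegree hf a
    rw [← Function.iterate_succ_apply, Function.iterate_succ_apply', transfer, push_eq_sum hf]
    simp only [mul_sub, Finset.sum_sub_distrib]
    rw [← Finset.sum_mul, hsum, inv_mul_cancel_left₀ hlam]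
  have hinv : ∀ φ : X → ℝ, Continuous φ →
      ∫ x, transfer f φ x ∂(μ : Measure X) = ∫ x, φ x ∂(μ : Measure X) := by
    intro φ hφ
    have h1 := (hlim _ (continuous_transfer hf hφ)).sub (hlim φ hφ)
    have h3 := (hsub φ hφ).mono_left (Nat.hyperfilter_le_atTop)
    exact sub_eq_zero.1 (tendsto_nhds_unique h1 h3)
  have hinvn : ∀ n, ∀ φ : X → ℝ, Continuous φ →
      ∫ x, (transfer f)^[n] φ x ∂(μ : Measure X) = ∫ x, φ x ∂(μ : Measure X) := by
    intro n φ hφ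
    induction n with
    | zero => rfl
    | succ n ih =>
      rw [Function.iterate_succ', ← ih]
      exact hinv _ (continuous_transfer_iterate hf hφ n)
  obtain ⟨U, hU, hEU, hfU, haU⟩ := exists_trapping hf hE
    (fun p hp => (map_mem_exceptionalSet_iff hf hT).2 hp)
    (fun p hp => by rw [show localDegree f p = _ from hp.1]; exact h2)
    (A := {a}) (toFinite _) (by rintro c rfl; exact ha)
  have haU' : a ∉ U := fun h => haU a rfl (subset_closure h)
  -- This φ is 1 on `E` and 0 off a trapping neighbourhood missing `a`. So T^n φ(a) = 0 for all n,
  -- hence φ has μ-integral 0 and `μ` does not charge `E`.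
  obtain ⟨φ, hφ0, hφ1, hφ⟩ := exists_continuous_zero_one_of_isClosed (s := Uᶜ) (t := E)
    hU.isClosed_compl hE.isClosed (disjoint_compl_left_iff_subset.2 hEU)
  have hφint : ∫ x, φ x ∂(μ : Measure X) = 0 := by
    refine tendsto_nhds_unique (hlim φ φ.continuous) ?_
    have : (fun n => (transfer f)^[n] φ a) = fun _ => 0 := funext fun n =>
      transfer_iterate_eq_zero hf hfU (fun x hx => hφ0 hx) n a haU'
    rw [this]; exact tendsto_const_nhds
  have hμE : (μ : Measure X) E = 0 := by
    have h1 := (integral_eq_zero_iff_of_nonneg (fun x => (hφ x).1)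
      (integrable_of_continuous φ.continuous)).1 hφint
    refine measure_mono_null (fun x hx => ?_) (ae_iff.1 h1)
    simp [hφ1 hx]
  refine ⟨μ, inferInstance, fun ν hν hνE φ hφ => ?_, φ, φ.continuous, fun x => (hφ x).1,
    fun x hx => hφ1 hx, hφint⟩
  -- Both ν and μ follow the values at `a`, and the integral against μ does not vary with n by
  -- invariance.
  have h3 := (tendsto_integral_transfer_sub hf h2 hT ν hνE ha hφ).sub
    (tendsto_integral_transfer_sub hf h2 hT (μ : Measure X) hμE ha hφ)
  rw [sub_zero] at h3
  have h4 := h3.add_const (∫ x, φ x ∂(μ : Measure X))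
  rw [zero_add] at h4
  refine h4.congr fun n => ?_
  rw [hinvn n φ hφ]; ring

end Limit

/-! ### Smooth measures: no atoms, and existence -/

section SmoothMeasures

variable {X : Type*} [TopologicalSpace X] [ChartedSpace ℂ X] [IsManifold 𝓘(ℂ) ω X]
  [MeasurableSpace X] [BorelSpace X]

/-- A measure with a density in charts has no atoms. -/
lemma measure_finite_of_isSmoothMeasure {σ : Measure X} (hσ : IsSmoothMeasure σ) {s : Set X}
    (hs : s.Finite) : σ s = 0 := by
  rw [← biUnion_of_singleton s]
  refine (measure_biUnion_null_iff hs.countable).2 fun p _ => ?_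
  obtain ⟨ρ, -, -, h⟩ := hσ (chartAt ℂ p) (chart_mem_atlas ℂ p)
  have h1 := h {chartAt ℂ p p} (measurableSet_singleton _)
    (singleton_subset_iff.2 (mem_chart_target ℂ p))
  rw [setLIntegral_measure_zero _ _ (by simp)] at h1
  refine measure_mono_null ?_ h1
  rintro x rfl
  exact ⟨mem_chart_source ℂ x, rfl⟩

lemma measurableSet_source_inter_preimage (e : OpenPartialHomeomorph X ℂ) {A : Set ℂ}
    (hA : MeasurableSet A) : MeasurableSet (e.source ∩ e ⁻¹' A) := by
  have h1 : Measurable (e.source.domRestrict e) :=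
    (continuousOn_iff_continuous_domRestrict.1 e.continuousOn).measurable
  have h2 := e.open_source.measurableSet.subtype_image (h1 hA)
  convert h2 using 1
  ext z
  simp [and_comm]

variable [T2Space X]

/-- A smooth probability measure supported in a chart. -/
theorem exists_isSmoothMeasure [Nonempty X] :
    ∃ σ : Measure X, IsProbabilityMeasure σ ∧ IsSmoothMeasure σ := by
  obtain ⟨x⟩ : Nonempty X := inferInstance
  set c := chartAt ℂ x
  obtain ⟨b, hb⟩ : ∃ b : ContDiffBump (c x), closedBall (c x) b.rOut ⊆ c.target := exists_bump x
  set β : ℂ → ℝ := b.normed volume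
  have hβ0 : ∀ z, 0 ≤ β z := fun z => b.nonneg_normed z
  have hβz : ∀ z ∉ closedBall (c x) b.rOut, β z = 0 := fun z hz => by
    simp only [β, ContDiffBump.normed_def, bump_zero b hz, zero_div]
  have hβs : ContDiff ℝ ∞ β := b.contDiff_normed
  have hβm : Measurable fun z => ENNReal.ofReal (β z) := hβs.continuous.measurable.ennreal_ofReal
  have hβt : ∀ z ∉ c.target, β z = 0 := fun z hz => hβz z fun h => hz (hb h)
  set m : Measure ℂ := (volume.withDensity fun z => ENNReal.ofReal (β z)).restrict c.target
  have hcm : AEMeasurable c.symm m := c.continuousOn_symm.aemeasurable c.open_target.measurableSet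
  have hsm := smoothFn_chartExt (x := x) (isCompact_closedBall (c x) b.rOut) hb hβz hβs
  refine ⟨m.map c.symm, ⟨?_⟩, fun e he => ?_⟩
  · rw [Measure.map_apply_of_aemeasurable hcm MeasurableSet.univ, preimage_univ,
      Measure.restrict_apply_univ, withDensity_apply _ c.open_target.measurableSet,
      setLIntegral_eq_of_support_subset, ← ofReal_integral_eq_lintegral_ofReal b.integrable_normed
        (Eventually.of_forall hβ0), b.integral_normed, ENNReal.ofReal_one]
    intro z hz
    by_contra h
    exact hz (by simp [hβt z h])
  set v : ℂ → ℂ := fun w => c (e.symm w)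
  -- The density in another chart picks up the Jacobian |v'|² of the holomorphic transition;
  -- extension by zero stays smooth since the bump has compact support in the chart at `x`.
  set ρ : ℂ → ℝ := fun w => ‖deriv v w‖ ^ 2 * chartExt x β (e.symm w)
  have hv : ∀ w ∈ e.target, e.symm w ∈ c.source → AnalyticAt ℂ v w := fun w hw hwc =>
    holAt_iff_analyticAt.1 (HolAt.comp (g := c) (f := e.symm) (holAt_chartAt hwc)
      (holAt_symm_of_mem_atlas he hw))
  refine ⟨ρ, fun w hw => ?_, fun w hw => ?_, fun A hA hAe => ?_⟩
  · refine ContDiffAt.contDiffWithinAt ?_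
    by_cases hwc : e.symm w ∈ c.source
    · have h1 : ContDiffAt ℝ ∞ (deriv v) w := (hv w hw hwc).deriv.contDiffAt_real (n := ⊤)
      exact (h1.norm_sq ℝ).mul ((hsm (e.symm w)).comp_curve (holAt_symm_of_mem_atlas he hw))
    · have h1 : e.symm w ∉ c.symm '' closedBall (c x) b.rOut := by
        rintro ⟨z, hz, hzw⟩
        exact hwc (hzw ▸ c.map_target (hb hz))
      have h2 := chartExt_eventually_zero (isCompact_closedBall (c x) b.rOut) hb hβz h1
      have h3 : ρ =ᶠ[𝓝 w] fun _ => 0 := by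
        filter_upwards [(e.continuousAt_symm hw).eventually h2] with w' hw'
        simp only [ρ, hw', mul_zero]
      exact contDiffAt_const.congr_of_eventuallyEq h3
  · refine mul_nonneg (by positivity) ?_
    by_cases hwc : e.symm w ∈ c.source
    · rw [chartExt_of_mem _ hwc]; exact hβ0 _
    · rw [chartExt, if_neg hwc]
  · set S := e.source ∩ e ⁻¹' A
    have hS : MeasurableSet S := measurableSet_source_inter_preimage e hA
    set A' := A ∩ e.symm ⁻¹' c.source
    have hA'o : IsOpen (e.target ∩ e.symm ⁻¹' c.source) :=
      e.symm.isOpen_inter_preimage c.open_source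
    have hA'eq : A' = A ∩ (e.target ∩ e.symm ⁻¹' c.source) := by
      rw [← inter_assoc, inter_eq_left.2 hAe]
    have hA' : MeasurableSet A' := hA'eq ▸ hA.inter hA'o.measurableSet
    have himg : v '' A' = c.target ∩ c.symm ⁻¹' S := by
      ext z
      constructor
      · rintro ⟨w, ⟨hwA, hwc⟩, rfl⟩
        refine ⟨c.map_source hwc, ?_⟩
        simp only [v, mem_preimage]
        rw [c.left_inv hwc]
        refine ⟨e.map_target (hAe hwA), ?_⟩
        rw [mem_preimage, e.right_inv (hAe hwA)]; exact hwA
      · rintro ⟨hz, hz1, hz2⟩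
        refine ⟨e (c.symm z), ⟨hz2, ?_⟩, ?_⟩
        · rw [mem_preimage, e.left_inv hz1]; exact c.map_target hz
        · simp only [v]; rw [e.left_inv hz1, c.right_inv hz]
    have hinj : InjOn v A' := fun w hw w' hw' h =>
      e.symm.injOn (hAe hw.1) (hAe hw'.1) (c.injOn hw.2 hw'.2 h)
    rw [Measure.map_apply_of_aemeasurable hcm hS]
    have h1 : m (c.symm ⁻¹' S) = ∫⁻ z in c.target ∩ c.symm ⁻¹' S, ENNReal.ofReal (β z) := by
      rw [Measure.restrict_apply' c.open_target.measurableSet, inter_comm,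
        withDensity_apply' ]
    rw [h1, ← himg, lintegral_image_hol hA' (fun w hw => hv w (hAe hw.1) hw.2) hinj]
    have h2 : ∫⁻ z in A', ‖deriv v z‖ₑ ^ 2 * ENNReal.ofReal (β (v z)) =
        ∫⁻ z in A', ENNReal.ofReal (ρ z) := by
      refine setLIntegral_congr_fun hA' fun w hw => ?_
      simp only [ρ]
      rw [ENNReal.ofReal_mul (by positivity), ENNReal.ofReal_pow (norm_nonneg _), ofReal_norm,
        chartExt_of_mem _ hw.2]
    rw [h2]
    have h3 : A' ∩ A = A' := inter_eq_left.2 inter_subset_left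
    rw [← h3, ← setLIntegral_indicator hA']
    refine setLIntegral_congr_fun hA fun w hw => ?_
    by_cases hwc : w ∈ A'
    · exact indicator_of_mem hwc _
    · have h4 : e.symm w ∉ c.source := fun h => hwc ⟨hw, h⟩
      rw [indicator_of_notMem hwc]
      simp only [ρ, chartExt, if_neg (show e.symm w ∉ (chartAt ℂ x).source from h4), mul_zero,
        ENNReal.ofReal_zero]

end SmoothMeasures

/-! ### The equidistribution theorem, granted the bound on totally ramified points -/

section Main

variable {X : Type*} [TopologicalSpace X] [ChartedSpace ℂ X] [IsManifold 𝓘(ℂ) ω X]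
  [MeasurableSpace X] [BorelSpace X] [CompactSpace X] [T2Space X] [ConnectedSpace X]

/-- The equidistribution theorem, given a bound for the number of totally ramified points. -/
theorem equidistribution_of_encard_le {f : X → X} (hf : IsHolEndo f)
    (h2 : 2 ≤ topologicalDegree f) (hT : (totallyRamified f).encard ≤ 2) :
    (∃! μ : Measure X, IsCanonicalMeasure f μ) ∧ IsCanonicalMeasure f (canonicalMeasure f) ∧
    (exceptionalSet f).encard ≤ 2 ∧
    (∀ ν : Measure X, IsProbabilityMeasure ν →
      (WeakTendsto (fun n => normalizedPullback f n ν) (canonicalMeasure f) ↔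
        ν (exceptionalSet f) = 0)) ∧
    (∀ a : X, WeakTendsto (fun n => normalizedPullback f n (Measure.dirac a)) (canonicalMeasure f) ↔
      a ∉ exceptionalSet f) := by
  have := secondCountable_surface X
  have h0 : topologicalDegree f ≠ 0 := by omega
  have hE : (exceptionalSet f).Finite := finite_exceptionalSet hT
  obtain ⟨μ, hμP, hμ, ψ, hψc, hψ0, hψ1, hψμ⟩ := exists_limit_measure hf h2 hT
  have hconv : ∀ ν : Measure X, IsProbabilityMeasure ν → ν (exceptionalSet f) = 0 →
      WeakTendsto (fun n => normalizedPullback f n ν) μ := fun ν hν hνE φ => by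
    simp only [integral_normalizedPullback hf h0 _ ν φ.continuous]
    exact hμ ν hν hνE φ φ.continuous
  have hμcan : IsCanonicalMeasure f μ := ⟨hμP, fun σ hσ hs =>
    hconv σ hσ (measure_finite_of_isSmoothMeasure hs hE)⟩
  have huniq : ∀ μ' : Measure X, IsCanonicalMeasure f μ' → μ' = μ := by
    intro μ' hμ'
    obtain ⟨σ, hσ, hs⟩ := exists_isSmoothMeasure (X := X)
    have := hμ'.isProbabilityMeasure
    refine ext_of_forall_integral_eq_of_IsFiniteMeasure fun φ => ?_
    exact tendsto_nhds_unique (hμ'.weakTendsto σ hσ hs φ.toContinuousMap)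
      (hμcan.weakTendsto σ hσ hs φ.toContinuousMap)
  have hex : ∃ μ : Measure X, IsCanonicalMeasure f μ := ⟨μ, hμcan⟩
  have hcan : canonicalMeasure f = μ := by
    rw [canonicalMeasure, dif_pos hex]
    exact huniq _ hex.choose_spec
  have hiff : ∀ ν : Measure X, IsProbabilityMeasure ν →
      (WeakTendsto (fun n => normalizedPullback f n ν) (canonicalMeasure f) ↔
        ν (exceptionalSet f) = 0) := by
    intro ν hν
    rw [hcan]
    refine ⟨fun h => ?_, hconv ν hν⟩
    have h1 := h ⟨ψ, hψc⟩
    simp only [ContinuousMap.coe_mk, integral_normalizedPullback hf h0 _ ν hψc, hψμ] at h1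
    -- T^n ψ is nonnegative and remains 1 on the exceptional set, while its ν-integral tends to the
    -- μ-integral of ψ, which is 0.
    have h3 : ∀ n, ν.real (exceptionalSet f) ≤ ∫ x, (transfer f)^[n] ψ x ∂ν := by
      intro n
      rw [← integral_indicator_one hE.measurableSet]
      refine integral_mono ((integrable_indicator_iff hE.measurableSet).2 (integrable_const _).integrableOn)
        (integrable_transfer_iterate hf hψc n ν) fun x => ?_
      by_cases hx : x ∈ exceptionalSet f
      · rw [indicator_of_mem hx, transfer_iterate_eq_one hf h0
          (fun x h => (map_mem_exceptionalSet_iff hf hT).1 h) hψ1 n x hx]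
        rfl
      · rw [indicator_of_notMem hx]
        exact transfer_iterate_nonneg hf n hψ0 x
    have h4 : ν.real (exceptionalSet f) ≤ 0 := ge_of_tendsto' h1 h3
    exact (measureReal_eq_zero_iff).1 (le_antisymm h4 measureReal_nonneg)
  refine ⟨⟨μ, hμcan, huniq⟩, hcan ▸ hμcan, (encard_le_encard (exceptionalSet_subset f)).trans hT,
    hiff, fun a => ?_⟩
  rw [hiff _ inferInstance, Measure.dirac_apply' _ hE.measurableSet]
  by_cases ha : a ∈ exceptionalSet f <;> simp [ha]

end Main

/-! ### Weyl's lemma for the ∂̄-operator -/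

section Weyl

open ContinuousLinearMap
open scoped Convolution

/-- The mean value property for radial weights. -/
lemma integral_radial_smul {f : ℂ → ℂ} {z : ℂ} {r δ : ℝ} (hδ : δ < r)
    (hf : DifferentiableOn ℂ f (ball z r)) {g : ℝ → ℝ} (hg : Continuous g)
    (hg0 : ∀ t, δ ≤ t → g t = 0) :
    ∫ w, g ‖w‖ • f (z - w) = (∫ w : ℂ, g ‖w‖) • f z := by
  set F : ℂ → ℂ := fun w => g ‖w‖ • f (z - w)
  have hF0 : ∀ w : ℂ, δ ≤ ‖w‖ → F w = 0 := fun w hw => by simp only [F, hg0 _ hw, zero_smul]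
  have hgw : Continuous fun w : ℂ => g ‖w‖ := hg.comp continuous_norm
  have hF : Continuous F := by
    rw [continuous_iff_continuousAt]
    intro w
    rcases lt_or_ge ‖w‖ r with hw | hw
    · have h1 : z - w ∈ ball z r := by simpa [dist_eq_norm] using hw
      refine hgw.continuousAt.smul ?_
      exact ContinuousAt.comp (f := fun w => z - w) (g := f)
        (hf.differentiableAt (isOpen_ball.mem_nhds h1)).continuousAt (by fun_prop)
    · have h1 : F =ᶠ[𝓝 w] fun _ => 0 := by
        filter_upwards [(continuous_norm (E := ℂ)).continuousAt.eventually
          (lt_mem_nhds (hδ.trans_le hw))] with v hv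
        exact hF0 v hv.le
      exact (continuousAt_const (y := (0 : ℂ))).congr h1.symm
  have hrot : ∀ θ : ℝ, ∫ w, F (circleMap 0 1 θ * w) = ∫ w, F w := by
    intro θ
    have h1 : MeasurePreserving (rotation (Circle.exp θ)) (volume : Measure ℂ) volume :=
      (rotation (Circle.exp θ)).measurePreserving
    refine Eq.trans ?_ (h1.integral_comp (rotation (Circle.exp θ)).toHomeomorph.measurableEmbedding F)
    refine integral_congr_ae (Eventually.of_forall fun w => ?_)
    simp [rotation_apply, circleMap, Circle.coe_exp]
  have hnorm : ∀ (θ : ℝ) (w : ℂ), ‖circleMap 0 1 θ * w‖ = ‖w‖ := fun θ w => by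
    simp [norm_circleMap_zero]
  have hmean : ∀ w : ℂ, ∫ θ in (0 : ℝ)..2 * Real.pi, F (circleMap 0 1 θ * w) =
      (2 * Real.pi * g ‖w‖) • f z := by
    intro w
    rcases lt_or_ge ‖w‖ δ with hw | hw
    · have hk : DiffContOnCl ℂ (fun ζ => f (z - ζ * w)) (ball 0 |1|) := by
        refine DifferentiableOn.diffContOnCl ?_
        rw [abs_one, closure_ball _ one_ne_zero]
        refine hf.comp (by fun_prop) fun ζ hζ => ?_
        rw [mem_ball, dist_eq_norm, sub_sub_cancel_left, norm_neg, norm_mul]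
        rw [mem_closedBall_zero_iff] at hζ
        nlinarith [norm_nonneg w]
      have h1 := hk.circleAverage
      rw [Real.circleAverage] at h1
      simp only [F, hnorm]
      rw [zero_mul, sub_zero] at h1
      have h2 : ∫ θ in (0 : ℝ)..2 * Real.pi, f (z - circleMap 0 1 θ * w) = (2 * Real.pi) • f z := by
        rw [← h1, smul_smul, mul_inv_cancel₀ (by positivity), one_smul]
      rw [intervalIntegral.integral_smul, h2, smul_smul, mul_comm]
    · have : ∀ θ : ℝ, F (circleMap 0 1 θ * w) = 0 := fun θ => hF0 _ (by rw [hnorm]; exact hw)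
      simp [this, hg0 _ hw]
  -- Averaging the rotation-invariant integral over all rotations and exchanging the integrals
  -- leaves the mean of f over circles around z, which is f z.
  have hswap : ∫ θ in (0 : ℝ)..2 * Real.pi, ∫ w in closedBall (0 : ℂ) δ, F (circleMap 0 1 θ * w) =
      ∫ w in closedBall (0 : ℂ) δ, ∫ θ in (0 : ℝ)..2 * Real.pi, F (circleMap 0 1 θ * w) := by
    refine intervalIntegral_integral_swap ?_
    rw [uIoc_of_le (by positivity), Measure.prod_restrict]
    have hc : Continuous fun p : ℝ × ℂ => F (circleMap 0 1 p.1 * p.2) :=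
      hF.comp (((continuous_circleMap 0 1).comp continuous_fst).mul continuous_snd)
    exact (hc.continuousOn.integrableOn_compact
      (isCompact_Icc.prod (isCompact_closedBall (0 : ℂ) δ))).mono_set
      (prod_mono Ioc_subset_Icc_self Subset.rfl)
  have hcut : ∀ {E : Type} [NormedAddCommGroup E] [NormedSpace ℝ E] (G : ℂ → E),
      (∀ w : ℂ, δ ≤ ‖w‖ → G w = 0) → ∫ w in closedBall (0 : ℂ) δ, G w = ∫ w, G w := by
    intro E _ _ G hG
    refine setIntegral_eq_integral_of_forall_compl_eq_zero fun w hw => hG w ?_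
    rw [mem_closedBall_zero_iff, not_le] at hw; exact hw.le
  have h1 : ∀ θ : ℝ, ∫ w in closedBall (0 : ℂ) δ, F (circleMap 0 1 θ * w) = ∫ w, F w := fun θ => by
    rw [hcut (fun w => F (circleMap 0 1 θ * w)) fun w hw => hF0 _ (by rw [hnorm]; exact hw), hrot]
  simp only [h1, hmean] at hswap
  rw [intervalIntegral.integral_const, sub_zero, integral_smul_const, integral_const_mul,
    hcut (fun w : ℂ => g ‖w‖) fun w hw => hg0 _ hw] at hswap
  refine smul_right_injective ℂ (r := 2 * Real.pi) (by positivity) ?_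
  simp only [mul_smul] at hswap ⊢
  exact hswap

/-- Twice the `∂̄`-derivative of a real function. -/
noncomputable def dbar (φ : ℂ → ℝ) (z : ℂ) : ℂ := fderiv ℝ φ z 1 + Complex.I * fderiv ℝ φ z Complex.I

/-- The regularization of a weakly holomorphic function is holomorphic. -/
lemma differentiableAt_convolution {a : ℂ → ℂ} (ha : LocallyIntegrable a) {c : ℂ} {R : ℝ}
    (h : ∀ φ : ℂ → ℝ, ContDiff ℝ ∞ φ → tsupport φ ⊆ ball c R → ∫ z, dbar φ z * a z = 0)
    {ρ : ℂ → ℝ} (hρ : ContDiff ℝ ∞ ρ) {δ : ℝ} (hρ0 : ∀ w ∉ closedBall (0 : ℂ) δ, ρ w = 0) {z : ℂ}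
    (hz : closedBall z δ ⊆ ball c R) :
    DifferentiableAt ℂ (ρ ⋆[lsmul ℝ ℝ, volume] a) z := by
  set L : ℂ →L[ℝ] ℝ →L[ℝ] ℂ := (lsmul ℝ ℝ : ℝ →L[ℝ] ℂ →L[ℝ] ℂ).flip
  have hflip : ρ ⋆[lsmul ℝ ℝ, volume] a = a ⋆[L, volume] ρ := (convolution_flip _).symm
  have hsupp : tsupport ρ ⊆ closedBall 0 δ := closure_minimal (fun w hw => by
    by_contra hcon; exact hw (hρ0 w hcon)) isClosed_closedBall
  have hcs : HasCompactSupport ρ := (isCompact_closedBall _ _).of_isClosed_subset (isClosed_tsupport ρ) hsupp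
  have hρ1 : ContDiff ℝ 1 ρ := hρ.of_le (by norm_cast)
  have hd := hcs.hasFDerivAt_convolution_right L ha hρ1 z
  rw [hflip, differentiableAt_complex_iff_differentiableAt_real]
  refine ⟨hd.differentiableAt, ?_⟩
  have hDc : Continuous (fderiv ℝ ρ) := hρ1.continuous_fderiv one_ne_zero
  have happ : ∀ v : ℂ, fderiv ℝ (a ⋆[L, volume] ρ) z v = ∫ t, fderiv ℝ ρ (z - t) v • a t := by
    intro v
    rw [hd.fderiv, convolution_precompR_apply L ha (hcs.fderiv ℝ) hDc]
    rfl
  have hint : ∀ v : ℂ, Integrable fun t => fderiv ℝ ρ (z - t) v • a t := by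
    intro v
    have := (hcs.fderiv_apply ℝ v).convolutionExists_right L ha (hDc.clm_apply continuous_const) z
    exact this
  rw [happ, happ]
  -- Tested against this function, the weak equation becomes the Cauchy–Riemann equation of the
  -- convolution at `z`.
  set φ : ℂ → ℝ := fun t => ρ (z - t)
  have hφ : ContDiff ℝ ∞ φ := hρ.comp (contDiff_const.sub contDiff_id)
  have hφd : ∀ t v, fderiv ℝ φ t v = - fderiv ℝ ρ (z - t) v := by
    intro t v
    have h1 : HasFDerivAt (fun t : ℂ => z - t) (-(ContinuousLinearMap.id ℝ ℂ)) t :=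
      (hasFDerivAt_id t).const_sub z
    have h2 := ((hρ1.differentiable one_ne_zero (z - t)).hasFDerivAt.comp t h1).fderiv
    change fderiv ℝ φ t = _ at h2
    rw [h2]; simp
  have hφs : tsupport φ ⊆ ball c R := by
    refine (closure_minimal (fun t ht => ?_) isClosed_closedBall).trans hz
    by_contra hcon
    refine ht (hρ0 _ fun h => hcon ?_)
    rw [mem_closedBall_zero_iff] at h
    rw [mem_closedBall, dist_comm, dist_eq_norm]; exact h
  have h1 := h φ hφ hφs
  have h2 : ∫ t, dbar φ t * a t = -((∫ t, fderiv ℝ ρ (z - t) 1 • a t) +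
      Complex.I * ∫ t, fderiv ℝ ρ (z - t) Complex.I • a t) := by
    rw [← integral_const_mul, ← integral_add (hint 1) ((hint Complex.I).const_mul _), ← integral_neg]
    refine integral_congr_ae (Eventually.of_forall fun t => ?_)
    simp only [dbar, hφd, Complex.real_smul]
    push_cast; ring
  rw [h2, neg_eq_zero] at h1
  rw [eq_neg_of_add_eq_zero_left h1, smul_eq_mul, mul_neg, ← mul_assoc, Complex.I_mul_I]
  ring

/-- Weyl's lemma for the `∂̄`-operator. -/
theorem exists_differentiableOn_ae_eq {a : ℂ → ℂ} (ha : LocallyIntegrable a) {c : ℂ} {R : ℝ}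
    (hR : 0 < R)
    (h : ∀ φ : ℂ → ℝ, ContDiff ℝ ∞ φ → tsupport φ ⊆ ball c R → ∫ z, dbar φ z * a z = 0) :
    ∃ b : ℂ → ℂ, DifferentiableOn ℂ b (ball c (R / 2)) ∧ ∀ᵐ z, z ∈ ball c (R / 2) → a z = b z := by
  -- From the ball of radius R/2, a mean value disc of radius R/4 followed by a kernel of radius R/8
  -- stays inside the ball of radius R.
  set δ := R / 8
  have hδ : 0 < δ := by positivity
  -- a radial kernel
  set g₀ : ℝ → ℝ := fun t => Real.smoothTransition (1 - t / δ ^ 2)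
  have hg₀ : ContDiff ℝ ∞ g₀ := Real.smoothTransition.contDiff.comp (by fun_prop)
  set κ₀ : ℂ → ℝ := fun w => g₀ (‖w‖ ^ 2)
  have hκ₀ : ContDiff ℝ ∞ κ₀ := hg₀.comp (contDiff_norm_sq ℝ)
  have hg₀0 : ∀ t, δ ≤ t → g₀ (t ^ 2) = 0 := fun t ht => by
    refine Real.smoothTransition.zero_of_nonpos ?_
    rw [sub_nonpos, one_le_div (by positivity)]
    exact pow_le_pow_left₀ hδ.le ht 2
  have hκ₀0 : ∀ w ∉ closedBall (0 : ℂ) δ, κ₀ w = 0 := fun w hw => by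
    rw [mem_closedBall_zero_iff, not_le] at hw
    exact hg₀0 _ hw.le
  have hκ₀s : HasCompactSupport κ₀ := HasCompactSupport.intro (isCompact_closedBall (0 : ℂ) δ) hκ₀0
  have hpos : 0 < ∫ w, κ₀ w := by
    refine hκ₀.continuous.integral_pos_of_hasCompactSupport_nonneg_nonzero hκ₀s
      (fun w => Real.smoothTransition.nonneg _) (x := 0) ?_
    have : κ₀ 0 = 1 := by simp [κ₀, g₀, Real.smoothTransition.one]
    rw [this]; exact one_ne_zero
  set C := ∫ w, κ₀ w
  set g : ℝ → ℝ := fun t => C⁻¹ * g₀ (t ^ 2)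
  set κ : ℂ → ℝ := fun w => g ‖w‖
  have hg : Continuous g := continuous_const.mul (hg₀.continuous.comp (continuous_pow 2))
  have hκ : ContDiff ℝ ∞ κ := contDiff_const.mul hκ₀
  have hκ0 : ∀ w ∉ closedBall (0 : ℂ) δ, κ w = 0 := fun w hw => mul_eq_zero_of_right _ (hκ₀0 w hw)
  have hκs : HasCompactSupport κ := HasCompactSupport.intro (isCompact_closedBall (0 : ℂ) δ) hκ0
  have hκ1 : ∫ w, κ w = 1 := by
    simp only [κ, g, integral_const_mul]
    exact inv_mul_cancel₀ hpos.ne'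
  -- For an approximate identity ρ, the function ρ ⋆ a is holomorphic, hence reproduced by the
  -- radial kernel: ρ ⋆ a = κ ⋆ (ρ ⋆ a) = ρ ⋆ b on the half ball. Shrinking ρ gives a = b almost
  -- everywhere there.
  set b : ℂ → ℂ := κ ⋆[lsmul ℝ ℝ, volume] a
  have hbc : Continuous b := hκs.continuous_convolution_left _ hκ.continuous ha
  -- bump functions
  set ψ : ℕ → ContDiffBump (0 : ℂ) := fun n =>
    ⟨δ / (2 * (n + 1)), δ / (n + 1), by positivity, by
      rw [div_lt_div_iff_of_pos_left hδ (by positivity) (by positivity)]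
      have : (0 : ℝ) < n + 1 := by positivity
      linarith⟩
  have hψr : Tendsto (fun n => (ψ n).rOut) atTop (𝓝 0) := by
    have := (tendsto_one_div_add_atTop_nhds_zero_nat (𝕜 := ℝ)).const_mul δ
    rw [mul_zero] at this
    refine this.congr fun n => ?_
    simp only [ψ]; ring
  have hψK : ∀ᶠ n in atTop, (ψ n).rOut ≤ 2 * (ψ n).rIn := Eventually.of_forall fun n => by
    simp only [ψ]
    refine le_of_eq ?_
    field_simp
  have hψδ : ∀ n, (ψ n).rOut ≤ δ := fun n => div_le_self hδ.le (by
    have : (0 : ℝ) ≤ n := Nat.cast_nonneg n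
    linarith)
  have hae := ContDiffBump.ae_convolution_tendsto_right_of_locallyIntegrable (μ := volume) hψr hψK ha
  refine ⟨b, fun z hz => ?_, hae.mono fun z hz hzR => ?_⟩
  · refine (differentiableAt_convolution ha h hκ hκ0 fun w hw => ?_).differentiableWithinAt
    rw [mem_ball] at hz ⊢
    rw [mem_closedBall] at hw
    have := dist_triangle w z c
    simp only [δ] at hw
    linarith
  · refine tendsto_nhds_unique hz ?_
    have h2 := ContDiffBump.convolution_tendsto_right_of_continuous (μ := volume) hψr hbc z
    refine h2.congr fun n => ?_
    set ρ : ℂ → ℝ := (ψ n).normed volume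
    have hρ : ContDiff ℝ ∞ ρ := (ψ n).contDiff_normed
    have hρ0 : ∀ w ∉ closedBall (0 : ℂ) δ, ρ w = 0 := fun w hw => by
      have : ψ n w = 0 := bump_zero (ψ n) fun h => hw (closedBall_subset_closedBall (hψδ n) h)
      simp only [ρ, ContDiffBump.normed_def, this, zero_div]
    have hρs : HasCompactSupport ρ := HasCompactSupport.intro (isCompact_closedBall (0 : ℂ) δ) hρ0
    -- the regularization satisfies the mean value property
    have hmean : (κ ⋆[lsmul ℝ ℝ, volume] (ρ ⋆[lsmul ℝ ℝ, volume] a)) z =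
        (ρ ⋆[lsmul ℝ ℝ, volume] a) z := by
      have h3 := integral_radial_smul (f := ρ ⋆[lsmul ℝ ℝ, volume] a) (z := z) (r := R / 4) (δ := δ)
        (by simp only [δ]; linarith) (fun w hw => by
          refine (differentiableAt_convolution ha h hρ hρ0 fun v hv => ?_).differentiableWithinAt
          rw [mem_ball] at hw hzR ⊢
          rw [mem_closedBall] at hv
          have h4 := dist_triangle v w c
          have h5 := dist_triangle w z c
          simp only [δ] at hv
          linarith) hg (fun t ht => mul_eq_zero_of_right _ (hg₀0 t ht))
      rw [hκ1, one_smul] at h3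
      exact h3
    rw [← hmean]
    -- associativity
    have han : LocallyIntegrable (fun x => ‖a x‖) := fun x => by
      obtain ⟨s, hs, h⟩ := ha x
      exact ⟨s, hs, h.norm⟩
    have hex : ∀ {u v : ℂ → ℝ}, ContDiff ℝ ∞ u → HasCompactSupport u → ContDiff ℝ ∞ v →
        HasCompactSupport v → ((u ⋆[mul ℝ ℝ, volume] v) ⋆[lsmul ℝ ℝ, volume] a) z =
          (u ⋆[lsmul ℝ ℝ, volume] (v ⋆[lsmul ℝ ℝ, volume] a)) z := by
      intro u v hu hus hv hvs
      refine convolution_assoc (mul ℝ ℝ) (lsmul ℝ ℝ) (lsmul ℝ ℝ) (lsmul ℝ ℝ)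
        (fun x y w => by simp [mul_smul]) hu.continuous.aestronglyMeasurable
        hv.continuous.aestronglyMeasurable ha.aestronglyMeasurable
        (Eventually.of_forall fun y => hus.convolutionExists_left (mul ℝ ℝ) hu.continuous
          hv.continuous.locallyIntegrable y)
        (Eventually.of_forall fun y => hvs.norm.convolutionExists_left (mul ℝ ℝ) hv.continuous.norm
          han y) ?_
      refine hus.norm.convolutionExists_left (mul ℝ ℝ) hu.continuous.norm
        (Continuous.locallyIntegrable ?_) z
      exact hvs.norm.continuous_convolution_left (mul ℝ ℝ) hv.continuous.norm han
    rw [← hex hρ hρs hκ hκs, ← hex hκ hκs hρ hρs]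
    congr 1
    have h6 : (ρ ⋆[mul ℝ ℝ, volume] κ) = (κ ⋆[mul ℝ ℝ, volume] ρ) := by
      rw [← convolution_flip]
      congr 1
      ext
      simp
    rw [h6]

end Weyl

/-! ### Measurable frames: forms and areas as functions and a measure on the surface -/

section FrameDef

variable {X : Type*} [TopologicalSpace X] [ChartedSpace ℂ X] [IsManifold 𝓘(ℂ) ω X]
  [MeasurableSpace X]

/-- A measurable choice of one of finitely many charts at every point. -/
structure Frame (X : Type*) [TopologicalSpace X] [ChartedSpace ℂ X] [MeasurableSpace X] where
  t : Finset X
  c : X → X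
  r : X → ℝ
  mem : ∀ x, c x ∈ t
  meas : ∀ i, MeasurableSet (c ⁻¹' {i})
  sub : ∀ i, closedBall (chartAt ℂ i i) (r i) ⊆ (chartAt ℂ i).target
  src : ∀ x, x ∈ (chartAt ℂ (c x)).source
  ball : ∀ x, chartAt ℂ (c x) x ∈ ball (chartAt ℂ (c x) (c x)) (r (c x))

variable [BorelSpace X]

/-- The set inserted last takes priority; `x₀` is only a default value where no set of the family
contains the point. -/
lemma exists_measurable_choice (O : X → Set X) (hO : ∀ i, MeasurableSet (O i)) (x₀ : X)
    (t : Finset X) : ∃ c : X → X, (∀ i, MeasurableSet (c ⁻¹' {i})) ∧ (∀ x, c x = x₀ ∨ c x ∈ t) ∧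
      ∀ x, (∃ i ∈ t, x ∈ O i) → c x ∈ t ∧ x ∈ O (c x) := by
  classical
  induction t using Finset.induction_on with
  | empty =>
    exact ⟨fun _ => x₀, fun i => MeasurableSet.const _, fun _ => Or.inl rfl, by simp⟩
  | insert j t _ ih =>
    obtain ⟨c, h1, h2, h3⟩ := ih
    refine ⟨fun x => if x ∈ O j then j else c x, fun i => ?_, fun x => ?_, fun x hx => ?_⟩
    · have : (fun x => if x ∈ O j then j else c x) ⁻¹' {i} =
          (O j ∩ {_x | j = i}) ∪ ((O j)ᶜ ∩ c ⁻¹' {i}) := by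
        ext x
        by_cases hx : x ∈ O j <;> simp [hx]
      rw [this]
      exact ((hO j).inter (MeasurableSet.const _)).union ((hO j).compl.inter (h1 i))
    · simp only
      split_ifs with h
      · exact Or.inr (Finset.mem_insert_self _ _)
      · exact (h2 x).imp_right (Finset.mem_insert_of_mem)
    · simp only
      split_ifs with h
      · exact ⟨Finset.mem_insert_self _ _, h⟩
      · obtain ⟨i, hi, hxi⟩ := hx
        rcases Finset.mem_insert.1 hi with rfl | hi
        · exact absurd hxi h
        · exact ⟨Finset.mem_insert_of_mem (h3 x ⟨i, hi, hxi⟩).1, (h3 x ⟨i, hi, hxi⟩).2⟩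

lemma exists_frame [CompactSpace X] [Nonempty X] : Nonempty (Frame X) := by
  choose r hr hrt using exists_closedBall_subset_target (X := X)
  set O : X → Set X := fun x => (chartAt ℂ x).source ∩ chartAt ℂ x ⁻¹' ball (chartAt ℂ x x) (r x)
  have hOo : ∀ x, IsOpen (O x) := fun x => (chartAt ℂ x).isOpen_inter_preimage isOpen_ball
  obtain ⟨t, ht⟩ := isCompact_univ.elim_finite_subcover O hOo
    (fun x _ => mem_iUnion.2 ⟨x, mem_chart_source ℂ x, mem_ball_self (hr x)⟩)
  have hcov : ∀ y, ∃ x ∈ t, y ∈ O x := fun y => by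
    simpa only [mem_iUnion, exists_prop] using ht (mem_univ y)
  obtain ⟨c, h1, -, h3⟩ := exists_measurable_choice O (fun i => (hOo i).measurableSet)
    (Classical.arbitrary X) t
  exact ⟨⟨t, c, r, fun x => (h3 x (hcov x)).1, h1, hrt, fun x => (h3 x (hcov x)).2.1,
    fun x => (h3 x (hcov x)).2.2⟩⟩

namespace Frame

variable (Fr : Frame X)

/-- The part of the chart domain at `i` where the chart at `i` is the chosen one. -/
def piece (i : X) : Set ℂ := (chartAt ℂ i).target ∩ (chartAt ℂ i).symm ⁻¹' (Fr.c ⁻¹' {i})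

/-- The part of the chart domain at `x` where the chart at `i` is the chosen one. -/
def part (x i : X) : Set ℂ := (chartAt ℂ x).target ∩ (chartAt ℂ x).symm ⁻¹' (Fr.c ⁻¹' {i})

lemma measurableSet_part (x i : X) : MeasurableSet (Fr.part x i) := by
  have h1 : Measurable ((chartAt ℂ x).target.domRestrict (chartAt ℂ x).symm) :=
    (continuousOn_iff_continuous_domRestrict.1 (chartAt ℂ x).continuousOn_symm).measurable
  have h2 := (chartAt ℂ x).open_target.measurableSet.subtype_image (h1 (Fr.meas i))
  convert h2 using 1
  ext z
  simp [part, and_comm]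

lemma measurableSet_piece (i : X) : MeasurableSet (Fr.piece i) := Fr.measurableSet_part i i

lemma piece_subset_ball (i : X) : Fr.piece i ⊆ Metric.ball (chartAt ℂ i i) (Fr.r i) := by
  rintro z ⟨hz, hzi⟩
  have h1 : Fr.c ((chartAt ℂ i).symm z) = i := hzi
  have := Fr.ball ((chartAt ℂ i).symm z)
  rwa [h1, (chartAt ℂ i).right_inv hz] at this

lemma iUnion_part (x : X) : ⋃ i ∈ Fr.t, Fr.part x i = (chartAt ℂ x).target := by
  ext z
  simp only [part, mem_iUnion, exists_prop]
  exact ⟨fun ⟨i, _, h, _⟩ => h, fun h => ⟨_, Fr.mem _, h, rfl⟩⟩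

lemma pairwiseDisjoint_part (x : X) (s : Set X) : s.PairwiseDisjoint (Fr.part x) := by
  intro i _ j _ hij
  rw [Function.onFun, Set.disjoint_left]
  rintro z ⟨-, h1⟩ ⟨-, h2⟩
  exact hij (h1.symm.trans h2)

/-- The area measure associated with a frame. -/
noncomputable def measure : Measure X :=
  ∑ i ∈ Fr.t, (volume.restrict (Fr.piece i)).map (chartAt ℂ i).symm

lemma aemeasurable_symm (i : X) :
    AEMeasurable (chartAt ℂ i).symm (volume.restrict (Fr.piece i)) :=
  ((chartAt ℂ i).continuousOn_symm.mono inter_subset_left).aemeasurable (Fr.measurableSet_piece i)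

instance : IsFiniteMeasure Fr.measure := by
  have : ∀ i, IsFiniteMeasure (volume.restrict (Fr.piece i)) := fun i =>
    ⟨by rw [Measure.restrict_apply_univ]
        exact (measure_mono (Fr.piece_subset_ball i)).trans_lt measure_ball_lt_top⟩
  unfold measure
  infer_instance

/-- The transition factor from the chosen chart to the chart at `x`. -/
noncomputable def jac (x : X) (z : ℂ) : ℂ :=
  deriv (fun w => chartAt ℂ (Fr.c ((chartAt ℂ x).symm z)) ((chartAt ℂ x).symm w)) z

lemma analyticAt_transition {x i : X} {z : ℂ} (hz : z ∈ (chartAt ℂ x).target)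
    (hi : (chartAt ℂ x).symm z ∈ (chartAt ℂ i).source) :
    AnalyticAt ℂ (fun w => chartAt ℂ i ((chartAt ℂ x).symm w)) z :=
  holAt_iff_analyticAt.1 (HolAt.comp (g := chartAt ℂ i) (f := (chartAt ℂ x).symm)
    (holAt_chartAt hi) (holAt_chartAt_symm hz))

lemma part_src {x i : X} {z : ℂ} (hz : z ∈ Fr.part x i) :
    (chartAt ℂ x).symm z ∈ (chartAt ℂ i).source := by
  have h1 : Fr.c ((chartAt ℂ x).symm z) = i := hz.2
  rw [← h1]; exact Fr.src _

lemma jac_of_mem_part {x i : X} {z : ℂ} (hz : z ∈ Fr.part x i) :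
    Fr.jac x z = deriv (fun w => chartAt ℂ i ((chartAt ℂ x).symm w)) z := by
  have h1 : Fr.c ((chartAt ℂ x).symm z) = i := hz.2
  rw [jac, h1]

lemma image_part (x i : X) : (fun w => chartAt ℂ i ((chartAt ℂ x).symm w)) '' Fr.part x i =
    Fr.piece i ∩ (chartAt ℂ i).symm ⁻¹' (chartAt ℂ x).source := by
  ext z
  constructor
  · rintro ⟨w, hw, rfl⟩
    have h1 := Fr.part_src hw
    refine ⟨⟨(chartAt ℂ i).map_source h1, ?_⟩, ?_⟩
    · simp only [mem_preimage]; rw [(chartAt ℂ i).left_inv h1]; exact hw.2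
    · simp only [mem_preimage]; rw [(chartAt ℂ i).left_inv h1]
      exact (chartAt ℂ x).map_target hw.1
  · rintro ⟨⟨hz1, hz2⟩, hz3⟩
    refine ⟨chartAt ℂ x ((chartAt ℂ i).symm z), ⟨(chartAt ℂ x).map_source hz3, ?_⟩, ?_⟩
    · simp only [mem_preimage]; rw [(chartAt ℂ x).left_inv hz3]; exact hz2
    · simp only; rw [(chartAt ℂ x).left_inv hz3, (chartAt ℂ i).right_inv hz1]

lemma injOn_part (x i : X) :
    InjOn (fun w => chartAt ℂ i ((chartAt ℂ x).symm w)) (Fr.part x i) := fun _ hz _ hw h =>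
  (chartAt ℂ x).symm.injOn hz.1 hw.1 ((chartAt ℂ i).injOn (Fr.part_src hz) (Fr.part_src hw) h)

lemma aestronglyMeasurable_of_part {E : Type*} [TopologicalSpace E] [TopologicalSpace.PseudoMetrizableSpace E] (x : X)
    {G : ℂ → E} (h : ∀ i ∈ Fr.t, AEStronglyMeasurable G (volume.restrict (Fr.part x i))) :
    AEStronglyMeasurable G (volume.restrict (chartAt ℂ x).target) := by
  have h1 : (chartAt ℂ x).target = ⋃ i : Fr.t, Fr.part x i := by
    rw [← Fr.iUnion_part x]; ext; simp
  rw [h1, aestronglyMeasurable_iUnion_iff]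
  exact fun i => h i i.2

variable {E : Type*} [NormedAddCommGroup E] [NormedSpace ℝ E]

/-- Change of variables under the transition from the chart at `x` to the chosen chart `i`, with
Jacobian `‖Fr.jac x z‖ ^ 2`. -/
lemma integrable_comp_part {F : X → E} (hF : Integrable F Fr.measure) (x : X) {i : X} (hi : i ∈ Fr.t) :
    IntegrableOn (fun z => ‖Fr.jac x z‖ ^ 2 • F ((chartAt ℂ x).symm z)) (Fr.part x i) ∧
    ∫ z in Fr.part x i, ‖Fr.jac x z‖ ^ 2 • F ((chartAt ℂ x).symm z) =
      ∫ z in Fr.piece i ∩ (chartAt ℂ i).symm ⁻¹' (chartAt ℂ x).source, F ((chartAt ℂ i).symm z) := by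
  have hFi := integrable_finsetSum_measure.1 hF i hi
  have hFi' : IntegrableOn (fun z => F ((chartAt ℂ i).symm z)) (Fr.piece i) :=
    hFi.comp_aemeasurable (Fr.aemeasurable_symm i)
  set τ : ℂ → ℂ := fun w => chartAt ℂ i ((chartAt ℂ x).symm w)
  have hder : ∀ z ∈ Fr.part x i, HasFDerivWithinAt τ ((fderiv ℂ τ z).restrictScalars ℝ)
      (Fr.part x i) z := fun z hz =>
    ((analyticAt_transition hz.1 (Fr.part_src hz)).differentiableAt.hasFDerivAt.restrictScalars
      ℝ).hasFDerivWithinAt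
  have heq : ∀ z ∈ Fr.part x i, |((fderiv ℂ τ z).restrictScalars ℝ).det| •
      (fun z => F ((chartAt ℂ i).symm z)) (τ z) =
      ‖Fr.jac x z‖ ^ 2 • F ((chartAt ℂ x).symm z) := fun z hz => by
    simp only [τ]
    rw [det_fderiv_real, Fr.jac_of_mem_part hz, (chartAt ℂ i).left_inv (Fr.part_src hz)]
  rw [← Fr.image_part x i]
  constructor
  · refine IntegrableOn.congr_fun ((integrableOn_image_iff_integrableOn_abs_det_fderiv_smul volume
      (Fr.measurableSet_part x i) hder (Fr.injOn_part x i)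
      (fun z => F ((chartAt ℂ i).symm z))).1 ?_) heq (Fr.measurableSet_part x i)
    rw [Fr.image_part x i]
    exact hFi'.mono_set inter_subset_left
  · rw [integral_image_eq_integral_abs_det_fderiv_smul volume (Fr.measurableSet_part x i) hder
      (Fr.injOn_part x i)]
    exact (setIntegral_congr_fun (Fr.measurableSet_part x i) heq).symm

lemma integrableOn_target {F : X → E} (hF : Integrable F Fr.measure) (x : X) :
    IntegrableOn (fun z => ‖Fr.jac x z‖ ^ 2 • F ((chartAt ℂ x).symm z)) (chartAt ℂ x).target := by
  rw [← Fr.iUnion_part x]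
  exact integrableOn_finset_iUnion.2 fun i hi => (Fr.integrable_comp_part hF x hi).1

/-- The integral of a function supported in a chart, computed in the chart. -/
theorem integral_eq_integral_target {F : X → E} (hF : Integrable F Fr.measure) {x : X}
    (h0 : ∀ y ∉ (chartAt ℂ x).source, F y = 0) :
    ∫ y, F y ∂Fr.measure =
      ∫ z in (chartAt ℂ x).target, ‖Fr.jac x z‖ ^ 2 • F ((chartAt ℂ x).symm z) := by
  rw [← Fr.iUnion_part x, integral_biUnion_finset Fr.t (fun i _ => Fr.measurableSet_part x i)
    (Fr.pairwiseDisjoint_part x _) (fun i hi => (Fr.integrable_comp_part hF x hi).1)]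
  have hFi := integrable_finsetSum_measure.1 hF
  rw [measure, integral_finsetSum_measure hFi]
  refine Finset.sum_congr rfl fun i hi => ?_
  rw [(Fr.integrable_comp_part hF x hi).2, integral_map (Fr.aemeasurable_symm i)
    (hFi i hi).aestronglyMeasurable]
  refine setIntegral_eq_of_subset_of_forall_sdiff_eq_zero (Fr.measurableSet_piece i)
    inter_subset_left fun z hz => h0 _ fun h => hz.2 ⟨hz.1, h⟩

end Frame

end FrameDef

/-! ### The ∂-derivative in the plane and orthogonal projection in L² -/

section PlaneForms

/-- Twice the `∂`-derivative of a real function. -/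
noncomputable def del (φ : ℂ → ℝ) (z : ℂ) : ℂ := fderiv ℝ φ z 1 - Complex.I * fderiv ℝ φ z Complex.I

lemma star_del (φ : ℂ → ℝ) (z : ℂ) : star (del φ z) = dbar φ z := by
  simp [del, dbar]

lemma del_congr {u v : ℂ → ℝ} {z : ℂ} (h : u =ᶠ[𝓝 z] v) : del u z = del v z := by
  rw [del, del, h.fderiv_eq]

lemma del_const (c : ℝ) (z : ℂ) : del (fun _ => c) z = 0 := by
  simp [del]

/-- The derivative of `v` is complex linear, so it simply multiplies the (1,0)-part; thus `del`
transforms as the coefficient of a (1,0)-form. -/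
lemma del_comp {u : ℂ → ℝ} {v : ℂ → ℂ} {z : ℂ} (hu : DifferentiableAt ℝ u (v z))
    (hv : AnalyticAt ℂ v z) : del (fun w => u (v w)) z = del u (v z) * deriv v z := by
  have h1 : HasFDerivAt (fun w => u (v w))
      ((fderiv ℝ u (v z)).comp ((fderiv ℂ v z).restrictScalars ℝ)) z :=
    hu.hasFDerivAt.comp z (hv.differentiableAt.hasFDerivAt.restrictScalars ℝ)
  have h2 : ∀ w : ℂ, fderiv ℂ v z w = deriv v z * w := fun w => by
    rw [fderiv_eq_smul_deriv, smul_eq_mul, mul_comm]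
  have h3 : ∀ w : ℂ, fderiv ℝ u (v z) w =
      w.re * fderiv ℝ u (v z) 1 + w.im * fderiv ℝ u (v z) Complex.I := fun w => by
    conv_lhs => rw [← Complex.re_add_im w]
    have e1 : (w.re : ℂ) = w.re • (1 : ℂ) := by simp
    have e2 : (w.im : ℂ) * Complex.I = w.im • Complex.I := by simp
    rw [e1, e2, map_add, map_smul, map_smul, smul_eq_mul, smul_eq_mul]
  rw [del, h1.fderiv]
  simp only [ContinuousLinearMap.comp_apply, ContinuousLinearMap.coe_restrictScalars', h2]
  rw [h3 (deriv v z * 1), h3 (deriv v z * Complex.I), del]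
  apply Complex.ext <;> simp <;> ring

lemma del_re {k : ℂ → ℂ} {z : ℂ} (hk : AnalyticAt ℂ k z) :
    del (fun w => (k w).re) z = deriv k z := by
  have h1 : del (fun w => Complex.reCLM w) (k z) = 1 := by
    rw [del, ContinuousLinearMap.fderiv]; simp
  have h2 := del_comp (u := fun w => Complex.reCLM w) Complex.reCLM.differentiableAt hk
  rw [h1, one_mul] at h2
  exact h2

lemma del_im {k : ℂ → ℂ} {z : ℂ} (hk : AnalyticAt ℂ k z) :
    del (fun w => (k w).im) z = - Complex.I * deriv k z := by
  have h1 : del (fun w => Complex.imCLM w) (k z) = - Complex.I := by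
    rw [del, ContinuousLinearMap.fderiv]; simp
  have h2 := del_comp (u := fun w => Complex.imCLM w) Complex.imCLM.differentiableAt hk
  rw [h1] at h2
  exact h2

lemma del_eq_zero_of_notMem_tsupport {φ : ℂ → ℝ} {z : ℂ} (hz : z ∉ tsupport φ) : del φ z = 0 := by
  have h1 : φ =ᶠ[𝓝 z] fun _ => 0 := notMem_tsupport_iff_eventuallyEq.1 hz
  rw [del_congr h1, del_const]

lemma continuousAt_del {u : ℂ → ℝ} {z : ℂ} (hu : ContDiffAt ℝ 1 u z) : ContinuousAt (del u) z := by
  have h1 : ContinuousAt (fderiv ℝ u) z := (hu.fderiv_right (m := 0) (by norm_num)).continuousAt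
  unfold del
  fun_prop

lemma measurable_del (u : ℂ → ℝ) : Measurable (del u) := by
  unfold del
  have h1 := measurable_fderiv_apply_const ℝ u (1 : ℂ)
  have h2 := measurable_fderiv_apply_const ℝ u Complex.I
  fun_prop

lemma integral_fderiv_eq_zero {g : ℂ → ℝ} (hg : ContDiff ℝ 1 g) (hs : HasCompactSupport g) (v : ℂ) :
    ∫ z, fderiv ℝ g z v = 0 := by
  have h1 : Integrable fun z => fderiv ℝ g z v :=
    ((hg.continuous_fderiv one_ne_zero).clm_apply continuous_const).integrable_of_hasCompactSupport
      (hs.fderiv_apply ℝ v)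
  have h2 := integral_mul_fderiv_eq_neg_fderiv_mul_of_integrable (μ := (volume : Measure ℂ))
    (f := fun _ : ℂ => (1 : ℝ)) (g := g) (v := v) (by simp) (by simpa using h1)
    (by simpa using hg.continuous.integrable_of_hasCompactSupport hs)
    (fun _ _ => by fun_prop) (fun z _ => hg.differentiable one_ne_zero z)
  simpa using h2

/-- The integral of `du ∧ dφ` vanishes when `φ` is a test function. -/
lemma integral_del_del_eq_zero {u φ : ℂ → ℝ} (hφ : ContDiff ℝ ∞ φ) (hs : HasCompactSupport φ)
    (hu : ∀ z ∈ tsupport φ, ContDiffAt ℝ ∞ u z) :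
    ∫ z, (star (del u z) * (Complex.I * del φ z)).re = 0 := by
  have hfs : ∀ v : ℂ, ContDiff ℝ ∞ fun z => fderiv ℝ φ z v := fun v =>
    (hφ.fderiv_right (m := ∞) (by norm_cast)).clm_apply contDiff_const
  have hts : ∀ v : ℂ, tsupport (fun z => fderiv ℝ φ z v) ⊆ tsupport φ := fun v =>
    tsupport_fderiv_apply_subset ℝ v
  have hg : ∀ v : ℂ, ContDiff ℝ 1 (fun z => u z * fderiv ℝ φ z v) := by
    intro v
    rw [contDiff_iff_contDiffAt]
    intro z
    by_cases hz : z ∈ tsupport φ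
    · exact ((hu z hz).of_le (by norm_cast)).mul ((hfs v).of_le (by norm_cast)).contDiffAt
    · have h1 : (fun z => fderiv ℝ φ z v) =ᶠ[𝓝 z] fun _ => 0 :=
        notMem_tsupport_iff_eventuallyEq.1 fun h => hz (hts v h)
      have h2 : (fun z => u z * fderiv ℝ φ z v) =ᶠ[𝓝 z] fun _ => 0 :=
        h1.mono fun w hw => by simp only [hw, mul_zero]
      exact contDiffAt_const.congr_of_eventuallyEq h2
  have hgs : ∀ v : ℂ, HasCompactSupport (fun z => u z * fderiv ℝ φ z v) := fun v =>
    (hs.fderiv_apply ℝ v).mul_left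
  have hint : ∀ v w : ℂ, Integrable fun z => fderiv ℝ (fun z => u z * fderiv ℝ φ z v) z w := fun v w =>
    (((hg v).continuous_fderiv one_ne_zero).clm_apply continuous_const).integrable_of_hasCompactSupport
      ((hgs v).fderiv_apply ℝ w)
  -- By symmetry of the second derivatives of φ, u_x φ_y - u_y φ_x = (u φ_y)_x - (u φ_x)_y, an exact
  -- derivative.
  have hexp : ∀ z, (star (del u z) * (Complex.I * del φ z)).re =
      fderiv ℝ (fun z => u z * fderiv ℝ φ z Complex.I) z 1 -
      fderiv ℝ (fun z => u z * fderiv ℝ φ z 1) z Complex.I := by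
    intro z
    have h0 : (star (del u z) * (Complex.I * del φ z)).re =
        fderiv ℝ u z 1 * fderiv ℝ φ z Complex.I - fderiv ℝ u z Complex.I * fderiv ℝ φ z 1 := by
      simp [del]
    by_cases hz : z ∈ tsupport φ
    · have h1 : ∀ v, fderiv ℝ (fun z => u z * fderiv ℝ φ z v) z =
          u z • fderiv ℝ (fun z => fderiv ℝ φ z v) z + fderiv ℝ φ z v • fderiv ℝ u z := fun v =>
        fderiv_fun_mul ((hu z hz).differentiableAt (by simp))
          ((hfs v).differentiable (by simp) z)
      have h2 : ∀ v w : ℂ, fderiv ℝ (fun z => fderiv ℝ φ z v) z w = fderiv ℝ (fderiv ℝ φ) z w v := by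
        intro v w
        have h3 : DifferentiableAt ℝ (fderiv ℝ φ) z :=
          (hφ.fderiv_right (m := 1) (by norm_cast)).differentiable one_ne_zero z
        rw [fderiv_clm_apply h3 (differentiableAt_const v)]
        simp
      have h4 : fderiv ℝ (fderiv ℝ φ) z 1 Complex.I = fderiv ℝ (fderiv ℝ φ) z Complex.I 1 :=
        (hφ.contDiffAt.isSymmSndFDerivAt (by simp; norm_cast)) 1 Complex.I
      rw [h0, h1, h1]
      simp only [add_apply, smul_apply, smul_eq_mul, h2, h4]
      ring
    · have h1 : ∀ v : ℂ, (fun z => u z * fderiv ℝ φ z v) =ᶠ[𝓝 z] fun _ => 0 := fun v => by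
        have h1 : (fun z => fderiv ℝ φ z v) =ᶠ[𝓝 z] fun _ => 0 :=
          notMem_tsupport_iff_eventuallyEq.1 fun h => hz (hts v h)
        exact h1.mono fun w hw => by simp only [hw, mul_zero]
      rw [(h1 1).fderiv_eq, (h1 Complex.I).fderiv_eq, del_eq_zero_of_notMem_tsupport hz]
      simp
  simp only [hexp]
  rw [integral_sub (hint _ _) (hint _ _), integral_fderiv_eq_zero (hg _) (hgs _),
    integral_fderiv_eq_zero (hg _) (hgs _), sub_zero]

end PlaneForms

section Projection

open scoped InnerProductSpace

/-- The orthogonal projection on the closed span of a set. -/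
lemma exists_projection_span {H : Type*} [NormedAddCommGroup H] [InnerProductSpace ℝ H]
    [CompleteSpace H] (S : Set H) (θ : H) :
    ∃ a : H, (∀ s ∈ S, ⟪s, θ - a⟫_ℝ = 0) ∧ ∀ v, (∀ s ∈ S, ⟪s, v⟫_ℝ = 0) → ⟪a, v⟫_ℝ = 0 := by
  set K := (Submodule.span ℝ S).topologicalClosure
  have hK : IsClosed (K : Set H) := Submodule.isClosed_topologicalClosure _
  have : CompleteSpace K := hK.completeSpace_coe
  refine ⟨K.starProjection θ, fun s hs => ?_, fun v hv => ?_⟩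
  · exact (Submodule.mem_orthogonal K _).1 (K.sub_starProjection_mem_orthogonal θ) s
      (Submodule.le_topologicalClosure _ (Submodule.subset_span hs))
  · have h1 : v ∈ (Submodule.span ℝ S)ᗮ := by
      rw [Submodule.mem_orthogonal]
      intro u hu
      induction hu using Submodule.span_induction with
      | mem x hx => exact hv x hx
      | zero => exact inner_zero_left _
      | add x y _ _ hx hy => rw [inner_add_left, hx, hy, add_zero]
      | smul c x _ hx => rw [real_inner_smul_left, hx, mul_zero]
    rw [← Submodule.orthogonal_closure] at h1
    exact (Submodule.mem_orthogonal K v).1 h1 _ (K.starProjection_apply_mem θ)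

/-- `a` is the projection of `θ` on the closed real span of the `d i` in L², for the real inner
product Re(conj f · g). The last clause says that `a` lies in that closed span. -/
lemma exists_projection_memLp {α : Type*} [MeasurableSpace α] {μ : Measure α} {ι : Type*}
    {d : ι → α → ℂ} (hd : ∀ i, MemLp (d i) 2 μ) {θ : α → ℂ} (hθ : MemLp θ 2 μ) :
    ∃ a : α → ℂ, StronglyMeasurable a ∧ MemLp a 2 μ ∧
      (∀ i, ∫ x, (star (d i x) * (θ x - a x)).re ∂μ = 0) ∧
      ∀ v : α → ℂ, MemLp v 2 μ → (∀ i, ∫ x, (star (d i x) * v x).re ∂μ = 0) →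
        ∫ x, (star (a x) * v x).re ∂μ = 0 := by
  have hin : ∀ f g : Lp ℂ 2 μ, ⟪f, g⟫_ℝ = ∫ x, (star (f x) * g x).re ∂μ := fun f g => by
    rw [L2.inner_def]
    refine integral_congr_ae (Eventually.of_forall fun x => ?_)
    simp only [Complex.inner]
    rw [mul_comm]; rfl
  obtain ⟨a, h1, h2⟩ := exists_projection_span (range fun i => (hd i).toLp (d i)) (hθ.toLp θ)
  refine ⟨a, Lp.stronglyMeasurable a, Lp.memLp a, fun i => ?_, fun v hv h => ?_⟩
  · have h3 := h1 _ ⟨i, rfl⟩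
    rw [hin] at h3
    rw [← h3]
    refine integral_congr_ae ?_
    filter_upwards [(hd i).coeFn_toLp, hθ.coeFn_toLp, Lp.coeFn_sub (hθ.toLp θ) a] with x e1 e2 e3
    rw [e1, e3, Pi.sub_apply, e2]
  · have h3 := h2 (hv.toLp v) (by
      rintro _ ⟨i, rfl⟩
      rw [hin, ← h i]
      refine integral_congr_ae ?_
      filter_upwards [(hd i).coeFn_toLp, hv.coeFn_toLp] with x e1 e2
      rw [e1, e2])
    rw [hin] at h3
    rw [← h3]
    refine integral_congr_ae ?_
    filter_upwards [hv.coeFn_toLp] with x e2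
    rw [e2]

end Projection

/-! ### Exact forms on the surface and the weak Cauchy–Riemann equation -/

section Forms

variable {X : Type*} [TopologicalSpace X] [ChartedSpace ℂ X] [IsManifold 𝓘(ℂ) ω X]
  [MeasurableSpace X] [BorelSpace X]

namespace Frame

variable (Fr : Frame X)

/-- The coefficient, in the frame, of the `(1,0)`-part of twice the differential of `ψ`. -/
noncomputable def dX (ψ : X → ℝ) (y : X) : ℂ :=
  del (fun w => ψ ((chartAt ℂ (Fr.c y)).symm w)) (chartAt ℂ (Fr.c y) y)

lemma tendsto_symm_of_mem {x y : X} (hy : y ∈ (chartAt ℂ x).source) :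
    Tendsto (chartAt ℂ x).symm (𝓝 (chartAt ℂ x y)) (𝓝 y) := by
  have := (chartAt ℂ x).continuousAt_symm ((chartAt ℂ x).map_source hy)
  rwa [ContinuousAt, (chartAt ℂ x).left_inv hy] at this

lemma dX_congr {ψ ψ' : X → ℝ} {y : X} (h : ψ =ᶠ[𝓝 y] ψ') : Fr.dX ψ y = Fr.dX ψ' y :=
  del_congr ((tendsto_symm_of_mem (Fr.src y)).eventually h)

lemma dX_const (c : ℝ) (y : X) : Fr.dX (fun _ => c) y = 0 := del_const c _

/-- The factor `Fr.jac` converts a coefficient in the chosen chart into the coefficient in the chart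
at `x`. -/
lemma dX_mul_jac {ψ : X → ℝ} {x : X} {z : ℂ} (hz : z ∈ (chartAt ℂ x).target)
    (hψ : SmoothAt ⊤ ψ ((chartAt ℂ x).symm z)) :
    Fr.dX ψ ((chartAt ℂ x).symm z) * Fr.jac x z = del (fun w => ψ ((chartAt ℂ x).symm w)) z := by
  set y := (chartAt ℂ x).symm z with hy
  have hs := Fr.src y
  have hτ := analyticAt_transition hz hs
  have h1 : (chartAt ℂ (Fr.c y)).symm (chartAt ℂ (Fr.c y) y) = y := (chartAt ℂ (Fr.c y)).left_inv hs
  have hu : DifferentiableAt ℝ (fun w => ψ ((chartAt ℂ (Fr.c y)).symm w)) (chartAt ℂ (Fr.c y) y) :=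
    (SmoothAt.comp_curve (by rwa [h1])
      (holAt_chartAt_symm ((chartAt ℂ (Fr.c y)).map_source hs))).differentiableAt (by simp)
  have h2 := del_comp (v := fun w => chartAt ℂ (Fr.c y) ((chartAt ℂ x).symm w)) (z := z) hu hτ
  rw [dX, jac, ← hy]
  rw [← hy] at h2
  rw [← h2]
  refine del_congr ?_
  have h3 : ∀ᶠ w in 𝓝 z, (chartAt ℂ x).symm w ∈ (chartAt ℂ (Fr.c y)).source :=
    ((chartAt ℂ x).continuousAt_symm hz).eventually ((chartAt ℂ (Fr.c y)).open_source.mem_nhds hs)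
  filter_upwards [h3] with w hw
  rw [(chartAt ℂ (Fr.c y)).left_inv hw]

lemma measurable_dX (ψ : X → ℝ) : Measurable (Fr.dX ψ) := by
  classical
  have h1 : ∀ i, Measurable ((Fr.c ⁻¹' {i}).indicator
      fun y => del (fun w => ψ ((chartAt ℂ i).symm w)) (chartAt ℂ i y)) := fun i => by
    have h2 : Measurable ((chartAt ℂ i).source.piecewise (chartAt ℂ i) fun _ => 0) :=
      (chartAt ℂ i).continuousOn.measurable_piecewise continuousOn_const
        (chartAt ℂ i).open_source.measurableSet
    have h4 := ((measurable_del (fun w => ψ ((chartAt ℂ i).symm w))).comp h2).indicator (Fr.meas i)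
    convert h4 using 1
    refine indicator_congr fun y hy => ?_
    have h5 : y ∈ (chartAt ℂ i).source := (show Fr.c y = i from hy) ▸ Fr.src y
    simp only [Function.comp_apply, piecewise_eq_of_mem _ _ _ h5]
  have h3 : Fr.dX ψ = fun y => ∑ i ∈ Fr.t, (Fr.c ⁻¹' {i}).indicator
      (fun y => del (fun w => ψ ((chartAt ℂ i).symm w)) (chartAt ℂ i y)) y := by
    funext y
    rw [Finset.sum_eq_single_of_mem (Fr.c y) (Fr.mem y)]
    · rw [indicator_of_mem (by simp)]; rfl
    · intro i _ hi
      exact indicator_of_notMem (by simpa using hi.symm) _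
  rw [h3]
  exact Finset.measurable_fun_sum _ fun i _ => h1 i

lemma exists_bound_dX {ψ : X → ℝ} (hψ : SmoothFn ψ) : ∃ C, ∀ y, ‖Fr.dX ψ y‖ ≤ C := by
  have h1 : ∀ i : X, ∃ C, ∀ z ∈ closedBall (chartAt ℂ i i) (Fr.r i),
      ‖del (fun w => ψ ((chartAt ℂ i).symm w)) z‖ ≤ C := fun i =>
    (isCompact_closedBall _ _).exists_bound_of_continuousOn fun z hz =>
      (continuousAt_del (((hψ _).comp_curve (holAt_chartAt_symm (Fr.sub i hz))).of_le
        (by norm_cast))).continuousWithinAt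
  choose C hC using h1
  obtain ⟨B, hB⟩ := (Fr.t.finite_toSet.image C).bddAbove
  refine ⟨B, fun y => (hC (Fr.c y) _ (ball_subset_closedBall (Fr.ball y))).trans ?_⟩
  exact hB ⟨_, Fr.mem y, rfl⟩

lemma memLp_dX {ψ : X → ℝ} (hψ : SmoothFn ψ) : MemLp (Fr.dX ψ) 2 Fr.measure := by
  obtain ⟨C, hC⟩ := Fr.exists_bound_dX hψ
  exact MemLp.of_bound (Fr.measurable_dX ψ).aestronglyMeasurable C (Eventually.of_forall hC)

variable [T2Space X]

/-- A test function on `X` supported in a chart domain. -/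
structure IsTest (x : X) (φ : ℂ → ℝ) : Prop where
  smooth : ContDiff ℝ ∞ φ
  compact : HasCompactSupport φ
  sub : tsupport φ ⊆ (chartAt ℂ x).target

lemma IsTest.smoothFn {x : X} {φ : ℂ → ℝ} (h : IsTest x φ) : SmoothFn (chartExt x φ) :=
  smoothFn_chartExt h.compact h.sub (fun _ hz => image_eq_zero_of_notMem_tsupport hz) h.smooth

lemma IsTest.dX_eq_zero {x : X} {φ : ℂ → ℝ} (h : IsTest x φ) {y : X}
    (hy : y ∉ (chartAt ℂ x).symm '' tsupport φ) : Fr.dX (chartExt x φ) y = 0 := by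
  have h1 := chartExt_eventually_zero (x := x) (v := φ) h.compact h.sub
    (fun _ hz => image_eq_zero_of_notMem_tsupport hz) hy
  rw [Fr.dX_congr (ψ' := fun _ => 0) h1, dX_const]

lemma chartExt_symm_eventuallyEq {E : Type*} [NormedAddCommGroup E] [NormedSpace ℝ E]
    {x : X} {φ : ℂ → E} {z : ℂ}
    (hz : z ∈ (chartAt ℂ x).target) : (fun w => chartExt x φ ((chartAt ℂ x).symm w)) =ᶠ[𝓝 z] φ := by
  filter_upwards [(chartAt ℂ x).open_target.mem_nhds hz] with w hw
  rw [chartExt_of_mem _ ((chartAt ℂ x).map_target hw), (chartAt ℂ x).right_inv hw]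

lemma IsTest.dX_mul_jac {x : X} {φ : ℂ → ℝ} (h : IsTest x φ) {z : ℂ}
    (hz : z ∈ (chartAt ℂ x).target) :
    Fr.dX (chartExt x φ) ((chartAt ℂ x).symm z) * Fr.jac x z = del φ z := by
  rw [Fr.dX_mul_jac hz (h.smoothFn _), del_congr (chartExt_symm_eventuallyEq hz)]

lemma IsTest.setIntegral {x : X} {φ : ℂ → ℝ} (h : IsTest x φ) {E : Type*} [NormedAddCommGroup E]
    [NormedSpace ℝ E] {F : X → E} {G : ℂ → E} (hF : Integrable F Fr.measure)
    (h0 : ∀ y, Fr.dX (chartExt x φ) y = 0 → F y = 0)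
    (hG : ∀ z ∈ (chartAt ℂ x).target, ‖Fr.jac x z‖ ^ 2 • F ((chartAt ℂ x).symm z) = G z) :
    ∫ y, F y ∂Fr.measure = ∫ z in (chartAt ℂ x).target, G z := by
  rw [Fr.integral_eq_integral_target hF (x := x)]
  · exact setIntegral_congr_fun (chartAt ℂ x).open_target.measurableSet hG
  · intro y hy
    refine h0 y (h.dX_eq_zero Fr ?_)
    rintro ⟨z, hz, rfl⟩
    exact hy ((chartAt ℂ x).map_target (h.sub hz))

lemma integrable_mul {f g : X → ℂ} (hf : MemLp f 2 Fr.measure) (hg : MemLp g 2 Fr.measure) :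
    Integrable (fun y => f y * g y) Fr.measure := hf.integrable_mul hg

lemma memLp_star {f : X → ℂ} (hf : MemLp f 2 Fr.measure) :
    MemLp (fun y => star (f y)) 2 Fr.measure := hf.star

/-- Multiplying a (1,0)-coefficient by i amounts to the Hodge star, up to sign, on the real form it
represents. So exact forms are orthogonal to the star of d of a test function. -/
lemma integral_curl {x : X} {φ : ℂ → ℝ} (h : IsTest x φ) {u : X → ℝ} (hu : SmoothFn u) :
    ∫ y, (star (Fr.dX u y) * (Complex.I * Fr.dX (chartExt x φ) y)).re ∂Fr.measure = 0 := by
  have hi : Integrable (fun y => star (Fr.dX u y) * (Complex.I * Fr.dX (chartExt x φ) y)) Fr.measure :=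
    Fr.integrable_mul (Fr.memLp_star (Fr.memLp_dX hu)) ((Fr.memLp_dX h.smoothFn).const_mul _)
  rw [h.setIntegral Fr (F := fun y => (star (Fr.dX u y) * (Complex.I * Fr.dX (chartExt x φ) y)).re)
    (G := fun z => (star (del (fun w => u ((chartAt ℂ x).symm w)) z) * (Complex.I * del φ z)).re)
    hi.re]
  · rw [setIntegral_eq_integral_of_forall_compl_eq_zero]
    · exact integral_del_del_eq_zero h.smooth h.compact fun z hz =>
        (hu _).comp_curve (holAt_chartAt_symm (h.sub hz))
    · intro z hz
      rw [del_eq_zero_of_notMem_tsupport fun h' => hz (h.sub h')]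
      simp
  · intro y hy
    rw [hy]; simp
  · intro z hz
    rw [← Fr.dX_mul_jac hz (hu _), ← h.dX_mul_jac Fr hz, ← Complex.normSq_eq_norm_sq]
    simp [Complex.normSq_apply]
    ring

/-- The weak Cauchy-Riemann equation for an orthogonal projection on the exact forms. -/
lemma weak_equation {θ a : X → ℂ} (hθ : MemLp θ 2 Fr.measure) (ha : MemLp a 2 Fr.measure)
    (hA : ∀ u : X → ℝ, SmoothFn u → ∫ y, (star (Fr.dX u y) * (θ y - a y)).re ∂Fr.measure = 0)
    (hB : ∀ v : X → ℂ, MemLp v 2 Fr.measure →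
      (∀ u : X → ℝ, SmoothFn u → ∫ y, (star (Fr.dX u y) * v y).re ∂Fr.measure = 0) →
      ∫ y, (star (a y) * v y).re ∂Fr.measure = 0)
    {x : X} {φ : ℂ → ℝ} (h : IsTest x φ) {s t : X → ℝ} (hs : SmoothFn s) (ht : SmoothFn t)
    (hst : ∀ z ∈ tsupport φ, θ ((chartAt ℂ x).symm z) =
      Fr.dX s ((chartAt ℂ x).symm z) - Complex.I * Fr.dX t ((chartAt ℂ x).symm z)) :
    ∫ z in (chartAt ℂ x).target, dbar φ z * (a ((chartAt ℂ x).symm z) * Fr.jac x z -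
      del (fun w => s ((chartAt ℂ x).symm w)) z) = 0 := by
  set D := Fr.dX (chartExt x φ)
  have hD : MemLp D 2 Fr.measure := Fr.memLp_dX h.smoothFn
  have hDs := Fr.memLp_star hD
  have hs2 := Fr.memLp_dX hs
  have ht2 := Fr.memLp_dX ht
  have hi : Integrable (fun y => star (D y) * (a y - Fr.dX s y)) Fr.measure :=
    Fr.integrable_mul hDs (ha.sub hs2)
  have hint : ∀ f : X → ℂ, MemLp f 2 Fr.measure →
      Integrable (fun y => (star (f y) * (Complex.I * D y)).re) Fr.measure := fun f hf =>
    (Fr.integrable_mul (Fr.memLp_star hf) (hD.const_mul _)).re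
  -- i·D is orthogonal to all exact forms, hence to `a`, which lies in their closure.
  have e1 : ∫ y, (star (a y) * (Complex.I * D y)).re ∂Fr.measure = 0 :=
    hB _ (hD.const_mul _) fun u hu => Fr.integral_curl h hu
  have e2 := Fr.integral_curl h hs
  have e3 := Fr.integral_curl h ht
  have e4 := hA _ h.smoothFn
  -- The imaginary part only needs that both `a` and the differential of `s` are orthogonal to i·D.
  have him : ∫ y, (star (D y) * (a y - Fr.dX s y)).im ∂Fr.measure = 0 := by
    have h1 : ∀ y, (star (D y) * (a y - Fr.dX s y)).im = (star (a y) * (Complex.I * D y)).re -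
        (star (Fr.dX s y) * (Complex.I * D y)).re := fun y => by
      simp; ring
    simp only [h1]
    rw [integral_sub (hint _ ha) (hint _ hs2), e1]
    simp only [D]
    rw [e2, sub_zero]
  -- On the support, a - ds = -(θ - a) - i dt: the first term is orthogonal to exact forms, the
  -- second is a curl term.
  have hre : ∫ y, (star (D y) * (a y - Fr.dX s y)).re ∂Fr.measure = 0 := by
    have h1 : ∀ y, (star (D y) * (a y - Fr.dX s y)).re = (star (Fr.dX t y) * (Complex.I * D y)).re -
        (star (D y) * (θ y - a y)).re := fun y => by
      by_cases hy : y ∈ (chartAt ℂ x).symm '' tsupport φ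
      · obtain ⟨z, hz, rfl⟩ := hy
        rw [hst z hz]
        simp; ring
      · simp [D, h.dX_eq_zero Fr hy]
    simp only [h1]
    have h2 : Integrable (fun y => (star (D y) * (θ y - a y)).re) Fr.measure :=
      (Fr.integrable_mul hDs (hθ.sub ha)).re
    rw [integral_sub (hint _ ht2) h2, e4]
    simp only [D]
    rw [e3, sub_zero]
  have h0 : ∫ y, star (D y) * (a y - Fr.dX s y) ∂Fr.measure = 0 := by
    apply Complex.ext
    · exact (integral_re hi).symm.trans hre
    · exact (integral_im hi).symm.trans him
  rw [← h0, h.setIntegral Fr hi]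
  · intro y hy
    simp [D, hy]
  · intro z hz
    rw [← Fr.dX_mul_jac hz (hs _), ← star_del, ← h.dX_mul_jac Fr hz, ← Complex.normSq_eq_norm_sq,
      Complex.real_smul, Complex.normSq_eq_conj_mul_self, star_mul']
    simp only [D, Complex.star_def]
    ring

lemma aestronglyMeasurable_mul_jac {a : X → ℂ} (ha : StronglyMeasurable a) (x : X) :
    AEStronglyMeasurable (fun z => a ((chartAt ℂ x).symm z) * Fr.jac x z)
      (volume.restrict (chartAt ℂ x).target) := by
  refine Fr.aestronglyMeasurable_of_part x fun i _ => ?_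
  have h1 : AEMeasurable (chartAt ℂ x).symm (volume.restrict (Fr.part x i)) :=
    ((chartAt ℂ x).continuousOn_symm.mono inter_subset_left).aemeasurable (Fr.measurableSet_part x i)
  have h2 : AEStronglyMeasurable (fun z => a ((chartAt ℂ x).symm z)) (volume.restrict (Fr.part x i)) :=
    (ha.measurable.comp_aemeasurable h1).aestronglyMeasurable
  have h3 : Measurable (deriv fun w => chartAt ℂ i ((chartAt ℂ x).symm w)) := measurable_deriv _
  refine (h2.mul h3.aestronglyMeasurable).congr ?_
  filter_upwards [ae_restrict_mem (Fr.measurableSet_part x i)] with z hz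
  rw [Fr.jac_of_mem_part hz]
  rfl

/-- The L² norm of a form is the same in every chart, and L² is contained in L¹ on a set of finite
area. -/
lemma integrableOn_mul_jac {a : X → ℂ} (ha : StronglyMeasurable a) (ha2 : MemLp a 2 Fr.measure)
    {x : X} {B : Set ℂ} (hBt : B ⊆ (chartAt ℂ x).target) (hBf : volume B ≠ ⊤) :
    IntegrableOn (fun z => a ((chartAt ℂ x).symm z) * Fr.jac x z) B := by
  have h1 := (Fr.integrableOn_target (ha2.integrable_norm_pow (by norm_num)) x).mono_set hBt
  have : Fact (volume B < ⊤) := ⟨hBf.lt_top⟩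
  have h2 : MemLp (fun z => a ((chartAt ℂ x).symm z) * Fr.jac x z) 2 (volume.restrict B) := by
    rw [memLp_two_iff_integrable_sq_norm
      ((Fr.aestronglyMeasurable_mul_jac ha x).mono_set hBt)]
    refine h1.congr (Eventually.of_forall fun z => ?_)
    simp [mul_pow, mul_comm]
  exact h2.integrable (by norm_num)

/-- Weyl's lemma applied to the weak equation, after cutting the coefficient off outside a closed
chart ball. -/
lemma exists_local_representative {θ a : X → ℂ} (hθ : MemLp θ 2 Fr.measure)
    (ha0 : StronglyMeasurable a) (ha : MemLp a 2 Fr.measure)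
    (hA : ∀ u : X → ℝ, SmoothFn u → ∫ y, (star (Fr.dX u y) * (θ y - a y)).re ∂Fr.measure = 0)
    (hB : ∀ v : X → ℂ, MemLp v 2 Fr.measure →
      (∀ u : X → ℝ, SmoothFn u → ∫ y, (star (Fr.dX u y) * v y).re ∂Fr.measure = 0) →
      ∫ y, (star (a y) * v y).re ∂Fr.measure = 0)
    {x : X} {R : ℝ} (hR : 0 < R) (hRt : closedBall (chartAt ℂ x x) R ⊆ (chartAt ℂ x).target)
    {s t : X → ℝ} (hs : SmoothFn s) (ht : SmoothFn t)
    (hst : ∀ z ∈ Metric.ball (chartAt ℂ x x) R, θ ((chartAt ℂ x).symm z) =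
      Fr.dX s ((chartAt ℂ x).symm z) - Complex.I * Fr.dX t ((chartAt ℂ x).symm z)) :
    ∃ b : ℂ → ℂ, DifferentiableOn ℂ b (Metric.ball (chartAt ℂ x x) (R / 2)) ∧
      ∀ᵐ z, z ∈ Metric.ball (chartAt ℂ x x) (R / 2) → a ((chartAt ℂ x).symm z) * Fr.jac x z -
        del (fun w => s ((chartAt ℂ x).symm w)) z = b z := by
  set F : ℂ → ℂ := fun z => a ((chartAt ℂ x).symm z) * Fr.jac x z -
        del (fun w => s ((chartAt ℂ x).symm w)) z
  have hF : IntegrableOn F (closedBall (chartAt ℂ x x) R) := by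
    refine (Fr.integrableOn_mul_jac ha0 ha hRt
      measure_closedBall_lt_top.ne).sub ?_
    refine ContinuousOn.integrableOn_compact (isCompact_closedBall _ _) fun z hz => ?_
    exact (continuousAt_del (((hs _).comp_curve (holAt_chartAt_symm (hRt hz))).of_le
        (by norm_cast))).continuousWithinAt
  have hFi := hF.integrable_indicator measurableSet_closedBall
  obtain ⟨b, hb, hab⟩ := exists_differentiableOn_ae_eq hFi.locallyIntegrable hR (by
    intro φ hφ hφs
    have hT : IsTest x φ := ⟨hφ, (isCompact_closedBall _ R).of_isClosed_subset
      (isClosed_tsupport φ) (hφs.trans ball_subset_closedBall),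
      (hφs.trans ball_subset_closedBall).trans hRt⟩
    rw [← Fr.weak_equation hθ ha hA hB hT hs ht fun z hz => hst z (hφs hz)]
    rw [← setIntegral_eq_integral_of_forall_compl_eq_zero (s := (chartAt ℂ x).target)]
    · refine setIntegral_congr_fun (chartAt ℂ x).open_target.measurableSet fun z _ => ?_
      by_cases hz : z ∈ closedBall (chartAt ℂ x x) R
      · simp only [indicator_of_mem hz, F]
      · have : del φ z = 0 := del_eq_zero_of_notMem_tsupport fun h => hz (ball_subset_closedBall (hφs h))
        simp only [← star_del, this, star_zero, zero_mul]
    · intro z hz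
      have : del φ z = 0 := del_eq_zero_of_notMem_tsupport fun h => hz (hT.sub h)
      rw [← star_del, this, star_zero, zero_mul])
  refine ⟨b, hb, ?_⟩
  filter_upwards [hab] with z hz hzb
  rw [← hz hzb, indicator_of_mem]
  exact (ball_subset_closedBall.trans (closedBall_subset_closedBall (half_le_self hR.le))) hzb

end Frame

end Forms

/-! ### A meromorphic form with a single double pole -/

section MeromorphicForm

variable {X : Type*} [TopologicalSpace X] [ChartedSpace ℂ X] [IsManifold 𝓘(ℂ) ω X]

/-- The coefficient of a form in a parametrization `k`; the value of the form at a point is recorded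
in the preferred chart at this point. -/
noncomputable def coef (η : X → ℂ) (k : ℂ → X) (z : ℂ) : ℂ :=
  η (k z) * deriv (fun w => chartAt ℂ (k z) (k w)) z

variable [MeasurableSpace X] [BorelSpace X]

/-- Change of charts preserves null sets. -/
lemma ae_transition {P : ℂ → Prop} (hP : ∀ᵐ z, P z) (x y : X) :
    ∀ᵐ w, w ∈ (chartAt ℂ x).target → (chartAt ℂ x).symm w ∈ (chartAt ℂ y).source →
      P (chartAt ℂ y ((chartAt ℂ x).symm w)) := by
  set V : Set ℂ := {z | ¬ P z} ∩ {z | z ∈ (chartAt ℂ y).target ∧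
    (chartAt ℂ y).symm z ∈ (chartAt ℂ x).source}
  have hV : volume V = 0 := measure_mono_null inter_subset_left (ae_iff.1 hP)
  have h1 : volume ((fun z => chartAt ℂ x ((chartAt ℂ y).symm z)) '' V) = 0 :=
    addHaar_image_eq_zero_of_differentiableOn_of_addHaar_eq_zero volume
      (fun z hz => ((Frame.analyticAt_transition hz.2.1
        hz.2.2).differentiableAt.restrictScalars ℝ).differentiableWithinAt) hV
  refine ae_iff.2 (measure_mono_null ?_ h1)
  intro w hw
  simp only [mem_ofPred_eq, Classical.not_imp] at hw
  obtain ⟨hw1, hw2, hw3⟩ := hw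
  refine ⟨chartAt ℂ y ((chartAt ℂ x).symm w), ⟨hw3, (chartAt ℂ y).map_source hw2, ?_⟩, ?_⟩
  · rw [(chartAt ℂ y).left_inv hw2]; exact (chartAt ℂ x).map_target hw1
  · simp only
    rw [(chartAt ℂ y).left_inv hw2, (chartAt ℂ x).right_inv hw1]

/-- A set of full measure is dense; this upgrades almost everywhere identities between continuous
representatives to pointwise ones. -/
lemma eq_of_ae_eq {P : ℂ → Prop} (hP : ∀ᵐ z, P z) {f g : ℂ → ℂ} {z : ℂ}
    (h : ∀ᶠ w in 𝓝 z, P w → f w = g w) (hf : ContinuousAt f z) (hg : ContinuousAt g z) :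
    f z = g z := by
  have h1 : ∃ᶠ w in 𝓝 z, P w := mem_closure_iff_frequently.1 (Measure.dense_of_ae hP z)
  exact tendsto_nhds_unique_of_frequently_eq hf hg ((h1.and_eventually h).mono fun w hw => hw.2 hw.1)

variable [T2Space X] (Fr : Frame X)

namespace Frame

/-- The coefficient of the form `a - ∂S` in the chart at `x`. -/
noncomputable def diff (a : X → ℂ) (S : X → ℝ) (x : X) (z : ℂ) : ℂ :=
  a ((chartAt ℂ x).symm z) * Fr.jac x z - del (fun w => S ((chartAt ℂ x).symm w)) z

/-- Both terms of `diff` transform as coefficients of (1,0)-forms. -/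
lemma diff_transition (a : X → ℂ) {S : X → ℝ} {x y : X} {w : ℂ} (hw : w ∈ (chartAt ℂ x).target)
    (hy : (chartAt ℂ x).symm w ∈ (chartAt ℂ y).source) (hS : SmoothAt ⊤ S ((chartAt ℂ x).symm w)) :
    Fr.diff a S y (chartAt ℂ y ((chartAt ℂ x).symm w)) *
      deriv (fun w => chartAt ℂ y ((chartAt ℂ x).symm w)) w = Fr.diff a S x w := by
  set τ : ℂ → ℂ := fun w => chartAt ℂ y ((chartAt ℂ x).symm w)
  have hτ : AnalyticAt ℂ τ w := analyticAt_transition hw hy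
  have e1 : (chartAt ℂ y).symm (τ w) = (chartAt ℂ x).symm w := (chartAt ℂ y).left_inv hy
  have e2 : ∀ᶠ w' in 𝓝 w, (chartAt ℂ y).symm (τ w') = (chartAt ℂ x).symm w' := by
    filter_upwards [((chartAt ℂ x).continuousAt_symm hw).eventually
      ((chartAt ℂ y).open_source.mem_nhds hy)] with w' hw'
    exact (chartAt ℂ y).left_inv hw'
  have hτt : τ w ∈ (chartAt ℂ y).target := (chartAt ℂ y).map_source hy
  have hjac : Fr.jac y (τ w) * deriv τ w = Fr.jac x w := by
    rw [jac, jac, e1]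
    set c := Fr.c ((chartAt ℂ x).symm w)
    have h1 : AnalyticAt ℂ (fun w => chartAt ℂ c ((chartAt ℂ y).symm w)) (τ w) :=
      analyticAt_transition hτt (by rw [e1]; exact Fr.src _)
    have h2 := deriv_comp w h1.differentiableAt hτ.differentiableAt
    rw [← h2]
    exact EventuallyEq.deriv_eq (e2.mono fun w' hw' => by simp only [Function.comp_apply, hw'])
  have hdel : del (fun w => S ((chartAt ℂ y).symm w)) (τ w) * deriv τ w =
      del (fun w => S ((chartAt ℂ x).symm w)) w := by
    rw [← del_comp (v := τ) ((SmoothAt.comp_curve (by rwa [e1])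
      (holAt_chartAt_symm hτt)).differentiableAt (by simp)) hτ]
    exact del_congr (e2.mono fun w' hw' => by simp only [hw'])
  rw [diff, diff, sub_mul, mul_assoc, hjac, hdel]
  simp only [τ] at e1
  rw [e1]

/-- Local representatives of `a - ∂S` in different charts are compatible. -/
lemma diff_compat (a : X → ℂ) {S : X → ℝ} {x y : X} {w : ℂ} (hw : w ∈ (chartAt ℂ x).target)
    (hy : (chartAt ℂ x).symm w = y) (hS : ∀ᶠ y' in 𝓝 y, SmoothAt ⊤ S y') {G H : ℂ → ℂ} {U V : Set ℂ}
    (hU : U ∈ 𝓝 w) (hG : ∀ᵐ z, z ∈ U → Fr.diff a S x z = G z) (hGc : ContinuousAt G w)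
    (hV : V ∈ 𝓝 (chartAt ℂ y y)) (hH : ∀ᵐ z, z ∈ V → Fr.diff a S y z = H z)
    (hHc : ContinuousAt H (chartAt ℂ y y)) :
    H (chartAt ℂ y y) * deriv (fun w => chartAt ℂ y ((chartAt ℂ x).symm w)) w = G w := by
  set τ : ℂ → ℂ := fun w => chartAt ℂ y ((chartAt ℂ x).symm w)
  have hys : (chartAt ℂ x).symm w ∈ (chartAt ℂ y).source := by rw [hy]; exact mem_chart_source ℂ y
  have hτ : AnalyticAt ℂ τ w := analyticAt_transition hw hys
  have hτw : τ w = chartAt ℂ y y := by simp only [τ, hy]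
  have hsy : Tendsto (chartAt ℂ x).symm (𝓝 w) (𝓝 y) := by
    rw [← hy]; exact (chartAt ℂ x).continuousAt_symm hw
  have h1 := ae_transition hH x y
  rw [← hτw] at hV hHc ⊢
  refine eq_of_ae_eq (f := fun w => H (τ w) * deriv τ w) (h1.and hG) ?_
    ((hHc.comp (f := τ) hτ.continuousAt).mul hτ.deriv.continuousAt) hGc
  filter_upwards [hU, hτ.continuousAt hV, (chartAt ℂ x).open_target.mem_nhds hw,
    hsy ((chartAt ℂ y).open_source.mem_nhds (mem_chart_source ℂ y)), hsy.eventually hS]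
    with w' e1 e2 e3 e4 e5 h
  have e2' : τ w' ∈ V := e2
  rw [← h.1 e3 e4 e2', ← h.2 e1]
  exact Fr.diff_transition a e3 e4 e5

/-- Up to a factor this is the (1,0)-part of the differential of the conjugate of κ, which vanishes
since κ is holomorphic. -/
lemma dX_sub_of_holAt {s t : X → ℝ} {κ : X → ℂ} {y : X} (hκ : HolAt κ y)
    (hs : s =ᶠ[𝓝 y] fun y => (κ y).re) (ht : t =ᶠ[𝓝 y] fun y => (κ y).im) :
    Fr.dX s y - Complex.I * Fr.dX t y = 0 := by
  have h1 : AnalyticAt ℂ (fun w => κ ((chartAt ℂ (Fr.c y)).symm w)) (chartAt ℂ (Fr.c y) y) := by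
    rw [← holAt_iff_analyticAt]
    refine HolAt.comp (g := κ) (f := (chartAt ℂ (Fr.c y)).symm) ?_
      (holAt_chartAt_symm ((chartAt ℂ (Fr.c y)).map_source (Fr.src y)))
    rwa [(chartAt ℂ (Fr.c y)).left_inv (Fr.src y)]
  rw [Fr.dX_congr hs, Fr.dX_congr ht, dX, dX, del_re h1, del_im h1]
  linear_combination (deriv (fun w => κ ((chartAt ℂ (Fr.c y)).symm w)) (chartAt ℂ (Fr.c y) y)) *
    Complex.I_mul_I

end Frame

/-- The Cauchy kernel with pole at `c`, truncated to a disc. -/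
noncomputable def polePart {c : ℂ} (χ : ContDiffBump c) (z : ℂ) : ℂ := (χ z : ℂ) * (z - c)⁻¹

/-- The Cauchy kernel, truncated to an annulus. -/
noncomputable def polePartCut {c : ℂ} (χ η : ContDiffBump c) (z : ℂ) : ℂ :=
  ((χ z * (1 - η z) : ℝ) : ℂ) * (z - c)⁻¹

lemma contDiff_polePartCut {c : ℂ} (χ η : ContDiffBump c) : ContDiff ℝ ∞ (polePartCut χ η) := by
  rw [contDiff_iff_contDiffAt]
  intro z
  rcases eq_or_ne z c with rfl | hz
  · have h1 : polePartCut χ η =ᶠ[𝓝 z] fun _ => 0 := by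
      filter_upwards [η.eventuallyEq_one] with w hw
      have : η w = 1 := hw
      simp [polePartCut, this]
    exact contDiffAt_const.congr_of_eventuallyEq h1
  · have h1 : ContDiffAt ℝ ∞ (fun z : ℂ => (z - c)⁻¹) z :=
      (contDiffAt_id.sub contDiffAt_const).inv (sub_ne_zero.2 hz)
    exact (Complex.ofRealCLM.contDiff.contDiffAt.comp z
      (χ.contDiff.mul (contDiff_const.sub η.contDiff)).contDiffAt).mul h1

lemma polePartCut_eq {c : ℂ} (χ η : ContDiffBump c) {z : ℂ} (hz : z ∉ closedBall c η.rOut) :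
    polePartCut χ η z = polePart χ z := by
  simp [polePartCut, polePart, bump_zero η hz]

lemma polePartCut_eq_zero {c : ℂ} (χ η : ContDiffBump c) {z : ℂ} (hz : z ∉ closedBall c χ.rOut) :
    polePartCut χ η z = 0 := by
  simp [polePartCut, bump_zero χ hz]

lemma polePart_eq {c : ℂ} (χ : ContDiffBump c) {z : ℂ} (hz : z ∈ closedBall c χ.rIn) :
    polePart χ z = (z - c)⁻¹ := by
  simp [polePart, χ.one_of_mem_closedBall hz]

section Pole

variable {p : X} {χ : ContDiffBump (chartAt ℂ p p)}

lemma smoothFn_cut (hχ : closedBall (chartAt ℂ p p) χ.rOut ⊆ (chartAt ℂ p).target) (L : ℂ →L[ℝ] ℝ)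
    (η : ContDiffBump (chartAt ℂ p p)) : SmoothFn (chartExt p fun z => L (polePartCut χ η z)) :=
  smoothFn_chartExt (isCompact_closedBall _ _) hχ
    (fun z hz => by rw [polePartCut_eq_zero χ η hz, map_zero])
    (L.contDiff.comp (contDiff_polePartCut χ η))

lemma isClosed_image_closedBall (hχ : closedBall (chartAt ℂ p p) χ.rOut ⊆ (chartAt ℂ p).target) {r : ℝ}
    (hr : r ≤ χ.rOut) : IsClosed ((chartAt ℂ p).symm '' closedBall (chartAt ℂ p p) r) :=
  ((isCompact_closedBall _ _).image_of_continuousOn ((chartAt ℂ p).continuousOn_symm.mono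
      ((closedBall_subset_closedBall hr).trans hχ))).isClosed

lemma cut_eventuallyEq (hχ : closedBall (chartAt ℂ p p) χ.rOut ⊆ (chartAt ℂ p).target)
    (L : ℂ →L[ℝ] ℝ) {η : ContDiffBump (chartAt ℂ p p)} (hη : η.rOut ≤ χ.rOut)
    {y : X} (hy : y ∉ (chartAt ℂ p).symm '' closedBall (chartAt ℂ p p) η.rOut) :
    (chartExt p fun z => L (polePartCut χ η z)) =ᶠ[𝓝 y] chartExt p fun z => L (polePart χ z) := by
  filter_upwards [(isClosed_image_closedBall hχ hη).isOpen_compl.mem_nhds hy] with w hw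
  rw [chartExt, chartExt]
  split_ifs with h
  · rw [polePartCut_eq]
    exact fun h' => hw ⟨_, h', (chartAt ℂ p).left_inv h⟩
  · rfl

lemma exists_cut {ε : ℝ} (hε : 0 < ε) (hεt : closedBall (chartAt ℂ p p) ε ⊆ (chartAt ℂ p).target)
    {y : X} (hy : y ≠ p) : ∃ η : ContDiffBump (chartAt ℂ p p),
      η.rOut ≤ ε ∧ y ∉ (chartAt ℂ p).symm '' closedBall (chartAt ℂ p p) η.rOut := by
  have h1 : ∃ r > 0, r ≤ ε ∧ y ∉ (chartAt ℂ p).symm '' closedBall (chartAt ℂ p p) r := by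
    by_cases hs : y ∈ (chartAt ℂ p).source
    · have h2 : chartAt ℂ p y ≠ chartAt ℂ p p := fun h =>
        hy ((chartAt ℂ p).injOn hs (mem_chart_source ℂ p) h)
      have h3 := dist_pos.2 h2
      refine ⟨min ε (dist (chartAt ℂ p y) (chartAt ℂ p p) / 2), lt_min hε (half_pos h3),
        min_le_left _ _, ?_⟩
      rintro ⟨z, hz, rfl⟩
      rw [(chartAt ℂ p).right_inv (hεt (closedBall_subset_closedBall (min_le_left _ _) hz))] at hz h3
      have := (mem_closedBall.1 hz).trans (min_le_right _ _)
      linarith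
    · refine ⟨ε, hε, le_rfl, ?_⟩
      rintro ⟨z, hz, rfl⟩
      exact hs ((chartAt ℂ p).map_target (hεt hz))
  obtain ⟨r, hr, hrε, hyr⟩ := h1
  exact ⟨⟨r / 2, r, half_pos hr, half_lt_self hr⟩, hrε, hyr⟩

lemma exists_ball_of_mem_nhds {x : X} {O : Set X} (hO : O ∈ 𝓝 x) : ∃ R > 0,
    closedBall (chartAt ℂ x x) R ⊆ (chartAt ℂ x).target ∧
    ∀ z ∈ closedBall (chartAt ℂ x x) R, (chartAt ℂ x).symm z ∈ O := by
  have h1 := Filter.inter_mem ((chartAt ℂ x).open_target.mem_nhds (mem_chart_target ℂ x))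
    (Frame.tendsto_symm_of_mem (mem_chart_source ℂ x) hO)
  obtain ⟨R, hR, h2⟩ := Metric.nhds_basis_closedBall.mem_iff.1 h1
  exact ⟨R, hR, fun z hz => (h2 hz).1, fun z hz => (h2 hz).2⟩

end Pole

/-- Let κ be the truncated Cauchy kernel 1/(z - c) at p, and S its real part. The form θ = ∂(Re κ) -
i ∂(Im κ) vanishes where κ is holomorphic, so it extends by zero across p and lies in L². If `a` is
its projection on the exact forms, a - ∂S is holomorphic off p by Weyl's lemma. At p itself `a` is
holomorphic, while ∂S = -1/(z - c)² provides the double pole. -/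
lemma exists_local_form [CompactSpace X] [Nonempty X] (p : X) : ∃ (Fr : Frame X) (a : X → ℂ)
    (S : X → ℝ), (∀ y ≠ p, SmoothAt ⊤ S y) ∧ ∀ x, ∃ (b : ℂ → ℂ) (ρ : ℝ), 0 < ρ ∧
      ball (chartAt ℂ x x) ρ ⊆ (chartAt ℂ x).target ∧
      DifferentiableOn ℂ b (ball (chartAt ℂ x x) ρ) ∧
      (x ≠ p → ∀ᵐ z, z ∈ ball (chartAt ℂ x x) ρ → Fr.diff a S x z = b z) ∧
      (x = p → ∀ᵐ z, z ∈ ball (chartAt ℂ x x) ρ →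
        Fr.diff a S x z = b z + ((z - chartAt ℂ x x) ^ 2)⁻¹) := by
  obtain ⟨Fr⟩ := exists_frame (X := X)
  obtain ⟨χ, hχ⟩ := exists_bump p
  set s : ContDiffBump (chartAt ℂ p p) → X → ℝ := fun η => chartExt p fun z => Complex.reCLM (polePartCut χ η z)
  set t : ContDiffBump (chartAt ℂ p p) → X → ℝ := fun η => chartExt p fun z => Complex.imCLM (polePartCut χ η z)
  set S : X → ℝ := chartExt p fun z => Complex.reCLM (polePart χ z)
  have hs : ∀ η, SmoothFn (s η) := fun η => smoothFn_cut hχ Complex.reCLM η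
  have ht : ∀ η, SmoothFn (t η) := fun η => smoothFn_cut hχ Complex.imCLM η
  have hr := χ.rIn_pos
  have hr2 : χ.rIn / 2 ≤ χ.rOut := by linarith [χ.rIn_lt_rOut]
  have hin : closedBall (chartAt ℂ p p) (χ.rIn / 2) ⊆ (chartAt ℂ p).target := (closedBall_subset_closedBall hr2).trans hχ
  have hcut : ∀ {y}, y ≠ p → ∃ η : ContDiffBump (chartAt ℂ p p), η.rOut ≤ χ.rIn / 2 ∧
      y ∉ (chartAt ℂ p).symm '' closedBall (chartAt ℂ p p) η.rOut := fun hy => exists_cut (half_pos hr) hin hy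
  set D : Set X := (chartAt ℂ p).source ∩ chartAt ℂ p ⁻¹' ball (chartAt ℂ p p) χ.rIn
  have hDo : IsOpen D := (chartAt ℂ p).isOpen_inter_preimage isOpen_ball
  set η₁ : ContDiffBump (chartAt ℂ p p) := ⟨χ.rIn / 4, χ.rIn / 2, by positivity, by linarith⟩
  -- On `D` the kernel is holomorphic, so θ is 0 there; outside `D` the cut-off `η₁` does not change
  -- the kernel.
  set θ : X → ℂ := Dᶜ.indicator fun y => Fr.dX (s η₁) y - Complex.I * Fr.dX (t η₁) y
  have hθ : MemLp θ 2 Fr.measure :=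
    ((Fr.memLp_dX (hs η₁)).sub ((Fr.memLp_dX (ht η₁)).const_mul _)).indicator
      hDo.measurableSet.compl
  have hS : ∀ y ≠ p, SmoothAt ⊤ S y := fun y hy => by
    obtain ⟨η, h1, h2⟩ := hcut hy
    exact (hs η y).congr (cut_eventuallyEq hχ _ (h1.trans hr2) h2)
  have hθeq : ∀ η : ContDiffBump (chartAt ℂ p p), η.rOut ≤ χ.rIn / 2 → ∀ y ∉ (chartAt ℂ p).symm '' closedBall (chartAt ℂ p p) η.rOut,
      θ y = Fr.dX (s η) y - Complex.I * Fr.dX (t η) y := by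
    intro η hη y hy
    have h1 := fun L => cut_eventuallyEq hχ L (hη.trans hr2) hy
    by_cases hyD : y ∈ D
    · have hκ : HolAt (fun y => (chartAt ℂ p y - (chartAt ℂ p p))⁻¹) y := by
        refine HolAt.comp (g := fun z => (z - (chartAt ℂ p p))⁻¹) (f := chartAt ℂ p) ?_ (holAt_chartAt hyD.1)
        rw [holAt_iff_analyticAt]
        refine (analyticAt_id.sub analyticAt_const).inv (sub_ne_zero.2 fun h => hy ?_)
        have h : chartAt ℂ p y = chartAt ℂ p p := h
        exact ⟨chartAt ℂ p y, by rw [h]; exact mem_closedBall_self η.rOut_pos.le, (chartAt ℂ p).left_inv hyD.1⟩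
      have h2 : ∀ L : ℂ →L[ℝ] ℝ, (chartExt p fun z => L (polePart χ z)) =ᶠ[𝓝 y]
          fun y => L ((chartAt ℂ p y - (chartAt ℂ p p))⁻¹) := fun L => by
        filter_upwards [hDo.mem_nhds hyD] with w hw
        rw [chartExt_of_mem _ hw.1, polePart_eq χ (ball_subset_closedBall hw.2)]
      rw [Fr.dX_sub_of_holAt hκ ((h1 _).trans (h2 Complex.reCLM)) ((h1 _).trans (h2 Complex.imCLM))]
      exact indicator_of_notMem (notMem_compl_iff.2 hyD) _
    · have h3 : y ∉ (chartAt ℂ p).symm '' closedBall (chartAt ℂ p p) η₁.rOut := by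
        rintro ⟨z, hz, rfl⟩
        refine hyD ⟨(chartAt ℂ p).map_target (hin hz), ?_⟩
        have : z ∈ ball (chartAt ℂ p p) χ.rIn := closedBall_subset_ball (half_lt_self hr) hz
        rwa [mem_preimage, (chartAt ℂ p).right_inv (hin hz)]
      have h4 := fun L => cut_eventuallyEq hχ L (η := η₁) hr2 h3
      rw [Fr.dX_congr ((h1 _).trans (h4 _).symm), Fr.dX_congr ((h1 Complex.imCLM).trans (h4 _).symm)]
      exact indicator_of_mem (show y ∈ Dᶜ from hyD) _
  obtain ⟨a, ha0, ha, hA, hB⟩ := exists_projection_memLp (ι := {u : X → ℝ // SmoothFn u})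
    (fun u => Fr.memLp_dX u.2) hθ
  have hrep := fun {x : X} {R : ℝ} => Fr.exists_local_representative (x := x) (R := R) hθ ha0 ha
    (fun u hu => hA ⟨u, hu⟩) (fun v hv h => hB v hv fun u => h _ u.2)
  refine ⟨Fr, a, S, hS, fun x => ?_⟩
  rcases eq_or_ne x p with rfl | hx
  · have hconst : SmoothFn (fun _ : X => (0 : ℝ)) := fun y => contDiffAt_const
    -- Near the pole θ vanishes, so the zero functions can serve as `s` and `t`.
    obtain ⟨b, hb, hab⟩ := hrep (half_pos hr) hin hconst hconst (by
      intro z hz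
      have hz' : z ∈ closedBall (chartAt ℂ x x) (χ.rIn / 2) := ball_subset_closedBall hz
      rw [Frame.dX_const, mul_zero, sub_zero]
      have hD : (chartAt ℂ x).symm z ∈ D := by
        refine ⟨(chartAt ℂ x).map_target (hin hz'), ?_⟩
        rw [mem_preimage, (chartAt ℂ x).right_inv (hin hz')]
        exact closedBall_subset_ball (half_lt_self hr) hz'
      exact indicator_of_notMem (notMem_compl_iff.2 hD) _)
    have hsub : ball (chartAt ℂ x x) (χ.rIn / 2 / 2) ⊆ closedBall (chartAt ℂ x x) (χ.rIn / 2) :=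
      ball_subset_closedBall.trans (closedBall_subset_closedBall (by linarith))
    refine ⟨b, χ.rIn / 2 / 2, by positivity, hsub.trans hin, hb, fun h => absurd rfl h, fun _ => ?_⟩
    filter_upwards [hab, compl_mem_ae_iff.2 (measure_singleton (chartAt ℂ x x))] with z hz hz1 hzb
    rw [← hz hzb, del_const, sub_zero, Frame.diff, sub_eq_add_neg]
    congr 1
    have hz2 : z - (chartAt ℂ x x) ≠ 0 := sub_ne_zero.2 hz1
    have h1 : (fun w => S ((chartAt ℂ x).symm w)) =ᶠ[𝓝 z] fun w => ((w - (chartAt ℂ x x))⁻¹).re := by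
      filter_upwards [isOpen_ball.mem_nhds hzb] with w hw
      have hw' := hsub hw
      simp only [S]
      rw [chartExt_of_mem _ ((chartAt ℂ x).map_target (hin hw')), (chartAt ℂ x).right_inv (hin hw'), polePart_eq]
      · rfl
      · exact closedBall_subset_closedBall (by linarith) hw'
    rw [del_congr h1, del_re (k := fun w => (w - chartAt ℂ x x)⁻¹) ((analyticAt_id.sub analyticAt_const).inv hz2)]
    have h2 : HasDerivAt (fun w => (w - (chartAt ℂ x x))⁻¹) (-1 / (z - (chartAt ℂ x x)) ^ 2) z :=
      ((hasDerivAt_id z).sub_const (chartAt ℂ x x)).inv hz2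
    rw [h2.deriv]
    field_simp
  · obtain ⟨η, h1, h2⟩ := hcut hx
    -- Away from the pole the kernel is replaced by a globally smooth one, cut off in a disc around
    -- p that misses a neighbourhood of `x`.
    obtain ⟨R, hR, hRt, hRs⟩ := exists_ball_of_mem_nhds
      ((isClosed_image_closedBall hχ (h1.trans hr2)).isOpen_compl.mem_nhds h2)
    obtain ⟨b, hb, hab⟩ := hrep hR hRt (hs η) (ht η) fun z hz =>
      hθeq η h1 _ (hRs z (ball_subset_closedBall hz))
    refine ⟨b, R / 2, half_pos hR, (ball_subset_closedBall.trans
      (closedBall_subset_closedBall (half_le_self hR.le))).trans hRt, hb, fun _ => ?_,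
      fun h => absurd h hx⟩
    filter_upwards [hab] with z hz hzb
    rw [← hz hzb, Frame.diff]
    congr 1
    have hz' : z ∈ closedBall (chartAt ℂ x x) R :=
      (ball_subset_closedBall.trans (closedBall_subset_closedBall (half_le_self hR.le))) hzb
    exact del_congr ((((chartAt ℂ x).continuousAt_symm (hRt hz')).eventually
      (cut_eventuallyEq hχ _ (h1.trans hr2) (hRs z hz'))).mono fun w hw => hw.symm)

/-- A meromorphic form on a compact Riemann surface with a double pole at a given point and
no other pole. -/
theorem exists_meromorphic_form [CompactSpace X] [Nonempty X] (p : X) : ∃ η : X → ℂ,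
    (∀ x ≠ p, ∃ b : ℂ → ℂ, AnalyticAt ℂ b (chartAt ℂ x x) ∧
      ∀ᶠ z in 𝓝 (chartAt ℂ x x), coef η (chartAt ℂ x).symm z = b z) ∧
    ∃ b : ℂ → ℂ, AnalyticAt ℂ b (chartAt ℂ p p) ∧ ∀ᶠ z in 𝓝[≠] (chartAt ℂ p p),
      coef η (chartAt ℂ p).symm z = b z + ((z - chartAt ℂ p p) ^ 2)⁻¹ := by
  obtain ⟨Fr, a, S, hS, h⟩ := exists_local_form p
  choose b ρ hρ hρt hb h1 h2 using h
  have hba : ∀ x, ∀ z ∈ ball (chartAt ℂ x x) (ρ x), AnalyticAt ℂ (b x) z := fun x z hz =>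
    (hb x).analyticAt (isOpen_ball.mem_nhds hz)
  have hbx : ∀ x, AnalyticAt ℂ (b x) (chartAt ℂ x x) := fun x => hba x _ (mem_ball_self (hρ x))
  have key : ∀ x (G : ℂ → ℂ) z, z ∈ ball (chartAt ℂ x x) (ρ x) → (chartAt ℂ x).symm z ≠ p →
      (∀ᵐ z, z ∈ ball (chartAt ℂ x x) (ρ x) → Fr.diff a S x z = G z) → ContinuousAt G z →
      coef (fun x => b x (chartAt ℂ x x)) (chartAt ℂ x).symm z = G z := by
    intro x G z hz hzp hG hGc
    rw [coef]
    refine Fr.diff_compat a (hρt x hz) rfl ?_ (isOpen_ball.mem_nhds hz) hG hGc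
      (ball_mem_nhds _ (hρ _)) (h1 _ hzp) (hbx _).continuousAt
    filter_upwards [isOpen_compl_singleton.mem_nhds hzp] with y hy using hS y hy
  -- The value at `x` is that of the local representative at the centre of its own chart; `key`
  -- shows that these values fit together.
  refine ⟨fun x => b x (chartAt ℂ x x), fun x hx => ⟨b x, hbx x, ?_⟩, b p, hbx p, ?_⟩
  · have h3 := Frame.tendsto_symm_of_mem (mem_chart_source ℂ x) (isOpen_compl_singleton.mem_nhds hx)
    filter_upwards [h3, ball_mem_nhds _ (hρ x)] with z hz hzb
    exact key x _ z hzb hz (h1 x hx) (hba x z hzb).continuousAt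
  · filter_upwards [self_mem_nhdsWithin, mem_nhdsWithin_of_mem_nhds (ball_mem_nhds _ (hρ p))]
      with z hz hzb
    have hz0 : (z - chartAt ℂ p p) ^ 2 ≠ 0 := pow_ne_zero _ (sub_ne_zero.2 hz)
    refine key p (fun z => b p z + ((z - chartAt ℂ p p) ^ 2)⁻¹) z hzb (fun h => hz ?_) (h2 p rfl) ?_
    · rw [mem_singleton_iff, ← (chartAt ℂ p).right_inv (hρt p hzb), h]
    · exact (hba p z hzb).continuousAt.add
        (((continuous_id.sub continuous_const).pow 2).continuousAt.inv₀ hz0)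

end MeromorphicForm

/-! ### Holomorphic maps to the Riemann sphere -/

section SphereMaps

open OnePoint

/-- A coordinate on the Riemann sphere at the point `y`. -/
noncomputable def sphereCoord (y w : OnePoint ℂ) : ℂ :=
  open Classical in if y = infty then w.elim 0 (fun z => z⁻¹) else w.elim 0 id

lemma sphereCoord_infty_infty : sphereCoord infty infty = 0 := by simp [sphereCoord]

lemma sphereCoord_infty_coe (z : ℂ) : sphereCoord infty (z : OnePoint ℂ) = z⁻¹ := by
  simp [sphereCoord]

lemma sphereCoord_coe {y : OnePoint ℂ} (hy : y ≠ infty) (z : ℂ) : sphereCoord y (z : OnePoint ℂ) = z := by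
  simp [sphereCoord, hy]

/-- The domain of the coordinate at `y`. -/
def sphereDom (y : OnePoint ℂ) : Set (OnePoint ℂ) := {w | (y = infty → w ≠ (0 : ℂ)) ∧ (y ≠ infty → w ≠ infty)}

lemma sphereDom_mem_nhds (y : OnePoint ℂ) : sphereDom y ∈ 𝓝 y := by
  by_cases hy : y = infty
  · subst hy
    filter_upwards [isOpen_compl_singleton.mem_nhds (infty_ne_coe (0 : ℂ))] with w hw
    exact ⟨fun _ => hw, fun h => absurd rfl h⟩
  · filter_upwards [isOpen_compl_singleton.mem_nhds hy] with w hw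
    exact ⟨fun h => absurd h hy, fun _ => hw⟩

lemma injOn_sphereCoord (y : OnePoint ℂ) : InjOn (sphereCoord y) (sphereDom y) := by
  intro w hw w' hw' h
  by_cases hy : y = infty
  · subst hy
    have h1 := hw.1 rfl
    have h2 := hw'.1 rfl
    induction w using OnePoint.rec with
    | infty =>
      induction w' using OnePoint.rec with
      | infty => rfl
      | coe z' =>
        rw [sphereCoord_infty_infty, sphereCoord_infty_coe, eq_comm, inv_eq_zero] at h
        exact absurd (by rw [h]) h2
    | coe z =>
      induction w' using OnePoint.rec with
      | infty =>
        rw [sphereCoord_infty_infty, sphereCoord_infty_coe, inv_eq_zero] at h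
        exact absurd (by rw [h]) h1
      | coe z' =>
        rw [sphereCoord_infty_coe, sphereCoord_infty_coe, inv_inj] at h
        rw [h]
  · obtain ⟨z, rfl⟩ := ne_infty_iff_exists.1 (hw.2 hy)
    obtain ⟨z', rfl⟩ := ne_infty_iff_exists.1 (hw'.2 hy)
    rw [sphereCoord_coe hy, sphereCoord_coe hy] at h
    rw [h]

lemma continuousAt_sphereCoord (y : OnePoint ℂ) : ContinuousAt (sphereCoord y) y := by
  induction y using OnePoint.rec with
  | infty =>
    rw [continuousAt_infty', sphereCoord_infty_infty, coclosedCompact_eq_cocompact,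
      ← Metric.cobounded_eq_cocompact]
    have : sphereCoord infty ∘ ((↑) : ℂ → OnePoint ℂ) = fun z => z⁻¹ :=
      funext fun z => sphereCoord_infty_coe z
    rw [this]
    exact tendsto_inv₀_cobounded
  | coe z =>
    rw [continuousAt_coe]
    have : sphereCoord (z : OnePoint ℂ) ∘ ((↑) : ℂ → OnePoint ℂ) = id :=
      funext fun w => sphereCoord_coe (coe_ne_infty z) w
    rw [this]
    exact continuousAt_id

variable {X : Type*} [TopologicalSpace X] [ChartedSpace ℂ X] [IsManifold 𝓘(ℂ) ω X]

/-- The order of contact of `Φ` with the constant map at `x`. -/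
noncomputable def sphereOrd (Φ : X → OnePoint ℂ) (x : X) : ℕ∞ :=
  ordAt (sphereCoord (Φ x) ∘ Φ) x

lemma ordAt_inv_comp {q : X → ℂ} {x : X} (hq : HolAt q x) (h0 : q x ≠ 0) :
    ordAt (fun y => (q y)⁻¹) x = ordAt q x := by
  have h1 : AnalyticAt ℂ (fun z : ℂ => z⁻¹) (q x) := analyticAt_inv h0
  have h2 := ordAt_comp (q := fun z : ℂ => z⁻¹) (f := q) (x := x) (holAt_iff_analyticAt.2 h1) hq
  have h3 : ordAt (fun z : ℂ => z⁻¹) (q x) = 1 := by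
    rw [ordAt]
    simp only [chartAt_self_eq, OpenPartialHomeomorph.refl_symm, OpenPartialHomeomorph.refl_apply]
    refine h1.analyticOrderAt_sub_eq_one_of_deriv_ne_zero ?_
    rw [deriv_inv]
    exact neg_ne_zero.2 (inv_ne_zero (pow_ne_zero _ h0))
  rw [h3, one_mul, chartAt_self_eq] at h2
  exact h2

/-- The order may be computed in the coordinate of a nearby point; only the passage from 1/w to w
needs an argument, and inversion has order one away from 0. -/
lemma sphereOrd_eq {Φ : X → OnePoint ℂ} (hΦ : Continuous Φ) {x y : X} (hy : Φ y ∈ sphereDom (Φ x))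
    (hq : HolAt (sphereCoord (Φ x) ∘ Φ) y) : sphereOrd Φ y = ordAt (sphereCoord (Φ x) ∘ Φ) y := by
  by_cases hx : Φ x = infty
  · rw [hx] at hq ⊢
    have h0 := hy.1 hx
    by_cases hyi : Φ y = infty
    · rw [sphereOrd, hyi]
    · obtain ⟨w, hw⟩ := ne_infty_iff_exists.1 hyi
      have hw0 : w ≠ 0 := by
        rintro rfl
        exact h0 hw.symm
      have hqy : (sphereCoord infty ∘ Φ) y ≠ 0 := by
        rw [Function.comp_apply, ← hw, sphereCoord_infty_coe]
        exact inv_ne_zero hw0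
      rw [← ordAt_inv_comp hq hqy, sphereOrd]
      refine ordAt_congr ?_
      filter_upwards [hΦ.continuousAt.eventually (isOpen_compl_singleton.mem_nhds hyi)] with y' hy'
      obtain ⟨w', hw'⟩ := ne_infty_iff_exists.1 hy'
      rw [Function.comp_apply, Function.comp_apply, ← hw', sphereCoord_coe hyi,
        sphereCoord_infty_coe, inv_inv]
  · have hyi := hy.2 hx
    refine ordAt_congr (Eventually.of_forall fun y' => ?_)
    simp only [Function.comp_apply, sphereCoord, hx, hyi, if_false]

/-- This brings maps to the sphere under the fibre-counting theorem `fiberSum_one_eq`. -/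
lemma exists_sphere_localModel {Φ : X → OnePoint ℂ} (hΦ : Continuous Φ) {x : X}
    (hq : HolAt (sphereCoord (Φ x) ∘ Φ) x) (hx : sphereOrd Φ x ≠ ⊤) :
    ∃ h ρ, LocalModel Φ (fun x => (sphereOrd Φ x).toNat) x (sphereCoord (Φ x)) h ρ ∧
      ∀ ζ ∈ ball (0 : ℂ) ρ, ζ ≠ 0 → sphereOrd Φ (h ζ) = 1 := by
  have hne : (sphereOrd Φ x).toNat ≠ 0 := by
    rw [Ne, ENat.toNat_eq_zero, not_or]
    exact ⟨ordAt_ne_zero hq, hx⟩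
  obtain ⟨h, ρ, hd, h0, heq, hhol⟩ := exists_normal_form hq (d := (sphereOrd Φ x).toNat)
    (ENat.natCast_toNat hx).symm
  have hev : ∀ᶠ ζ in 𝓝 (0 : ℂ), Φ (h ζ) ∈ sphereDom (Φ x) := by
    have h1 : ContinuousAt (fun ζ => Φ (h ζ)) 0 :=
      hΦ.continuousAt.comp (hd.hol 0 (mem_ball_self hd.pos)).continuousAt
    refine h1.eventually (p := fun z => z ∈ sphereDom (Φ x)) ?_
    simp only [h0]
    exact sphereDom_mem_nhds _
  obtain ⟨r, hr, hrs⟩ := Metric.eventually_nhds_iff_ball.1 hev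
  have hsub : ball (0 : ℂ) (min r ρ) ⊆ ball 0 ρ := ball_subset_ball (min_le_right _ _)
  have hone : ∀ ζ ∈ ball (0 : ℂ) (min r ρ), ζ ≠ 0 → sphereOrd Φ (h ζ) = 1 := fun ζ hζ hζ0 => by
    rw [sphereOrd_eq hΦ (hrs ζ (ball_subset_ball (min_le_left _ _) hζ)) (hhol ζ (hsub hζ))]
    exact ordAt_eq_one_of_normal_form hne hd heq hhol (hsub hζ) hζ0
  refine ⟨h, min r ρ, ⟨hd.mono (lt_min hr hd.pos) (min_le_right _ _), h0, hne,
    fun ζ hζ => heq ζ (hsub hζ), fun ζ hζ hζ0 => ?_, continuousAt_sphereCoord _,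
    ⟨_, sphereDom_mem_nhds _, injOn_sphereCoord _⟩⟩, hone⟩
  simp only [hone ζ hζ hζ0, ENat.toNat_one]

variable [CompactSpace X] [T2Space X]

/-- A holomorphic map to the sphere which is locally constant somewhere is locally constant. -/
lemma sphereOrd_dichotomy [PreconnectedSpace X] {Φ : X → OnePoint ℂ} (hΦ : Continuous Φ)
    (hq : ∀ x, HolAt (sphereCoord (Φ x) ∘ Φ) x) :
    (∀ x, sphereOrd Φ x ≠ ⊤) ∨ ∀ x, sphereOrd Φ x = ⊤ := by
  have h1 : IsClopen {x | sphereOrd Φ x = ⊤} := by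
    constructor
    · rw [← isOpen_compl_iff, isOpen_iff_eventually]
      intro x hx
      obtain ⟨h, ρ, H, h1⟩ := exists_sphere_localModel hΦ (hq x) hx
      have h2 := eventually_nhdsNE_of_disc H.disc (p := fun y => sphereOrd Φ y ≠ ⊤)
        fun ζ hζ h0 => by rw [h1 ζ hζ h0]; exact ENat.one_ne_top
      rw [H.zero, eventually_nhdsWithin_iff] at h2
      filter_upwards [h2] with y hy
      by_cases hyx : y = x
      · rw [hyx]; exact hx
      · exact hy hyx
    · rw [isOpen_iff_eventually]
      intro x hx
      have hx : sphereOrd Φ x = ⊤ := hx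
      rw [sphereOrd, ordAt, analyticOrderAt_eq_top, eventually_chart_iff
        (p := fun y => (sphereCoord (Φ x) ∘ Φ) y - (sphereCoord (Φ x) ∘ Φ) x = 0)] at hx
      have h2 : ∀ᶠ y in 𝓝 x, Φ y = Φ x := by
        filter_upwards [hx, hΦ.continuousAt.eventually (sphereDom_mem_nhds (Φ x))] with y hy hy'
        exact injOn_sphereCoord _ hy' (mem_of_mem_nhds (sphereDom_mem_nhds _)) (sub_eq_zero.1 hy)
      filter_upwards [h2.eventually_nhds] with y hy
      have h3 : sphereCoord (Φ y) ∘ Φ =ᶠ[𝓝 y] fun _ => sphereCoord (Φ y) (Φ x) :=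
        hy.mono fun y' hy' => by simp only [Function.comp_apply, hy']
      change sphereOrd Φ y = ⊤
      rw [sphereOrd, ordAt_congr h3, ordAt, analyticOrderAt_eq_top]
      exact Eventually.of_forall fun _ => sub_self _
  rcases isClopen_iff.1 h1 with h | h
  · exact Or.inl fun x hx => (h ▸ (show x ∈ {x | sphereOrd Φ x = ⊤} from hx) : x ∈ (∅ : Set X))
  · exact Or.inr fun x => (h ▸ mem_univ x : x ∈ {x | sphereOrd Φ x = ⊤})

end SphereMaps

/-! ### Zeros and poles of a meromorphic function -/

section OrderSum

open OnePoint

variable {X : Type*} [TopologicalSpace X] [ChartedSpace ℂ X] [IsManifold 𝓘(ℂ) ω X]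

lemma tendsto_chartAt_nhdsNE (x : X) : Tendsto (chartAt ℂ x) (𝓝[≠] x) (𝓝[≠] (chartAt ℂ x x)) := by
  refine tendsto_nhdsWithin_iff.2 ⟨(tendsto_chartAt x).mono_left nhdsWithin_le_nhds, ?_⟩
  filter_upwards [self_mem_nhdsWithin, mem_nhdsWithin_of_mem_nhds
    ((chartAt ℂ x).open_source.mem_nhds (mem_chart_source ℂ x))] with y hy hys h
  exact hy ((chartAt ℂ x).injOn hys (mem_chart_source ℂ x) h)

lemma tendsto_chartAt_symm_nhdsNE (x : X) :
    Tendsto (chartAt ℂ x).symm (𝓝[≠] (chartAt ℂ x x)) (𝓝[≠] x) := by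
  refine tendsto_nhdsWithin_iff.2 ⟨(tendsto_chartAt_symm x).mono_left nhdsWithin_le_nhds, ?_⟩
  filter_upwards [self_mem_nhdsWithin, mem_nhdsWithin_of_mem_nhds
    ((chartAt ℂ x).open_target.mem_nhds (mem_chart_target ℂ x))] with z hz hzt h
  refine hz ?_
  have h : (chartAt ℂ x).symm z = x := h
  rw [mem_singleton_iff, ← (chartAt ℂ x).right_inv hzt, h]

instance nhdsNE_neBot_surface (x : X) : (𝓝[≠] x).NeBot := (tendsto_chartAt_symm_nhdsNE x).neBot

/-- `h` is a meromorphic function on `X`, nowhere locally zero. -/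
def IsMero (h : X → ℂ) : Prop := ∀ x, MeromorphicAt (fun z => h ((chartAt ℂ x).symm z)) (chartAt ℂ x x) ∧
  meromorphicOrderAt (fun z => h ((chartAt ℂ x).symm z)) (chartAt ℂ x x) ≠ ⊤

/-- The order of the meromorphic function `h` at `x`. -/
noncomputable def meroOrd (h : X → ℂ) (x : X) : ℤ :=
  (meromorphicOrderAt (fun z => h ((chartAt ℂ x).symm z)) (chartAt ℂ x x)).untop₀

/-- The extension of a meromorphic function to a map to the sphere. -/
noncomputable def toSphere (h : X → ℂ) (x : X) : OnePoint ℂ :=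
  limUnder (𝓝[≠] x) fun y => (h y : OnePoint ℂ)

lemma toSphere_of_holAt {h : X → ℂ} {x : X} (hx : HolAt h x) : toSphere h x = (h x : OnePoint ℂ) :=
  ((continuous_coe.continuousAt.comp hx.continuousAt).tendsto.mono_left
    nhdsWithin_le_nhds).limUnder_eq

lemma IsMero.eventually_holAt {h : X → ℂ} (hh : IsMero h) (x : X) : ∀ᶠ y in 𝓝[≠] x, HolAt h y := by
  filter_upwards [(tendsto_chartAt_nhdsNE x).eventually (hh x).1.eventually_analyticAt,
    mem_nhdsWithin_of_mem_nhds ((chartAt ℂ x).open_source.mem_nhds (mem_chart_source ℂ x))]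
    with y hy hys
  have h1 := HolAt.comp (g := fun z => h ((chartAt ℂ x).symm z)) (f := chartAt ℂ x)
    (holAt_iff_analyticAt.2 hy) (holAt_chartAt hys)
  refine h1.congr ?_
  filter_upwards [(chartAt ℂ x).open_source.mem_nhds hys] with w hw
  rw [Function.comp_apply, (chartAt ℂ x).left_inv hw]

lemma ordAt_comp_chartAt {G : ℂ → ℂ} {x : X} {n : ℕ} {g : ℂ → ℂ} (hg : AnalyticAt ℂ g (chartAt ℂ x x))
    (hg0 : g (chartAt ℂ x x) ≠ 0) (hn : n ≠ 0)
    (hG : G = fun z => (z - chartAt ℂ x x) ^ n * g z) : ordAt (fun y => G (chartAt ℂ x y)) x = n := by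
  have h0 : G (chartAt ℂ x x) = 0 := by rw [hG]; simp [hn]
  have hGa : AnalyticAt ℂ G (chartAt ℂ x x) := by
    rw [hG]; exact ((analyticAt_id.sub analyticAt_const).pow n).mul hg
  rw [ordAt, h0, analyticOrderAt_congr (g := G)]
  · rw [hGa.analyticOrderAt_eq_natCast]
    exact ⟨g, hg, hg0, Eventually.of_forall fun z => by simp only [hG, smul_eq_mul]⟩
  · filter_upwards [(chartAt ℂ x).open_target.mem_nhds (mem_chart_target ℂ x)] with z hz
    rw [(chartAt ℂ x).right_inv hz, sub_zero]

/-- Write h = (z - c)^n g with g(c) ≠ 0. The value of `toSphere h` is a punctured limit, so the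
value of `h` at the point itself plays no role; in the sphere coordinate the map is (z - c)^n g for
n ≥ 0 and (z - c)^{-n}/g for n < 0. -/
lemma IsMero.local_data {h : X → ℂ} (hh : IsMero h) (x : X) : ContinuousAt (toSphere h) x ∧
    HolAt (sphereCoord (toSphere h x) ∘ toSphere h) x ∧
    ((toSphere h x = (0 : ℂ) ∧ 0 < meroOrd h x ∧ sphereOrd (toSphere h) x = (meroOrd h x).toNat) ∨
     (toSphere h x = infty ∧ meroOrd h x < 0 ∧ sphereOrd (toSphere h) x = (-meroOrd h x).toNat) ∨
     (toSphere h x ≠ (0 : ℂ) ∧ toSphere h x ≠ infty ∧ meroOrd h x = 0)) := by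
  set e := chartAt ℂ x
  set n := meroOrd h x with hn
  obtain ⟨g, hg, hg0, hgeq⟩ := (meromorphicOrderAt_ne_top_iff (hh x).1).1 (hh x).2
  have hgeq' : ∀ᶠ y in 𝓝[≠] x, h y = (e y - e x) ^ n * g (e y) := by
    filter_upwards [(tendsto_chartAt_nhdsNE x).eventually hgeq, mem_nhdsWithin_of_mem_nhds
      (e.open_source.mem_nhds (mem_chart_source ℂ x))] with y hy hys
    rw [e.left_inv hys] at hy
    exact hy
  have hΦ : ∀ᶠ y in 𝓝[≠] x, toSphere h y = (h y : OnePoint ℂ) :=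
    (hh.eventually_holAt x).mono fun y hy => toSphere_of_holAt hy
  have hcont : ∀ w, Tendsto (fun y => (h y : OnePoint ℂ)) (𝓝[≠] x) (𝓝 w) →
      toSphere h x = w ∧ ContinuousAt (toSphere h) x := fun w hw => by
    have h1 : toSphere h x = w := hw.limUnder_eq
    refine ⟨h1, continuousAt_iff_punctured_nhds.2 ?_⟩
    rw [h1]
    exact hw.congr' (hΦ.mono fun y hy => hy.symm)
  have hol : ∀ G : ℂ → ℂ, AnalyticAt ℂ G (e x) →
      sphereCoord (toSphere h x) ∘ toSphere h =ᶠ[𝓝 x] (fun y => G (e y)) →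
      HolAt (sphereCoord (toSphere h x) ∘ toSphere h) x := fun G hG hE =>
    (HolAt.comp (g := G) (f := e) (holAt_iff_analyticAt.2 hG)
      (holAt_chartAt (mem_chart_source ℂ x))).congr hE.symm
  have hev : ∀ {u v : X → ℂ}, u =ᶠ[𝓝[≠] x] v → u x = v x → u =ᶠ[𝓝 x] v := fun {u v} h1 h2 => by
    rw [EventuallyEq, eventually_nhdsWithin_iff] at h1
    filter_upwards [h1] with y hy
    by_cases hyx : y = x
    · rw [hyx, h2]
    · exact hy hyx
  rcases lt_or_ge n 0 with hneg | hpos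
  · obtain ⟨k, hk⟩ : ∃ k : ℕ, n = -(k : ℤ) := ⟨n.natAbs, by omega⟩
    have hk0 : k ≠ 0 := by omega
    set G : ℂ → ℂ := fun z => (z - e x) ^ k * (g z)⁻¹ with hG
    have hGa : AnalyticAt ℂ G (e x) := ((analyticAt_id.sub analyticAt_const).pow k).mul (hg.inv hg0)
    have ht : Tendsto (fun y => (h y : OnePoint ℂ)) (𝓝[≠] x) (𝓝 infty) := by
      have h1 : meromorphicOrderAt (fun z => h (e.symm z)) (e x) < 0 := by
        rw [← WithTop.coe_untop₀_of_ne_top (hh x).2]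
        exact_mod_cast hneg
      have h2 := (tendsto_cobounded_of_meromorphicOrderAt_neg h1).comp (tendsto_chartAt_nhdsNE x)
      rw [Metric.cobounded_eq_cocompact, ← coclosedCompact_eq_cocompact] at h2
      refine (tendsto_coe_infty.comp h2).congr' ?_
      filter_upwards [mem_nhdsWithin_of_mem_nhds
        (e.open_source.mem_nhds (mem_chart_source ℂ x))] with y hys
      simp only [Function.comp_apply]
      rw [e.left_inv hys]
    obtain ⟨hx, hc⟩ := hcont _ ht
    have hE : sphereCoord (toSphere h x) ∘ toSphere h =ᶠ[𝓝 x] (fun y => G (e y)) := by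
      refine hev ?_ ?_
      · filter_upwards [hΦ, hgeq'] with y h1 h2
        rw [Function.comp_apply, h1, hx, sphereCoord_infty_coe, h2, hG, hk, zpow_neg, zpow_natCast,
          mul_inv, inv_inv]
      · rw [Function.comp_apply, hx, sphereCoord_infty_infty]; simp [hG, hk0]
    refine ⟨hc, hol G hGa hE, Or.inr (Or.inl ⟨hx, hneg, ?_⟩)⟩
    rw [sphereOrd, ordAt_congr hE, ordAt_comp_chartAt (hg.inv hg0) (inv_ne_zero hg0) hk0 hG, hk]
    simp
  · obtain ⟨k, hk⟩ := Int.eq_ofNat_of_zero_le hpos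
    set G : ℂ → ℂ := fun z => (z - e x) ^ k * g z with hG
    have hGa : AnalyticAt ℂ G (e x) := ((analyticAt_id.sub analyticAt_const).pow k).mul hg
    have hGh : ∀ᶠ y in 𝓝[≠] x, h y = G (e y) := by
      filter_upwards [hgeq'] with y hy
      rw [hy, hk, zpow_natCast]
    have ht : Tendsto (fun y => (h y : OnePoint ℂ)) (𝓝[≠] x) (𝓝 (G (e x) : OnePoint ℂ)) := by
      have h1 : Tendsto (fun y => (G (e y) : OnePoint ℂ)) (𝓝[≠] x) (𝓝 (G (e x) : OnePoint ℂ)) :=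
        ((continuous_coe.continuousAt.comp hGa.continuousAt).tendsto.comp
          (tendsto_chartAt x)).mono_left nhdsWithin_le_nhds
      exact h1.congr' (hGh.mono fun y hy => by simp only [hy])
    obtain ⟨hx, hc⟩ := hcont _ ht
    have hxi : toSphere h x ≠ infty := by rw [hx]; exact coe_ne_infty _
    have hE : sphereCoord (toSphere h x) ∘ toSphere h =ᶠ[𝓝 x] (fun y => G (e y)) := by
      refine hev ?_ ?_
      · filter_upwards [hΦ, hGh] with y h1 h2
        rw [Function.comp_apply, h1, sphereCoord_coe hxi, h2]
      · rw [Function.comp_apply]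
        nth_rw 2 [hx]
        rw [sphereCoord_coe hxi]
    refine ⟨hc, hol G hGa hE, ?_⟩
    rcases eq_or_ne k 0 with rfl | hk0
    · refine Or.inr (Or.inr ⟨?_, hxi, hk⟩)
      rw [hx, Ne, coe_eq_coe]
      simpa [hG] using hg0
    · refine Or.inl ⟨?_, by omega, ?_⟩
      · rw [hx]; simp [hG, hk0]
      · rw [sphereOrd, ordAt_congr hE, ordAt_comp_chartAt hg hg0 hk0 hG, hk]
        simp

variable [CompactSpace X] [T2Space X]

/-- The orders of a meromorphic function add up to zero. -/
theorem sum_meroOrd_eq_zero [PreconnectedSpace X] {h : X → ℂ} (hh : IsMero h) {P : Finset X}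
    (hP : ∀ x ∉ P, meroOrd h x = 0) : ∑ x ∈ P, meroOrd h x = 0 := by
  classical
  set Φ := toSphere h
  have hΦ : Continuous Φ := continuous_iff_continuousAt.2 fun x => (hh.local_data x).1
  have hq : ∀ x, HolAt (sphereCoord (Φ x) ∘ Φ) x := fun x => (hh.local_data x).2.1
  set m : X → ℕ := fun x => (sphereOrd Φ x).toNat
  rcases sphereOrd_dichotomy hΦ hq with hfin | htop
  · have hloc : ∀ x, ∃ q h ρ, LocalModel Φ m x q h ρ := fun x => by
      obtain ⟨h, ρ, H, -⟩ := exists_sphere_localModel hΦ (hq x) (hfin x)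
      exact ⟨_, h, ρ, H⟩
    have hsum : ∀ y, (∀ x, Φ x = y → x ∈ P) →
        fiberSum Φ m (fun _ => 1) y = ∑ x ∈ P, if Φ x = y then (m x : ℝ) else 0 := fun y hy => by
      have h1 : Φ ⁻¹' {y} = ↑(P.filter fun x => Φ x = y) := by
        ext x
        simp only [mem_preimage, mem_singleton_iff, Finset.coe_filter, mem_ofPred_eq]
        exact ⟨fun h => ⟨hy x h, h⟩, fun h => h.2⟩
      rw [fiberSum, h1, finsum_mem_coe_finset, Finset.sum_filter]
      simp
    -- The fibre over 0 counts the zeros and the fibre over infinity the poles; both counts agree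
    -- because the fibre count is constant on the connected sphere.
    have h0 := hsum ((0 : ℂ) : OnePoint ℂ) fun x hx => by
      by_contra hxP
      have := hP x hxP
      rcases (hh.local_data x).2.2 with h | h | h
      · omega
      · omega
      · exact h.1 hx
    have h1 := hsum infty fun x hx => by
      by_contra hxP
      have := hP x hxP
      rcases (hh.local_data x).2.2 with h | h | h
      · omega
      · omega
      · exact h.2.1 hx
    have h2 : ∀ x, (meroOrd h x : ℝ) = (if Φ x = ((0 : ℂ) : OnePoint ℂ) then (m x : ℝ) else 0) -
        if Φ x = infty then (m x : ℝ) else 0 := fun x => by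
      have hmx : m x = (sphereOrd Φ x).toNat := rfl
      rcases (hh.local_data x).2.2 with ⟨e1, e2, e3⟩ | ⟨e1, e2, e3⟩ | ⟨e1, e2, e3⟩
      · rw [e3, ENat.toNat_natCast] at hmx
        have h4 : ((m x : ℤ) : ℝ) = meroOrd h x := by rw [hmx, Int.toNat_of_nonneg e2.le]
        rw [if_pos e1, if_neg (fun h' => coe_ne_infty _ (e1.symm.trans h')), ← h4]; simp
      · rw [e3, ENat.toNat_natCast] at hmx
        have h4 : ((m x : ℤ) : ℝ) = -meroOrd h x := by
          rw [hmx, Int.toNat_of_nonneg (by omega)]; simp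
        rw [if_pos e1, if_neg (fun h' => infty_ne_coe _ (e1.symm.trans h'))]
        have h5 : (m x : ℝ) = -meroOrd h x := by rw [← h4]; simp
        rw [h5]; ring
      · rw [if_neg e1, if_neg e2, e3]; simp
    have h3 : (∑ x ∈ P, (meroOrd h x : ℝ)) = 0 := by
      simp only [h2]
      rw [Finset.sum_sub_distrib, ← h0, ← h1, fiberSum_one_eq hΦ hloc _ infty, sub_self]
    exact_mod_cast h3
  -- For a locally constant map every order of contact is infinite, which leaves neither zeros nor
  -- poles.
  · refine Finset.sum_eq_zero fun x _ => ?_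
    have h1 : sphereOrd Φ x = ⊤ := htop x
    rcases (hh.local_data x).2.2 with ⟨-, -, e3⟩ | ⟨-, -, e3⟩ | ⟨-, -, e3⟩
    · exact absurd (e3.symm.trans h1) (ENat.natCast_ne_top _)
    · exact absurd (e3.symm.trans h1) (ENat.natCast_ne_top _)
    · exact e3

end OrderSum

/-! ### Riemann–Hurwitz and the bound on totally ramified points -/

section RiemannHurwitz

variable {X : Type*} [TopologicalSpace X] [ChartedSpace ℂ X] [IsManifold 𝓘(ℂ) ω X]
  [MeasurableSpace X] [BorelSpace X]

lemma coef_congr (η : X → ℂ) {k k' : ℂ → X} {z : ℂ} (h : k =ᶠ[𝓝 z] k') : coef η k z = coef η k' z := by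
  have h0 := h.eq_of_nhds
  rw [coef, coef, h0]
  congr 1
  exact EventuallyEq.deriv_eq (h.mono fun w hw => by simp only [hw])

lemma coef_comp (η : X → ℂ) {k : ℂ → X} {τ : ℂ → ℂ} {z : ℂ} (hk : HolAt k (τ z))
    (hτ : AnalyticAt ℂ τ z) : coef η (fun w => k (τ w)) z = coef η k (τ z) * deriv τ z := by
  have h1 : AnalyticAt ℂ (fun w => chartAt ℂ (k (τ z)) (k w)) (τ z) := by
    rw [← holAt_iff_analyticAt]
    exact HolAt.comp (g := chartAt ℂ (k (τ z))) (f := k) (holAt_chartAt (mem_chart_source ℂ _)) hk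
  have h2 := deriv_comp z h1.differentiableAt hτ.differentiableAt
  rw [coef, coef, mul_assoc, ← h2]
  rfl

lemma coef_eq_coef_chart (η : X → ℂ) {k : ℂ → X} {z : ℂ} {y : X} (hk : HolAt k z)
    (hy : k z ∈ (chartAt ℂ y).source) : coef η k z =
      coef η (chartAt ℂ y).symm (chartAt ℂ y (k z)) * deriv (fun w => chartAt ℂ y (k w)) z := by
  have h1 : AnalyticAt ℂ (fun w => chartAt ℂ y (k w)) z := by
    rw [← holAt_iff_analyticAt]
    exact HolAt.comp (g := chartAt ℂ y) (f := k) (holAt_chartAt hy) hk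
  rw [← coef_comp η (τ := fun w => chartAt ℂ y (k w))
    (holAt_chartAt_symm ((chartAt ℂ y).map_source hy)) h1]
  refine coef_congr η ?_
  filter_upwards [hk.continuousAt.eventually ((chartAt ℂ y).open_source.mem_nhds hy)] with w hw
  exact ((chartAt ℂ y).left_inv hw).symm

lemma deriv_transition_ne_zero {x y : X} {z : ℂ} (hz : z ∈ (chartAt ℂ x).target)
    (hy : (chartAt ℂ x).symm z ∈ (chartAt ℂ y).source) :
    deriv (fun w => chartAt ℂ y ((chartAt ℂ x).symm w)) z ≠ 0 := by
  have h1 := Frame.analyticAt_transition hz hy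
  have h2 : AnalyticAt ℂ (fun w => chartAt ℂ x ((chartAt ℂ y).symm w))
      (chartAt ℂ y ((chartAt ℂ x).symm z)) :=
    Frame.analyticAt_transition ((chartAt ℂ y).map_source hy) (by
      rw [(chartAt ℂ y).left_inv hy]; exact (chartAt ℂ x).map_target hz)
  have h3 := deriv_comp z h2.differentiableAt h1.differentiableAt
  have h4 : ((fun w => chartAt ℂ x ((chartAt ℂ y).symm w)) ∘
      fun w => chartAt ℂ y ((chartAt ℂ x).symm w)) =ᶠ[𝓝 z] id := by
    filter_upwards [(chartAt ℂ x).open_target.mem_nhds hz, ((chartAt ℂ x).continuousAt_symm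
      hz).eventually ((chartAt ℂ y).open_source.mem_nhds hy)] with w hw1 hw2
    simp only [Function.comp_apply, id]
    rw [(chartAt ℂ y).left_inv hw2, (chartAt ℂ x).right_inv hw1]
  rw [h4.deriv_eq, deriv_id] at h3
  intro h
  rw [h, mul_zero] at h3
  exact one_ne_zero h3

/-- The form `η` is meromorphic and nowhere locally zero. -/
def IsMeroForm (η : X → ℂ) : Prop := ∀ x, MeromorphicAt (coef η (chartAt ℂ x).symm) (chartAt ℂ x x) ∧
  meromorphicOrderAt (coef η (chartAt ℂ x).symm) (chartAt ℂ x x) ≠ ⊤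

/-- The order of the meromorphic form `η` at `x`. -/
noncomputable def formOrd (η : X → ℂ) (x : X) : ℤ :=
  (meromorphicOrderAt (coef η (chartAt ℂ x).symm) (chartAt ℂ x x)).untop₀

/-- Substituting a map of order d multiplies the order of the coefficient by d, and the factor dz
contributes the order d - 1 of the derivative. -/
lemma meromorphicOrderAt_coef {η : X → ℂ} (hη : IsMeroForm η) {k : ℂ → X} {z : ℂ} {y : X} (hy : k z = y)
    (hk : HolAt k z) {d : ℕ}
    (hd : analyticOrderAt (fun w => chartAt ℂ y (k w) - chartAt ℂ y y) z = d) :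
    MeromorphicAt (coef η k) z ∧
      meromorphicOrderAt (coef η k) z = ((d * formOrd η y + (d - 1) : ℤ) : WithTop ℤ) := by
  set v : ℂ → ℂ := fun w => chartAt ℂ y (k w) with hv
  have hys : k z ∈ (chartAt ℂ y).source := by rw [hy]; exact mem_chart_source ℂ y
  have hva : AnalyticAt ℂ v z := by
    rw [← holAt_iff_analyticAt]
    exact HolAt.comp (g := chartAt ℂ y) (f := k) (holAt_chartAt hys) hk
  have hvz : v z = chartAt ℂ y y := by rw [hv]; simp only [hy]
  have hd' : analyticOrderAt (fun w => v w - v z) z = d := by rw [hvz]; exact hd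
  have h1 : coef η k =ᶠ[𝓝 z] (coef η (chartAt ℂ y).symm ∘ v) * deriv v := by
    filter_upwards [hk.eventually, hk.continuousAt.eventually
      ((chartAt ℂ y).open_source.mem_nhds hys)] with w hw hws
    exact coef_eq_coef_chart η hw hws
  have h1' := h1.filter_mono (nhdsWithin_le_nhds (s := {z}ᶜ))
  have hm : MeromorphicAt (coef η (chartAt ℂ y).symm) (v z) := by rw [hvz]; exact (hη y).1
  have hmc := hm.comp_analyticAt hva
  have hdm := hva.deriv.meromorphicAt
  have hnc : ¬ EventuallyConst v (𝓝 z) := by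
    rw [eventuallyConst_iff_analyticOrderAt_sub_eq_top, hd']
    exact ENat.natCast_ne_top d
  have hder : meromorphicOrderAt (deriv v) z = ((d - 1 : ℤ) : WithTop ℤ) := by
    have h2 := hva.analyticOrderAt_deriv_add_one
    rw [hd'] at h2
    obtain ⟨e, he⟩ : ∃ e : ℕ, analyticOrderAt (deriv v) z = e := by
      refine ⟨(analyticOrderAt (deriv v) z).toNat, (ENat.natCast_toNat ?_).symm⟩
      intro h
      rw [h, top_add] at h2
      exact ENat.natCast_ne_top d h2.symm
    rw [he] at h2
    have h3 : e + 1 = d := by exact_mod_cast h2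
    rw [hva.deriv.meromorphicOrderAt_eq, he, ENat.map_natCast, ← h3]
    simp
  refine ⟨(hmc.mul hdm).congr h1'.symm, ?_⟩
  rw [meromorphicOrderAt_congr h1', meromorphicOrderAt_mul hmc hdm, hm.meromorphicOrderAt_comp hva hnc,
    hd', hder, hvz, ← WithTop.coe_untop₀_of_ne_top (hη y).2, ENat.map_natCast, WithTop.coe_add,
    mul_comm, WithTop.coe_mul]
  rfl

/-- The quotient of `f^* η` by `η`. -/
noncomputable def pullbackRatio (f : X → X) (η : X → ℂ) (y : X) : ℂ :=
  coef η (fun w => f ((chartAt ℂ y).symm w)) (chartAt ℂ y y) /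
    coef η (chartAt ℂ y).symm (chartAt ℂ y y)

/-- Both forms pick up the same transition factor, so their quotient is a function that can be
computed in any chart. -/
lemma pullbackRatio_symm {f : X → X} (hf : MDifferentiable 𝓘(ℂ) 𝓘(ℂ) f) (η : X → ℂ) {x : X} {z : ℂ}
    (hz : z ∈ (chartAt ℂ x).target) : pullbackRatio f η ((chartAt ℂ x).symm z) =
      coef η (fun w => f ((chartAt ℂ x).symm w)) z / coef η (chartAt ℂ x).symm z := by
  set y := (chartAt ℂ x).symm z with hy
  have hys : (chartAt ℂ x).symm z ∈ (chartAt ℂ y).source := mem_chart_source ℂ y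
  set τ : ℂ → ℂ := fun w => chartAt ℂ y ((chartAt ℂ x).symm w) with hτ
  have hτa : AnalyticAt ℂ τ z := Frame.analyticAt_transition hz hys
  have hτz : τ z = chartAt ℂ y y := by simp only [hτ, ← hy]
  have hτ0 : deriv τ z ≠ 0 := deriv_transition_ne_zero hz hys
  have h1 : (chartAt ℂ x).symm =ᶠ[𝓝 z] fun w => (chartAt ℂ y).symm (τ w) := by
    filter_upwards [((chartAt ℂ x).continuousAt_symm hz).eventually
      ((chartAt ℂ y).open_source.mem_nhds hys)] with w hw
    exact ((chartAt ℂ y).left_inv hw).symm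
  have hs : HolAt (chartAt ℂ y).symm (τ z) := by
    rw [hτz]; exact holAt_chartAt_symm (mem_chart_target ℂ y)
  have h2 : coef η (chartAt ℂ x).symm z = coef η (chartAt ℂ y).symm (τ z) * deriv τ z := by
    rw [coef_congr η h1, coef_comp η hs hτa]
  have h3 : coef η (fun w => f ((chartAt ℂ x).symm w)) z =
      coef η (fun w => f ((chartAt ℂ y).symm w)) (τ z) * deriv τ z := by
    rw [← coef_comp η (k := fun w => f ((chartAt ℂ y).symm w)) (HolAt.comp (g := f)
      (f := (chartAt ℂ y).symm) (hf.holAt _) hs) hτa]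
    exact coef_congr η (h1.mono fun w hw => by simp only; rw [hw])
  rw [h2, h3, mul_div_mul_right _ _ hτ0, pullbackRatio, hτz]

lemma pullbackRatio_data {f : X → X} (hf : IsHolEndo f) {η : X → ℂ} (hη : IsMeroForm η) (x : X) :
    (MeromorphicAt (fun z => pullbackRatio f η ((chartAt ℂ x).symm z)) (chartAt ℂ x x) ∧
      meromorphicOrderAt (fun z => pullbackRatio f η ((chartAt ℂ x).symm z)) (chartAt ℂ x x) ≠ ⊤) ∧
    meroOrd (pullbackRatio f η) x =
      localDegree f x * formOrd η (f x) + (localDegree f x - 1) - formOrd η x := by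
  have e1 : (chartAt ℂ x).symm (chartAt ℂ x x) = x := (chartAt ℂ x).left_inv (mem_chart_source ℂ x)
  have hk : HolAt (fun w => f ((chartAt ℂ x).symm w)) (chartAt ℂ x x) :=
    HolAt.comp (g := f) (f := (chartAt ℂ x).symm) (hf.hol.holAt _)
      (holAt_chartAt_symm (mem_chart_target ℂ x))
  obtain ⟨h1, h2⟩ := meromorphicOrderAt_coef hη (y := f x) (d := localDegree f x)
    (by simp only [e1]) hk (localDegree_cast hf.nc x).symm
  have h3 : (fun z => pullbackRatio f η ((chartAt ℂ x).symm z)) =ᶠ[𝓝[≠] (chartAt ℂ x x)]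
      coef η (fun w => f ((chartAt ℂ x).symm w)) * (coef η (chartAt ℂ x).symm)⁻¹ := by
    filter_upwards [mem_nhdsWithin_of_mem_nhds
      ((chartAt ℂ x).open_target.mem_nhds (mem_chart_target ℂ x))] with z hz
    rw [pullbackRatio_symm hf.hol η hz, div_eq_mul_inv]
    rfl
  have h4 : meromorphicOrderAt (fun z => pullbackRatio f η ((chartAt ℂ x).symm z)) (chartAt ℂ x x) =
      ((localDegree f x * formOrd η (f x) + (localDegree f x - 1) - formOrd η x : ℤ) : WithTop ℤ) := by
    rw [meromorphicOrderAt_congr h3, meromorphicOrderAt_mul h1 (hη x).1.inv, meromorphicOrderAt_inv, h2,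
      ← WithTop.coe_untop₀_of_ne_top (hη x).2]
    rfl
  refine ⟨⟨(h1.mul (hη x).1.inv).congr h3.symm, ?_⟩, ?_⟩
  · rw [h4]; exact WithTop.coe_ne_top
  · rw [meroOrd, h4, WithTop.untop₀_coe]

variable [CompactSpace X] [T2Space X]

lemma finite_formOrd_ne_zero {η : X → ℂ} (hη : IsMeroForm η) : {x | formOrd η x ≠ 0}.Finite := by
  refine finite_of_forall_eventually fun x => ?_
  have h1 := ((hη x).1.eventually_analyticAt).and
    ((meromorphicOrderAt_ne_top_iff_eventually_ne_zero (hη x).1).1 (hη x).2)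
  filter_upwards [(tendsto_chartAt_nhdsNE x).eventually h1,
    mem_nhdsWithin_of_mem_nhds ((chartAt ℂ x).open_source.mem_nhds (mem_chart_source ℂ x))]
    with y hy hys
  have hzt := (chartAt ℂ x).map_source hys
  have e1 := (chartAt ℂ x).left_inv hys
  have hys' : (chartAt ℂ x).symm (chartAt ℂ x y) ∈ (chartAt ℂ y).source := by
    rw [e1]; exact mem_chart_source ℂ y
  have h2 := (Frame.analyticAt_transition hzt hys').analyticOrderAt_sub_eq_one_of_deriv_ne_zero
    (deriv_transition_ne_zero hzt hys')
  simp only [e1] at h2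
  have h3 := (meromorphicOrderAt_coef hη e1 (holAt_chartAt_symm hzt) (d := 1) (by exact_mod_cast h2)).2
  rw [hy.1.meromorphicOrderAt_eq, hy.1.analyticOrderAt_eq_zero.2 hy.2] at h3
  have h4 : ((0 : ℤ) : WithTop ℤ) = ((1 * formOrd η y + (1 - 1) : ℤ) : WithTop ℤ) := by
    simpa using h3
  have h5 := WithTop.coe_injective h4
  simp only [not_not]
  omega

/-- The Riemann–Hurwitz formula. -/
theorem riemann_hurwitz [ConnectedSpace X] {f : X → X} (hf : IsHolEndo f) {η : X → ℂ}
    (hη : IsMeroForm η) : ∑ x ∈ (finite_critical hf).toFinset, ((localDegree f x : ℤ) - 1) =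
      (1 - (topologicalDegree f : ℤ)) * ∑ x ∈ (finite_formOrd_ne_zero hη).toFinset, formOrd η x := by
  classical
  set O := (finite_formOrd_ne_zero hη).toFinset
  set C := (finite_critical hf).toFinset
  set F := O.biUnion fun y => (finite_fiber hf y).toFinset
  have hO : ∀ x ∉ O, formOrd η x = 0 := fun x hx => by simpa [O] using hx
  have hC : ∀ x ∉ C, localDegree f x = 1 := fun x hx => by simpa [C] using hx
  have hF : ∀ x ∉ F, formOrd η (f x) = 0 := fun x hx => hO _ fun h =>
    hx (Finset.mem_biUnion.2 ⟨f x, h, by simp⟩)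
  have hm : IsMero (pullbackRatio f η) := fun x => (pullbackRatio_data hf hη x).1
  have hs := sum_meroOrd_eq_zero hm (P := O ∪ F ∪ C) fun x hx => by
    simp only [Finset.mem_union, not_or] at hx
    rw [(pullbackRatio_data hf hη x).2, hO x hx.1.1, hF x hx.1.2, hC x hx.2]
    simp
  simp only [fun x => (pullbackRatio_data hf hη x).2] at hs
  rw [Finset.sum_sub_distrib, Finset.sum_add_distrib] at hs
  -- Grouping by fibres, each zero or pole of η is counted λ times.
  have h1 : ∑ x ∈ O ∪ F ∪ C, (localDegree f x : ℤ) * formOrd η (f x) =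
      topologicalDegree f * ∑ y ∈ O, formOrd η y := by
    rw [← Finset.sum_subset (Finset.subset_union_right.trans Finset.subset_union_left :
      F ⊆ O ∪ F ∪ C) fun x _ hx => by rw [hF x hx, mul_zero]]
    rw [Finset.sum_biUnion, Finset.mul_sum]
    · refine Finset.sum_congr rfl fun y _ => ?_
      rw [← sum_localDegree hf y, Nat.cast_sum, Finset.sum_mul]
      refine Finset.sum_congr rfl fun x hx => ?_
      have : f x = y := by simpa using hx
      rw [this]
    · intro y _ y' _ hne
      rw [Function.onFun, Finset.disjoint_left]
      intro x hx hx'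
      have h2 : f x = y := by simpa using hx
      have h3 : f x = y' := by simpa using hx'
      exact hne (h2.symm.trans h3)
  have h2 : ∑ x ∈ O ∪ F ∪ C, ((localDegree f x : ℤ) - 1) = ∑ x ∈ C, ((localDegree f x : ℤ) - 1) :=
    (Finset.sum_subset Finset.subset_union_right fun x _ hx => by rw [hC x hx]; simp).symm
  have h3 : ∑ x ∈ O ∪ F ∪ C, formOrd η x = ∑ x ∈ O, formOrd η x :=
    (Finset.sum_subset (Finset.subset_union_left.trans Finset.subset_union_left)
      fun x _ hx => hO x hx).symm
  rw [h1, h2, h3] at hs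
  linear_combination hs

/-- The points near which η vanishes form a clopen set that misses `p`, so it is empty. -/
lemma isMeroForm_of_order [PreconnectedSpace X] {η : X → ℂ}
    (h : ∀ x, MeromorphicAt (coef η (chartAt ℂ x).symm) (chartAt ℂ x x)) {p : X}
    (hp : meromorphicOrderAt (coef η (chartAt ℂ p).symm) (chartAt ℂ p p) ≠ ⊤) : IsMeroForm η := by
  have key : ∀ x, ∀ᶠ y in 𝓝[≠] x, (coef η (chartAt ℂ x).symm (chartAt ℂ x y) = 0 ↔ η y = 0) := by
    intro x
    filter_upwards [mem_nhdsWithin_of_mem_nhds ((chartAt ℂ x).open_source.mem_nhds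
      (mem_chart_source ℂ x))] with y hys
    have e1 := (chartAt ℂ x).left_inv hys
    have h1 : deriv (fun w => chartAt ℂ y ((chartAt ℂ x).symm w)) (chartAt ℂ x y) ≠ 0 :=
      deriv_transition_ne_zero ((chartAt ℂ x).map_source hys)
        (by rw [e1]; exact mem_chart_source ℂ y)
    rw [coef, e1, mul_eq_zero, or_iff_left h1]
  have hz : ∀ x, (∀ᶠ y in 𝓝[≠] x, η y = 0) ∨ ∀ᶠ y in 𝓝[≠] x, η y ≠ 0 := fun x => by
    refine (h x).eventually_eq_zero_or_eventually_ne_zero.imp (fun h1 => ?_) fun h1 => ?_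
    · filter_upwards [key x, (tendsto_chartAt_nhdsNE x).eventually h1] with y h2 h3 using h2.1 h3
    · filter_upwards [key x, (tendsto_chartAt_nhdsNE x).eventually h1] with y h2 h3 using
        fun h4 => h3 (h2.2 h4)
  have hev : ∀ (x : X) (P : X → Prop), (∀ᶠ y in 𝓝[≠] x, P y) →
      ∀ᶠ y in 𝓝[≠] x, ∀ᶠ w in 𝓝[≠] y, P w := fun x P hP => by
    filter_upwards [eventually_eventually_nhdsWithin.2 hP, self_mem_nhdsWithin] with y hy hyx
    rw [isOpen_compl_singleton.nhdsWithin_eq hyx] at hy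
    exact hy.filter_mono nhdsWithin_le_nhds
  have hnhds : ∀ (x : X) (P : X → Prop), P x → (∀ᶠ y in 𝓝[≠] x, P y) → ∀ᶠ y in 𝓝 x, P y :=
    fun x P h0 hP => by
      rw [eventually_nhdsWithin_iff] at hP
      filter_upwards [hP] with y hy
      by_cases hyx : y = x
      · rwa [hyx]
      · exact hy hyx
  have hclopen : IsClopen {x | ∀ᶠ y in 𝓝[≠] x, η y = 0} := by
    constructor
    · rw [← isOpen_compl_iff, isOpen_iff_eventually]
      intro x hx
      refine hnhds x (fun y => y ∈ {x | ∀ᶠ y in 𝓝[≠] x, η y = 0}ᶜ) hx ?_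
      filter_upwards [hev x _ ((hz x).resolve_left hx)] with y hy hy'
      obtain ⟨w, h1, h2⟩ := (Eventually.and hy hy').exists
      exact h1 h2
    · rw [isOpen_iff_eventually]
      exact fun x hx => hnhds x _ hx (hev x _ hx)
  have hpn : p ∉ {x | ∀ᶠ y in 𝓝[≠] x, η y = 0} := fun h1 => hp (by
    rw [meromorphicOrderAt_eq_top_iff]
    have h1 : ∀ᶠ y in 𝓝[≠] p, η y = 0 := h1
    have h2 := (tendsto_chartAt_symm_nhdsNE p).eventually (h1.and (key p))
    filter_upwards [h2, mem_nhdsWithin_of_mem_nhds ((chartAt ℂ p).open_target.mem_nhds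
      (mem_chart_target ℂ p))] with z h3 hz
    rw [(chartAt ℂ p).right_inv hz] at h3
    exact h3.2.2 h3.1)
  have hempty : {x | ∀ᶠ y in 𝓝[≠] x, η y = 0} = ∅ :=
    (isClopen_iff.1 hclopen).resolve_right fun h1 => hpn (h1 ▸ mem_univ p)
  refine fun x => ⟨h x, fun h1 => ?_⟩
  rw [meromorphicOrderAt_eq_top_iff] at h1
  have h2 : x ∈ {x | ∀ᶠ y in 𝓝[≠] x, η y = 0} := by
    filter_upwards [key x, (tendsto_chartAt_nhdsNE x).eventually h1] with y h2 h3 using h2.1 h3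
  rw [hempty] at h2
  exact h2

/-- The double pole contributes -2 and all other orders are nonnegative. The exact value 2g - 2 is
not needed. -/
lemma exists_isMeroForm [ConnectedSpace X] : ∃ η : X → ℂ, ∃ hη : IsMeroForm η,
    -2 ≤ ∑ x ∈ (finite_formOrd_ne_zero hη).toFinset, formOrd η x := by
  obtain ⟨p⟩ : Nonempty X := inferInstance
  obtain ⟨η, h1, b, hb, h2⟩ := exists_meromorphic_form p
  have h3 : MeromorphicAt (coef η (chartAt ℂ p).symm) (chartAt ℂ p p) :=
    (hb.meromorphicAt.add (((MeromorphicAt.id _).sub (MeromorphicAt.const _ _)).pow 2).inv).congr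
      (h2.mono fun z hz => hz.symm)
  have h4 : meromorphicOrderAt (coef η (chartAt ℂ p).symm) (chartAt ℂ p p) = (-2 : ℤ) := by
    rw [meromorphicOrderAt_eq_int_iff h3]
    refine ⟨fun z => b z * (z - chartAt ℂ p p) ^ 2 + 1, ?_, by simp, ?_⟩
    · exact (hb.mul ((analyticAt_id.sub analyticAt_const).pow 2)).add analyticAt_const
    · filter_upwards [h2, self_mem_nhdsWithin] with z hz hz0
      have h5 : z - chartAt ℂ p p ≠ 0 := sub_ne_zero.2 hz0
      rw [hz, smul_eq_mul, zpow_neg]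
      have h6 : (z - chartAt ℂ p p) ^ (2 : ℤ) = (z - chartAt ℂ p p) ^ 2 := zpow_natCast _ 2
      rw [h6]
      field_simp
  have hη : IsMeroForm η := isMeroForm_of_order (fun x => by
    rcases eq_or_ne x p with rfl | hx
    · exact h3
    · obtain ⟨b, hb, hbe⟩ := h1 x hx
      exact hb.meromorphicAt.congr (hbe.filter_mono nhdsWithin_le_nhds |>.mono fun z hz => hz.symm))
    (p := p) (by rw [h4]; exact WithTop.coe_ne_top)
  have hop : formOrd η p = -2 := by rw [formOrd, h4, WithTop.untop₀_coe]
  have hox : ∀ x ≠ p, 0 ≤ formOrd η x := fun x hx => by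
    obtain ⟨b, hb, hbe⟩ := h1 x hx
    rw [formOrd, WithTop.untop₀_nonneg,
      meromorphicOrderAt_congr (hbe.filter_mono nhdsWithin_le_nhds : _ =ᶠ[𝓝[≠] _] b)]
    exact hb.meromorphicOrderAt_nonneg
  refine ⟨η, hη, ?_⟩
  have hpO : p ∈ (finite_formOrd_ne_zero hη).toFinset := by simp [hop]
  classical
  rw [← Finset.add_sum_erase _ _ hpO, hop]
  have := Finset.sum_nonneg (s := (finite_formOrd_ne_zero hη).toFinset.erase p)
    (f := formOrd η) fun x hx => hox x (Finset.ne_of_mem_erase hx)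
  omega

/-- A holomorphic self-map of degree at least two has at most two totally ramified points. -/
theorem encard_totallyRamified_le [ConnectedSpace X] {f : X → X} (hf : IsHolEndo f)
    (h2 : 2 ≤ topologicalDegree f) : (totallyRamified f).encard ≤ 2 := by
  obtain ⟨η, hη, hs⟩ := exists_isMeroForm (X := X)
  have hRH := riemann_hurwitz hf hη
  have hsub : totallyRamified f ⊆ {x | localDegree f x ≠ 1} := fun x hx h => by
    have hx : localDegree f x = topologicalDegree f := hx
    have h : localDegree f x = 1 := h
    omega
  have hfin : (totallyRamified f).Finite := (finite_critical hf).subset hsub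
  have h3 : ∑ x ∈ hfin.toFinset, ((localDegree f x : ℤ) - 1) ≤
      ∑ x ∈ (finite_critical hf).toFinset, ((localDegree f x : ℤ) - 1) := by
    refine Finset.sum_le_sum_of_subset_of_nonneg (by simpa using hsub) fun x _ _ => ?_
    have := Nat.pos_of_ne_zero (localDegree_ne_zero hf.hol hf.nc x)
    omega
  have h4 : ∑ x ∈ hfin.toFinset, ((localDegree f x : ℤ) - 1) =
      hfin.toFinset.card * ((topologicalDegree f : ℤ) - 1) := by
    rw [Finset.sum_congr rfl (g := fun _ => (topologicalDegree f : ℤ) - 1), Finset.sum_const,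
      nsmul_eq_mul]
    intro x hx
    have hx : localDegree f x = topologicalDegree f := by simpa [totallyRamified] using hx
    rw [hx]
  -- N totally ramified points give N(λ - 1) ≤ (1 - λ) deg η ≤ 2(λ - 1), and λ - 1 is positive.
  have h5 : (hfin.toFinset.card : ℤ) ≤ 2 := by
    have h6 : (0 : ℤ) < (topologicalDegree f : ℤ) - 1 := by omega
    nlinarith
  rw [hfin.encard_eq_coe_toFinset_card]
  exact_mod_cast h5

end RiemannHurwitz

end HolomorphicDynamics

theorem mainTheorem10 {X : Type*} [TopologicalSpace X] [T2Space X] [CompactSpace X]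
    [ConnectedSpace X] [ChartedSpace ℂ X] [IsManifold 𝓘(ℂ) ω X]
    [MeasurableSpace X] [BorelSpace X]
    (f : X → X) (hf : MDifferentiable 𝓘(ℂ) 𝓘(ℂ) f)
    (hdeg : 2 ≤ HolomorphicDynamics.topologicalDegree f) :
    (∃! μ : Measure X, HolomorphicDynamics.IsCanonicalMeasure f μ) ∧
    HolomorphicDynamics.IsCanonicalMeasure f (HolomorphicDynamics.canonicalMeasure f) ∧
    (HolomorphicDynamics.exceptionalSet f).encard ≤ 2 ∧
    (∀ ν : Measure X, IsProbabilityMeasure ν →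
      (HolomorphicDynamics.WeakTendsto
          (fun n => HolomorphicDynamics.normalizedPullback f n ν)
          (HolomorphicDynamics.canonicalMeasure f) ↔
        ν (HolomorphicDynamics.exceptionalSet f) = 0)) ∧
    (∀ a : X,
      HolomorphicDynamics.WeakTendsto
          (fun n => HolomorphicDynamics.normalizedPullback f n (Measure.dirac a))
          (HolomorphicDynamics.canonicalMeasure f) ↔
        a ∉ HolomorphicDynamics.exceptionalSet f) := by
  have hf' := HolomorphicDynamics.isHolEndo_of_degree hf hdeg
  have hT := HolomorphicDynamics.encard_totallyRamified_le hf' hdeg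
  exact HolomorphicDynamics.equidistribution_of_encard_le hf' hdeg hT
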